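/- Let $\Sigma$ be a compact connected Riemann surface with an anti-holomorphic involution $f:\Sigma\to\Sigma$. Let $V\to\Sigma$ be a smooth complex vector bundle with a Hermitian metric, and let $(\bar\partial_A,\Phi)$ be a solution of the Hitchin equations $$F_A+[\Phi,\Phi^*]=0,\qquad \bar\partial_A\Phi=0$$ on $V$. Here $\nabla_A$ is the unitary connection with $(0,1)$-part $\bar\partial_A$, $F_A$ is its curvature, and $\Phi$ is an $\mathrm{End}(V)$-valued $(1,0)$-form. Let $\nabla=\nabla_A+\Phi+\Phi^*$ be the associated flat connection. Suppose that $\nabla$ is simple (its only covariantly constant endomorphisms are the multiples of the identity), and that $\varphi:V\to V$ is a smooth, fibrewise complex linear lift of $f$ with $\varphi^2=1$ which preserves $\nabla$. Let $M=(\Sigma\times[-1,1])/\tau$, where $\tau(x,t)=(f(x),-t)$; $M$ is a topological $3$-manifold with boundary $\Sigma$ (via $x\mapsto[(x,1)]$). Say that $\nabla$ extends over $M$ if there is a flat complex vector bundle on $M$ (a bundle with locally constant transition functions) whose restriction to $\partial M=\Sigma$ is isomorphic to $(V,\nabla)$ as a flat bundle. Let $K^0_{\mathbb Z_2}(\Sigma)$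 be the Grothendieck group of complex vector bundles on $\Sigma$ with an involutive linear lift of $f$, let $\tilde K^0_{\mathbb Z_2}(\Sigma)$ be its quotient by the subgroup $\mathbb Z$ generated by the trivial line bundle with the lift $(x,v)\mapsto(f(x),v)$, and let $[V,\psi]\in\tilde K^0_{\mathbb Z_2}(\Sigma)$ be the class of $V$ with a lift $\psi$. 1. If $f$ has a fixed point, then $\nabla$ extends over $M$ if and only if $[V,\varphi]=0$ or $[V,-\varphi]=0$ in $\tilde K^0_{\mathbb Z_2}(\Sigma)$. 2. Whether or not $f$ has fixed points, if $[V,\varphi]=0$ or $[V,-\varphi]=0$ in $\tilde K^0_{\mathbb Z_2}(\Sigma)$, then $\nabla$ extends over $M$. -/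

import Mathlib

open scoped Manifold ContDiff Topology

/-! ### Equivariant K-theory of a space with involution -/

/-- A continuous involution of a topological space, i.e. a continuous `ℤ/2`-action. -/
structure TopInvolution (X : Type*) [TopologicalSpace X] where
  /-- the underlying map -/
  toFun : X → X
  continuous_toFun : Continuous toFun
  involutive : Function.Involutive toFun

instance {X : Type*} [TopologicalSpace X] : CoeFun (TopInvolution X) (fun _ => X → X) :=
  ⟨TopInvolution.toFun⟩

/-- A `ℤ/2`-equivariant complex vector bundle of finite (constant) rank over `(X, f)`: a complex
vector bundle `E → X`, in Mathlib's sense, with a lift of `f` to a continuous, fibrewise linear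
involution `φ` of the total space. -/
structure EqBundle {X : Type*} [TopologicalSpace X] (f : TopInvolution X) where
  /-- the model fibre -/
  F : Type
  [normF : NormedAddCommGroup F]
  [spaceF : NormedSpace ℂ F]
  [finF : FiniteDimensional ℂ F]
  /-- the fibres -/
  E : X → Type
  [addE : ∀ x, AddCommGroup (E x)]
  [modE : ∀ x, Module ℂ (E x)]
  [topE : ∀ x, TopologicalSpace (E x)]
  [topTotal : TopologicalSpace (Bundle.TotalSpace F E)]
  [fiberBundle : FiberBundle F E]
  [vectorBundle : VectorBundle ℂ F E]
  /-- the lift of the involution, fibre by fibre -/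
  φ : ∀ x, E x →ₗ[ℂ] E (f x)
  continuous_φ : Continuous
    (fun p : Bundle.TotalSpace F E => (⟨f p.1, φ p.1 p.2⟩ : Bundle.TotalSpace F E))
  involutive_φ : Function.Involutive
    (fun p : Bundle.TotalSpace F E => (⟨f p.1, φ p.1 p.2⟩ : Bundle.TotalSpace F E))

attribute [instance] EqBundle.normF EqBundle.spaceF EqBundle.finF EqBundle.addE EqBundle.modE
  EqBundle.topE EqBundle.topTotal EqBundle.fiberBundle EqBundle.vectorBundle

namespace EqBundle

variable {X : Type*} [TopologicalSpace X] {f : TopInvolution X}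

/-- `V` and `W` are isomorphic as equivariant vector bundles. -/
def IsIso (V W : EqBundle f) : Prop :=
  ∃ e : ∀ x, V.E x ≃ₗ[ℂ] W.E x,
    Continuous (fun p : Bundle.TotalSpace V.F V.E =>
      (⟨p.1, e p.1 p.2⟩ : Bundle.TotalSpace W.F W.E)) ∧
    Continuous (fun p : Bundle.TotalSpace W.F W.E =>
      (⟨p.1, (e p.1).symm p.2⟩ : Bundle.TotalSpace V.F V.E)) ∧
    ∀ x v, e (f x) (V.φ x v) = W.φ x (e x v)

theorem IsIso.refl (V : EqBundle f) : IsIso V V :=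
  ⟨fun _ => LinearEquiv.refl ℂ _, continuous_id, continuous_id, fun _ _ => rfl⟩

theorem IsIso.symm {V W : EqBundle f} (h : IsIso V W) : IsIso W V := by
  obtain ⟨e, h1, h2, h3⟩ := h
  refine ⟨fun x => (e x).symm, h2, h1, fun x v => ?_⟩
  rw [LinearEquiv.symm_apply_eq, h3, LinearEquiv.apply_symm_apply]

theorem IsIso.trans {V W U : EqBundle f} (h : IsIso V W) (h' : IsIso W U) : IsIso V U := by
  obtain ⟨e, h1, h2, h3⟩ := h
  obtain ⟨e', h1', h2', h3'⟩ := h'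
  refine ⟨fun x => (e x).trans (e' x), h1'.comp h1, h2.comp h2', fun x v => ?_⟩
  simp [h3, h3']

/-- The trivial bundle `X × ℂⁿ` with the involution `(x, v) ↦ (f x, v)`. -/
noncomputable def trivial (f : TopInvolution X) (n : ℕ) : EqBundle f where
  F := Fin n → ℂ
  E := Bundle.Trivial X (Fin n → ℂ)
  φ _ := LinearMap.id
  continuous_φ := by
    have h := (Bundle.Trivial.homeomorphProd X (Fin n → ℂ)).symm.continuous.comp
      ((f.continuous_toFun.prodMap continuous_id).comp
        (Bundle.Trivial.homeomorphProd X (Fin n → ℂ)).continuous)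
    exact h
  involutive_φ := by
    rintro ⟨x, v⟩
    simp [f.involutive x]

theorem continuous_fst_total (V W : EqBundle f) :
    Continuous (fun p : Bundle.TotalSpace (V.F × W.F) (fun x => V.E x × W.E x) =>
      (⟨p.1, p.2.1⟩ : Bundle.TotalSpace V.F V.E)) :=
  continuous_fst.comp (FiberBundle.Prod.isInducing_diag V.F V.E W.F W.E).continuous

theorem continuous_snd_total (V W : EqBundle f) :
    Continuous (fun p : Bundle.TotalSpace (V.F × W.F) (fun x => V.E x × W.E x) =>
      (⟨p.1, p.2.2⟩ : Bundle.TotalSpace W.F W.E)) :=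
  continuous_snd.comp (FiberBundle.Prod.isInducing_diag V.F V.E W.F W.E).continuous

theorem continuous_prod_total (V W : EqBundle f) {Z : Type*} [TopologicalSpace Z] {b : Z → X}
    {v : ∀ z, V.E (b z)} {w : ∀ z, W.E (b z)}
    (hv : Continuous fun z => (⟨b z, v z⟩ : Bundle.TotalSpace V.F V.E))
    (hw : Continuous fun z => (⟨b z, w z⟩ : Bundle.TotalSpace W.F W.E)) :
    Continuous fun z =>
      (⟨b z, (v z, w z)⟩ : Bundle.TotalSpace (V.F × W.F) (fun x => V.E x × W.E x)) :=
  (FiberBundle.Prod.isInducing_diag V.F V.E W.F W.E).continuous_iff.2 (hv.prodMk hw)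

theorem total_prod_ext (V W : EqBundle f) {y x : X} {a : V.E y} {b : W.E y} {v : V.E x}
    {w : W.E x}
    (hv : (⟨y, a⟩ : Bundle.TotalSpace V.F V.E) = ⟨x, v⟩)
    (hw : (⟨y, b⟩ : Bundle.TotalSpace W.F W.E) = ⟨x, w⟩) :
    (⟨y, (a, b)⟩ : Bundle.TotalSpace (V.F × W.F) (fun x => V.E x × W.E x)) = ⟨x, (v, w)⟩ := by
  obtain rfl : y = x := congrArg Bundle.TotalSpace.proj hv
  cases hv
  cases hw
  rfl

/-- The direct sum of two equivariant vector bundles. -/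
noncomputable def directSum (V W : EqBundle f) : EqBundle f where
  F := V.F × W.F
  E := fun x => V.E x × W.E x
  fiberBundle := FiberBundle.prod V.F V.E W.F W.E
  vectorBundle := VectorBundle.prod ℂ V.F V.E W.F W.E
  φ x := (V.φ x).prodMap (W.φ x)
  continuous_φ := continuous_prod_total V W
    (V.continuous_φ.comp (continuous_fst_total V W))
    (W.continuous_φ.comp (continuous_snd_total V W))
  involutive_φ := by
    rintro ⟨x, v, w⟩
    exact total_prod_ext V W (V.involutive_φ ⟨x, v⟩) (W.involutive_φ ⟨x, w⟩)

theorem IsIso.directSum {V V' W W' : EqBundle f} (h : IsIso V V') (h' : IsIso W W') :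
    IsIso (V.directSum W) (V'.directSum W') := by
  obtain ⟨e, h1, h2, h3⟩ := h
  obtain ⟨e', h1', h2', h3'⟩ := h'
  refine ⟨fun x => (e x).prodCongr (e' x), ?_, ?_, ?_⟩
  · exact continuous_prod_total V' W' (h1.comp (continuous_fst_total V W))
      (h1'.comp (continuous_snd_total V W))
  · exact continuous_prod_total V W (h2.comp (continuous_fst_total V' W'))
      (h2'.comp (continuous_snd_total V' W'))
  · rintro x ⟨v, w⟩
    exact Prod.ext (h3 x v) (h3' x w)

theorem directSum_comm (V W : EqBundle f) : IsIso (V.directSum W) (W.directSum V) := by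
  refine ⟨fun x => LinearEquiv.prodComm ℂ (V.E x) (W.E x), ?_, ?_, fun _ _ => rfl⟩
  · exact continuous_prod_total W V (continuous_snd_total V W) (continuous_fst_total V W)
  · exact continuous_prod_total V W (continuous_snd_total W V) (continuous_fst_total W V)

theorem directSum_assoc (V W U : EqBundle f) :
    IsIso ((V.directSum W).directSum U) (V.directSum (W.directSum U)) := by
  refine ⟨fun x => LinearEquiv.prodAssoc ℂ (V.E x) (W.E x) (U.E x), ?_, ?_, fun _ _ => rfl⟩
  · exact continuous_prod_total V (W.directSum U)
      ((continuous_fst_total V W).comp (continuous_fst_total (V.directSum W) U))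
      (continuous_prod_total W U
        ((continuous_snd_total V W).comp (continuous_fst_total (V.directSum W) U))
        (continuous_snd_total (V.directSum W) U))
  · exact continuous_prod_total (V.directSum W) U
      (continuous_prod_total V W (continuous_fst_total V (W.directSum U))
        ((continuous_fst_total W U).comp (continuous_snd_total V (W.directSum U))))
      ((continuous_snd_total W U).comp (continuous_snd_total V (W.directSum U)))

theorem directSum_zero (V : EqBundle f) : IsIso (V.directSum (trivial f 0)) V := by
  refine ⟨fun x => LinearEquiv.prodUnique (R := ℂ) (M := V.E x) (M₂ := Fin 0 → ℂ),
    ?_, ?_, fun _ _ => rfl⟩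
  · exact continuous_fst_total V (trivial f 0)
  · refine continuous_prod_total V (trivial f 0) continuous_id ?_
    have h := (Bundle.Trivial.homeomorphProd X (Fin 0 → ℂ)).symm.continuous.comp
      ((FiberBundle.continuous_proj V.F V.E).prodMk
        (continuous_const (y := (0 : Fin 0 → ℂ))))
    refine h.congr fun p => ?_
    exact congrArg (fun w : Fin 0 → ℂ =>
      (⟨p.1, w⟩ : Bundle.TotalSpace (Fin 0 → ℂ) (Bundle.Trivial X (Fin 0 → ℂ))))
      (Subsingleton.elim _ _)

/-- Isomorphism of equivariant vector bundles as an equivalence relation. -/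
instance setoid (f : TopInvolution X) : Setoid (EqBundle f) where
  r := IsIso
  iseqv := ⟨IsIso.refl, IsIso.symm, IsIso.trans⟩

/-- The isomorphism classes of equivariant vector bundles over `(X, f)`. -/
def IsoClass (f : TopInvolution X) : Type _ := Quotient (setoid f)

/-- The isomorphism class of an equivariant vector bundle. -/
def isoClass (V : EqBundle f) : IsoClass f := Quotient.mk (setoid f) V

noncomputable instance (f : TopInvolution X) : Add (IsoClass f) :=
  ⟨Quotient.map₂ directSum (fun _ _ h _ _ h' => IsIso.directSum h h')⟩

noncomputable instance (f : TopInvolution X) : Zero (IsoClass f) :=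
  ⟨isoClass (trivial f 0)⟩

/-- The commutative monoid of isomorphism classes under direct sum. -/
noncomputable instance (f : TopInvolution X) : AddCommMonoid (IsoClass f) where
  add_assoc := by
    rintro ⟨a⟩ ⟨b⟩ ⟨c⟩
    exact Quotient.sound (directSum_assoc a b c)
  add_comm := by
    rintro ⟨a⟩ ⟨b⟩
    exact Quotient.sound (directSum_comm a b)
  add_zero := by
    rintro ⟨a⟩
    exact Quotient.sound (directSum_zero a)
  zero_add := by
    rintro ⟨a⟩
    exact Quotient.sound ((directSum_comm _ _).trans (directSum_zero a))
  nsmul := nsmulRec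

end EqBundle

/-- `K⁰_{ℤ/2}(X)` for the action of `ℤ/2` on `X` through `f`: the Grothendieck group of
equivariant complex vector bundles. -/
abbrev EqK {X : Type*} [TopologicalSpace X] (f : TopInvolution X) : Type _ :=
  Algebra.GrothendieckAddGroup (EqBundle.IsoClass f)

/-- The class `[V] ∈ K⁰_{ℤ/2}(X)`. -/
noncomputable def EqBundle.kClass {X : Type*} [TopologicalSpace X] {f : TopInvolution X}
    (V : EqBundle f) : EqK f :=
  Algebra.GrothendieckAddGroup.of V.isoClass

/-- The reduced group `K̃⁰_{ℤ/2}(X) = K⁰_{ℤ/2}(X) / ℤ`, where `ℤ` is generated by the trivial line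
bundle with the trivial lift `(x, v) ↦ (f x, v)`. -/
abbrev ReducedEqK {X : Type*} [TopologicalSpace X] (f : TopInvolution X) : Type _ :=
  EqK f ⧸ AddSubgroup.zmultiples (EqBundle.trivial f 1).kClass

/-- The class of an equivariant vector bundle in `K̃⁰_{ℤ/2}(X)`. -/
noncomputable def EqBundle.reducedClass {X : Type*} [TopologicalSpace X] {f : TopInvolution X}
    (V : EqBundle f) : ReducedEqK f :=
  QuotientAddGroup.mk V.kClass

theorem EqBundle.continuous_neg_total {X F : Type*} {E : X → Type*} [TopologicalSpace X]
    [NormedAddCommGroup F] [NormedSpace ℂ F] [∀ x, AddCommGroup (E x)] [∀ x, Module ℂ (E x)]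
    [∀ x, TopologicalSpace (E x)] [TopologicalSpace (Bundle.TotalSpace F E)] [FiberBundle F E]
    [VectorBundle ℂ F E] :
    Continuous (fun p : Bundle.TotalSpace F E => (⟨p.1, -p.2⟩ : Bundle.TotalSpace F E)) := by
  rw [continuous_iff_continuousAt]
  intro p
  rw [FiberBundle.continuousAt_totalSpace]
  refine ⟨(FiberBundle.continuous_proj F E).continuousAt, ?_⟩
  set e := trivializationAt F E p.1 with he
  have hp : p.1 ∈ e.baseSet := FiberBundle.mem_baseSet_trivializationAt F E p.1
  have h1 : ContinuousAt (fun q : Bundle.TotalSpace F E => -(e q).2) p :=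
    (continuous_snd.continuousAt.comp
      (e.continuousAt (e.mem_source.2 hp))).neg
  refine h1.congr ?_
  have hU : ∀ᶠ q : Bundle.TotalSpace F E in 𝓝 p, q.1 ∈ e.baseSet :=
    (FiberBundle.continuous_proj F E).continuousAt.eventually (e.open_baseSet.mem_nhds hp)
  filter_upwards [hU] with q hq
  have h := (e.linear ℂ hq).map_neg q.2
  exact h.symm

/-- The same bundle with the lift `φ` replaced by `-φ`. -/
def EqBundle.neg {X : Type*} [TopologicalSpace X] {f : TopInvolution X} (V : EqBundle f) :
    EqBundle f :=
  { V with
    φ := fun x => -V.φ x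
    continuous_φ := EqBundle.continuous_neg_total.comp V.continuous_φ
    involutive_φ := fun p => by
      have h := V.involutive_φ p
      simpa using h }

/-! ### Smooth complex vector bundles over a Riemann surface -/

/-- A Riemann surface is a smooth real surface. -/
instance isManifold_real {X : Type*} [TopologicalSpace X] [ChartedSpace ℂ X]
    [h : IsManifold 𝓘(ℂ) ω X] : IsManifold 𝓘(ℝ, ℂ) ω X := by
  refine isManifold_of_contDiffOn _ _ _ fun e e' he he' => ?_
  have h1 := (contDiffGroupoid ω 𝓘(ℂ)).compatible he he'
  exact ContDiffOn.restrict_scalars ℝ h1.1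

theorem trivialization_isLinear_real {X F : Type*} {E : X → Type*} [TopologicalSpace X]
    [NormedAddCommGroup F] [NormedSpace ℂ F] [∀ x, NormedAddCommGroup (E x)]
    [∀ x, InnerProductSpace ℂ (E x)]
    [TopologicalSpace (Bundle.TotalSpace F E)] [FiberBundle F E] [VectorBundle ℂ F E]
    (e : Bundle.Trivialization F (Bundle.TotalSpace.proj : Bundle.TotalSpace F E → X))
    [MemTrivializationAtlas e] : e.IsLinear ℝ := by
  refine ⟨fun b hb => ?_⟩
  have h := e.linear ℂ hb
  exact ⟨h.map_add, fun c x => h.map_smul (c : ℂ) x⟩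

/-- A complex vector bundle is in particular a real vector bundle. -/
instance vectorBundle_real {X F : Type*} {E : X → Type*} [TopologicalSpace X]
    [NormedAddCommGroup F] [NormedSpace ℂ F] [∀ x, NormedAddCommGroup (E x)]
    [∀ x, InnerProductSpace ℂ (E x)]
    [TopologicalSpace (Bundle.TotalSpace F E)] [FiberBundle F E]
    [h : VectorBundle ℂ F E] : VectorBundle ℝ F E where
  trivialization_linear' e _ := trivialization_isLinear_real e
  continuousOn_coordChange' e e' _ _ := by
    have : e.IsLinear ℝ := trivialization_isLinear_real e
    have : e'.IsLinear ℝ := trivialization_isLinear_real e'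
    have h := (ContinuousLinearMap.restrictScalarsL ℂ F F ℝ ℝ).continuous.comp_continuousOn
      (continuousOn_coordChange ℂ e e')
    refine h.congr fun b hb => ?_
    ext v
    exact (e.coordChangeL_apply (R := ℝ) e' hb v).trans
      (e.coordChangeL_apply (R := ℂ) e' hb v).symm

/-- An anti-holomorphic involution `f` of a Riemann surface: in holomorphic charts around `x` and
`f x`, the complex conjugate of `f` is complex differentiable at (every) `x`. -/
structure RealStructure (X : Type*) [TopologicalSpace X] [ChartedSpace ℂ X] extends
    TopInvolution X where
  antiholomorphic : ∀ x : X, DifferentiableAt ℂ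
    (fun z => (starRingEnd ℂ) (chartAt ℂ (toFun x) (toFun ((chartAt ℂ x).symm z)))) (chartAt ℂ x x)

instance {X : Type*} [TopologicalSpace X] [ChartedSpace ℂ X] :
    CoeFun (RealStructure X) (fun _ => X → X) :=
  ⟨fun f => f.toFun⟩

section Hitchin

variable {X : Type*} [TopologicalSpace X] [ChartedSpace ℂ X]
  {F : Type} [NormedAddCommGroup F] [NormedSpace ℂ F]

/-- The section `σ` of the bundle `V` is (real) differentiable at `x`. -/
def DiffSectionAt (F : Type) [NormedAddCommGroup F] [NormedSpace ℂ F] {V : X → Type}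
    [∀ x, TopologicalSpace (V x)] [TopologicalSpace (Bundle.TotalSpace F V)]
    [FiberBundle F V] (σ : ∀ x, V x) (x : X) : Prop :=
  MDifferentiableAt 𝓘(ℝ, ℂ) (𝓘(ℝ, ℂ).prod 𝓘(ℝ, F))
    (fun y => (⟨y, σ y⟩ : Bundle.TotalSpace F V)) x

/-- The section `σ` of the bundle `V` is (real) smooth at `x`. -/
def SmoothSectionAt (F : Type) [NormedAddCommGroup F] [NormedSpace ℂ F] {V : X → Type}
    [∀ x, TopologicalSpace (V x)] [TopologicalSpace (Bundle.TotalSpace F V)]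
    [FiberBundle F V] (σ : ∀ x, V x) (x : X) : Prop :=
  ContMDiffAt 𝓘(ℝ, ℂ) (𝓘(ℝ, ℂ).prod 𝓘(ℝ, F)) ∞
    (fun y => (⟨y, σ y⟩ : Bundle.TotalSpace F V)) x

/-- The complex structure `J` (multiplication by `i` in a holomorphic chart) on the real tangent
space at `x`. -/
def tangentJ (x : X) (v : TangentSpace 𝓘(ℝ, ℂ) x) : TangentSpace 𝓘(ℝ, ℂ) x :=
  (Complex.I * (show ℂ from v) : ℂ)

variable [IsManifold 𝓘(ℂ) ω X]

/-- The real vector field `Y` is smooth at `x`. -/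
def SmoothFieldAt (Y : ∀ x : X, TangentSpace 𝓘(ℝ, ℂ) x) (x : X) : Prop :=
  ContMDiffAt 𝓘(ℝ, ℂ) (𝓘(ℝ, ℂ).prod 𝓘(ℝ, ℂ)) ∞
    (fun y => (⟨y, Y y⟩ : TangentBundle 𝓘(ℝ, ℂ) X)) x

variable {V : X → Type} [∀ x, NormedAddCommGroup (V x)] [∀ x, InnerProductSpace ℂ (V x)]
  [∀ x, FiniteDimensional ℂ (V x)] [TopologicalSpace (Bundle.TotalSpace F V)] [FiberBundle F V]
  [VectorBundle ℂ F V]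

variable (F V) in
/-- A solution `(∂̄_A, Φ)` of the Hitchin equations on the smooth complex vector bundle `V` with the
Hermitian metric given by the inner products of the fibres. The holomorphic structure `∂̄_A` is
encoded by the associated unitary connection `∇_A`, of which it is the `(0,1)`-part. -/
structure HitchinSolution where
  /-- the Hermitian metric is smooth -/
  metric_smooth : ∀ (x : X) (σ τ : ∀ x, V x), SmoothSectionAt F σ x → SmoothSectionAt F τ x →
    ContMDiffAt 𝓘(ℝ, ℂ) 𝓘(ℝ, ℂ) ∞ (fun y => inner ℂ (σ y) (τ y)) x
  /-- the connection `∇_A`; `A σ x v` is `(∇_A)_v σ` at `x` -/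
  A : CovariantDerivative 𝓘(ℝ, ℂ) F V
  A_smooth : CovariantDerivative.ContMDiffCovariantDerivative A ∞
  A_linear : ∀ (x : X) (σ : ∀ x, V x), DiffSectionAt F σ x → ∀ v,
    A (fun y => Complex.I • σ y) x v = Complex.I • A σ x v
  /-- `∇_A` is unitary: `d⟨σ, τ⟩ = ⟨∇_A σ, τ⟩ + ⟨σ, ∇_A τ⟩` -/
  A_unitary : ∀ (x : X) (σ τ : ∀ x, V x), DiffSectionAt F σ x → DiffSectionAt F τ x → ∀ v,
    mvfderiv 𝓘(ℝ, ℂ) (fun y => inner ℂ (σ y) (τ y)) x v =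
      inner ℂ (A σ x v) (τ x) + inner ℂ (σ x) (A τ x v)
  /-- the Higgs field, an `End V`-valued one-form -/
  Φ : ∀ x : X, TangentSpace 𝓘(ℝ, ℂ) x →ₗ[ℝ] (V x →ₗ[ℂ] V x)
  Φ_smooth : ∀ (x : X) (Y : ∀ x : X, TangentSpace 𝓘(ℝ, ℂ) x) (σ : ∀ x, V x),
    SmoothFieldAt Y x → SmoothSectionAt F σ x → SmoothSectionAt F (fun y => Φ y (Y y) (σ y)) x
  /-- `Φ` is of type `(1,0)` -/
  Φ_type : ∀ (x : X) (v : TangentSpace 𝓘(ℝ, ℂ) x), Φ x (tangentJ x v) = Complex.I • Φ x v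
  /-- `F_A + [Φ, Φ^*] = 0`, evaluated on vector fields `Y, Z` and a section `σ`. Here
  `F_A(Y, Z) = [∇_Y, ∇_Z] - ∇_{[Y, Z]}` and, with `Φ^*(v) = Φ(v)^*`,
  `[Φ, Φ^*](Y, Z) = [Φ(Y), Φ^*(Z)] - [Φ(Z), Φ^*(Y)]`. -/
  curvature_eq : ∀ (x : X) (Y Z : ∀ x : X, TangentSpace 𝓘(ℝ, ℂ) x) (σ : ∀ x, V x),
    SmoothFieldAt Y x → SmoothFieldAt Z x → SmoothSectionAt F σ x →
    (A (fun y => A σ y (Z y)) x (Y x) - A (fun y => A σ y (Y y)) x (Z x)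
        - A σ x (VectorField.mlieBracket 𝓘(ℝ, ℂ) Y Z x))
      + (⁅Φ x (Y x), LinearMap.adjoint (Φ x (Z x))⁆
          - ⁅Φ x (Z x), LinearMap.adjoint (Φ x (Y x))⁆) (σ x) = 0
  /-- `∂̄_A Φ = 0`. As `Φ` has type `(1,0)` on a surface, `∂̄_A Φ` is the covariant exterior
  derivative `d_A Φ`, where
  `(d_A Φ)(Y, Z) = ∇_Y ∘ Φ(Z) - Φ(Z) ∘ ∇_Y - ∇_Z ∘ Φ(Y) + Φ(Y) ∘ ∇_Z - Φ([Y, Z])`. -/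
  dbar_eq : ∀ (x : X) (Y Z : ∀ x : X, TangentSpace 𝓘(ℝ, ℂ) x) (σ : ∀ x, V x),
    SmoothFieldAt Y x → SmoothFieldAt Z x → SmoothSectionAt F σ x →
    (A (fun y => Φ y (Z y) (σ y)) x (Y x) - Φ x (Z x) (A σ x (Y x)))
      - (A (fun y => Φ y (Y y) (σ y)) x (Z x) - Φ x (Y x) (A σ x (Z x)))
      - Φ x (VectorField.mlieBracket 𝓘(ℝ, ℂ) Y Z x) (σ x) = 0

variable (F V) in
/-- A lift of `f` to a smooth, fibrewise linear involution `φ : V → V`. -/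
structure LiftedInvolution (f : RealStructure X) where
  /-- the lift, fibre by fibre -/
  φ : ∀ x, V x →ₗ[ℂ] V (f x)
  smooth : ContMDiff (𝓘(ℝ, ℂ).prod 𝓘(ℝ, F)) (𝓘(ℝ, ℂ).prod 𝓘(ℝ, F)) ∞
    (fun p : Bundle.TotalSpace F V => (⟨f p.1, φ p.1 p.2⟩ : Bundle.TotalSpace F V))
  involutive : Function.Involutive
    (fun p : Bundle.TotalSpace F V => (⟨f p.1, φ p.1 p.2⟩ : Bundle.TotalSpace F V))

/-- The equivariant vector bundle `(V, φ)`. -/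
def LiftedInvolution.toEqBundle [FiniteDimensional ℂ F] {f : RealStructure X}
    (φ : LiftedInvolution F V f) : EqBundle f.toTopInvolution where
  F := F
  E := V
  φ := φ.φ
  continuous_φ := φ.smooth.continuous
  involutive_φ := φ.involutive

namespace HitchinSolution

/-- The associated flat connection `∇ = ∇_A + Φ + Φ^*`; `H.nabla σ x v` is `∇_v σ` at `x`. -/
noncomputable def nabla (H : HitchinSolution F V) (σ : ∀ x, V x) (x : X)
    (v : TangentSpace 𝓘(ℝ, ℂ) x) : V x :=
  H.A σ x v + H.Φ x v (σ x) + LinearMap.adjoint (H.Φ x v) (σ x)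

/-- `σ` is a smooth `∇`-parallel section over `U` (its values outside of `U` are irrelevant). -/
def IsParallelOn (H : HitchinSolution F V) (σ : ∀ x, V x) (U : Set X) : Prop :=
  ∀ x ∈ U, SmoothSectionAt F σ x ∧ ∀ v, H.nabla σ x v = 0

/-- `∇` is simple: the only covariantly constant endomorphisms of `V` are the constant multiples of
the identity. -/
def IsSimple (H : HitchinSolution F V) : Prop :=
  ∀ T : ∀ x, V x →ₗ[ℂ] V x,
    (∀ (x : X) (σ : ∀ x, V x), SmoothSectionAt F σ x →
      SmoothSectionAt F (fun y => T y (σ y)) x ∧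
      ∀ v, H.nabla (fun y => T y (σ y)) x v = T x (H.nabla σ x v)) →
    ∃ c : ℂ, ∀ x v, T x v = c • v

/-- `φ` preserves `∇`: if `σ' = φ(σ)`, i.e. `σ'(f x) = φ(σ(x))`, then
`∇_{df(v)} σ' = φ(∇_v σ)`. -/
def PreservedBy (H : HitchinSolution F V) {f : RealStructure X} (φ : LiftedInvolution F V f) :
    Prop :=
  ∀ σ σ' : ∀ x, V x, (∀ x, σ' (f x) = φ.φ x (σ x)) →
    ∀ x, SmoothSectionAt F σ x → ∀ v,
      H.nabla σ' (f x) (mfderiv 𝓘(ℝ, ℂ) 𝓘(ℝ, ℂ) f x v) = φ.φ x (H.nabla σ x v)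

end HitchinSolution

end Hitchin

/-! ### The quotient `M = (X × [-1,1]) / τ` and flat connections on it -/

section Quotient

universe u

variable {X : Type*} [TopologicalSpace X]

/-- The involution `τ(x, t) = (f x, -t)` of `X × [-1,1]`. -/
def tau (f : TopInvolution X) (p : X × Set.Icc (-1 : ℝ) 1) : X × Set.Icc (-1 : ℝ) 1 :=
  (f p.1, ⟨-p.2.1, neg_le_neg p.2.2.2, neg_le.1 p.2.2.1⟩)

/-- The quotient space `M = (X × [-1,1]) / τ`. -/
def MSpace (f : TopInvolution X) : Type _ :=
  Quot (fun p q : X × Set.Icc (-1 : ℝ) 1 => q = tau f p)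

instance (f : TopInvolution X) : TopologicalSpace (MSpace f) :=
  inferInstanceAs (TopologicalSpace (Quot _))

/-- The inclusion of `X` as the boundary of `M`, `x ↦ [(x, 1)]`. -/
def boundaryInclusion (f : TopInvolution X) (x : X) : MSpace f :=
  Quot.mk _ (x, ⟨1, by norm_num⟩)

/-- A complex vector bundle with flat connection on a topological manifold `Y`: a vector bundle
whose transition functions are locally constant. -/
structure FlatBundle (Y : Type u) [TopologicalSpace Y] (F : Type) [NormedAddCommGroup F]
    [NormedSpace ℂ F] where
  /-- the index set of the atlas of flat trivializations -/
  ι : Type u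
  /-- the bundle, glued from trivial bundles over the sets of an open cover -/
  core : VectorBundleCore ℂ Y F ι
  flat : ∀ i j, ∀ y ∈ core.baseSet i ∩ core.baseSet j,
    ∀ᶠ z in 𝓝 y, core.coordChange i j z = core.coordChange i j y

/-- A section `s` over `U ⊆ Z` of the pull-back `j^* W` of the flat bundle `W` is flat if in every
flat trivialization of `W` its coordinates are locally constant. -/
def FlatBundle.IsFlatOn {Y : Type u} [TopologicalSpace Y] {F : Type} [NormedAddCommGroup F]
    [NormedSpace ℂ F] (W : FlatBundle Y F) {Z : Type*} [TopologicalSpace Z] (j : Z → Y)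
    (s : ∀ z, W.core.Fiber (j z)) (U : Set Z) : Prop :=
  ∀ z ∈ U, ∀ i, j z ∈ W.core.baseSet i → ∀ᶠ z' in 𝓝 z,
    (W.core.localTriv i ⟨j z', s z'⟩).2 = (W.core.localTriv i ⟨j z, s z⟩).2

end Quotient

/-- The flat connection `∇` of `H` extends over `M` as a flat connection: there are a flat bundle
`W` on `M` and an isomorphism `θ` from `V` to the restriction of `W` to the boundary `X` of `M`
which identifies the `∇`-parallel local sections with the flat local sections. -/
def HitchinSolution.ExtendsOverM {X : Type*} [TopologicalSpace X] [ChartedSpace ℂ X]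
    [IsManifold 𝓘(ℂ) ω X] {F : Type} [NormedAddCommGroup F] [NormedSpace ℂ F] {V : X → Type}
    [∀ x, NormedAddCommGroup (V x)] [∀ x, InnerProductSpace ℂ (V x)]
    [∀ x, FiniteDimensional ℂ (V x)] [TopologicalSpace (Bundle.TotalSpace F V)]
    [FiberBundle F V] [VectorBundle ℂ F V] (H : HitchinSolution F V) (f : RealStructure X) : Prop :=
  ∃ (W : FlatBundle (MSpace f.toTopInvolution) F)
    (θ : ∀ x, V x ≃ₗ[ℂ] W.core.Fiber (boundaryInclusion f.toTopInvolution x)),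
    ∀ (U : Set X) (s : ∀ x, V x), IsOpen U →
      (H.IsParallelOn s U ↔
        W.IsFlatOn (boundaryInclusion f.toTopInvolution) (fun x => θ x (s x)) U)

/-! All conditions are compared with one local condition, `FixesFibres`: a lift acts as the identity
on the fibres over the fixed points of f. If f has no fixed points, it is vacuous.

The connection ∇ is flat, because its curvature is the sum of F_A + [Φ, Φ^*], d_A Φ, its adjoint d_A
Φ^*, and the terms [Φ, Φ] and [Φ^*, Φ^*], which vanish for a (1,0)-form on a surface
(`isFlatConnection_nabla`). Integrating along rays in a chart gives local parallel frames
(`exists_parallel_frame`), and in such a frame a section is parallel exactly when its coordinates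
are locally constant. From there on only locally constant functions are involved.

If ψ = φ or ψ = -φ fixes the fibres, there are ψ-invariant parallel frames over invariant open sets:
near a fixed point a parallel frame and its transport agree at that point, hence nearby; elsewhere a
frame is chosen on a small set and transported to its disjoint mirror image. The transition
functions are f-invariant and locally constant, so they descend to a flat bundle on M
(`extendsOverM_of_lift`).

Conversely, an extension gives parallel transport along t ↦ [(x, t)] from t = 1 to t = -1, that is,
a parallel map χ from V_x to V_{f x}. Over a fixed point this path in M runs forth and back along
the same track, so χ is the identity there. Simplicity gives χ = cφ, and comparison at a fixed point
gives c = ±1 unless the fibre is zero, so φ or -φ fixes the fibres (`fixesFibres_of_extendsOverM`).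

In K-theory, the rank of the -1-eigenspace at a fixed point is additive and vanishes on the trivial
bundle with trivial lift. Vanishing of the reduced class thus implies `FixesFibres`, whether or not
fixed points exist. For the converse f needs a fixed point: a bundle whose lift fixes the fibres
then has a global equivariant frame. One starts with an equivariant frame having finitely many
singular points. The frame can be changed over a disc and its mirror image so that the singularities
in the disc move to any nearby point, without increasing their number; over an invariant disc around
a fixed point they can be removed, since a conjugation-invariant loop of invertible matrices extends
over the disc. With the least number of singular points, connectedness lets a singular point be
moved to a fixed point and removed, so there are none (`hasFrame_univ_empty`). -/

set_option linter.unusedSectionVars false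

/-! ### Smooth sections and smooth families of operators in local coordinates -/

section Sections

variable {X : Type*} [TopologicalSpace X] [ChartedSpace ℂ X]
  {F : Type} [NormedAddCommGroup F] [NormedSpace ℂ F]
  {V : X → Type} [∀ x, NormedAddCommGroup (V x)] [∀ x, InnerProductSpace ℂ (V x)]
  [TopologicalSpace (Bundle.TotalSpace F V)] [FiberBundle F V]

theorem SmoothSectionAt.congr {σ τ : ∀ x, V x} {x : X} (h : SmoothSectionAt F σ x)
    (hστ : ∀ᶠ y in 𝓝 x, σ y = τ y) : SmoothSectionAt F τ x :=
  ContMDiffAt.congr_of_eventuallyEq h (hστ.mono fun y hy => by simp [hy])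

theorem DiffSectionAt.congr {σ τ : ∀ x, V x} {x : X} (h : DiffSectionAt F σ x)
    (hστ : ∀ᶠ y in 𝓝 x, σ y = τ y) : DiffSectionAt F τ x :=
  MDifferentiableAt.congr_of_eventuallyEq h (hστ.mono fun y hy => by simp [hy])

theorem SmoothSectionAt.diff {σ : ∀ x, V x} {x : X} (h : SmoothSectionAt F σ x) :
    DiffSectionAt F σ x :=
  ContMDiffAt.mdifferentiableAt h (by simp)

variable [IsManifold 𝓘(ℂ) ω X] [VectorBundle ℂ F V] [ContMDiffVectorBundle ∞ F V 𝓘(ℝ, ℂ)]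

variable (F V) in
/-- The coordinates of a section in the preferred trivialization at `x₀`. -/
noncomputable def secCoord (x₀ : X) (σ : ∀ x, V x) (y : X) : F :=
  (trivializationAt F V x₀ ⟨y, σ y⟩).2

variable (F V) in
/-- The section with given coordinates in the preferred trivialization at `x₀`. -/
noncomputable def secOfCoord (x₀ : X) (a : X → F) (y : X) : V y :=
  (trivializationAt F V x₀).symmₗ ℂ y (a y)

theorem secCoord_secOfCoord (x₀ : X) (a : X → F) {y : X}
    (hy : y ∈ (trivializationAt F V x₀).baseSet) :
    secCoord F V x₀ (secOfCoord F V x₀ a) y = a y := by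
  simp [secCoord, secOfCoord, hy, Bundle.Trivialization.apply_mk_symm _ hy]

theorem secOfCoord_secCoord (x₀ : X) (σ : ∀ x, V x) {y : X}
    (hy : y ∈ (trivializationAt F V x₀).baseSet) :
    secOfCoord F V x₀ (secCoord F V x₀ σ) y = σ y := by
  simp [secCoord, secOfCoord, hy, Bundle.Trivialization.symm_apply_apply_mk _ hy]

theorem smoothSectionAt_iff (x₀ : X) {σ : ∀ x, V x} {y : X}
    (hy : y ∈ (trivializationAt F V x₀).baseSet) :
    SmoothSectionAt F σ y ↔ ContMDiffAt 𝓘(ℝ, ℂ) 𝓘(ℝ, F) ∞ (secCoord F V x₀ σ) y :=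
  (trivializationAt F V x₀).contMDiffAt_section_iff hy

theorem diffSectionAt_iff (x₀ : X) {σ : ∀ x, V x} {y : X}
    (hy : y ∈ (trivializationAt F V x₀).baseSet) :
    DiffSectionAt F σ y ↔ MDifferentiableAt 𝓘(ℝ, ℂ) 𝓘(ℝ, F) (secCoord F V x₀ σ) y := by
  have : ContMDiffVectorBundle 1 F V 𝓘(ℝ, ℂ) := ContMDiffVectorBundle.of_le (n := ∞) (by simp)
  exact (trivializationAt F V x₀).mdifferentiableAt_section_iff 𝓘(ℝ, ℂ) σ hy 

theorem baseSet_mem_nhds (x₀ : X) {y : X}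
    (hy : y ∈ (trivializationAt F V x₀).baseSet) :
    (trivializationAt F V x₀).baseSet ∈ 𝓝 y :=
  (trivializationAt F V x₀).open_baseSet.mem_nhds hy

theorem smoothSectionAt_secOfCoord (x₀ : X) {a : X → F} {y : X}
    (hy : y ∈ (trivializationAt F V x₀).baseSet) :
    SmoothSectionAt F (secOfCoord F V x₀ a) y ↔ ContMDiffAt 𝓘(ℝ, ℂ) 𝓘(ℝ, F) ∞ a y := by
  rw [smoothSectionAt_iff x₀ hy]
  refine Filter.EventuallyEq.contMDiffAt_iff ?_
  filter_upwards [baseSet_mem_nhds x₀ hy] with z hz using secCoord_secOfCoord x₀ a hz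

theorem diffSectionAt_secOfCoord (x₀ : X) {a : X → F} {y : X}
    (hy : y ∈ (trivializationAt F V x₀).baseSet) :
    DiffSectionAt F (secOfCoord F V x₀ a) y ↔ MDifferentiableAt 𝓘(ℝ, ℂ) 𝓘(ℝ, F) a y := by
  rw [diffSectionAt_iff x₀ hy]
  refine Filter.EventuallyEq.mdifferentiableAt_iff ?_
  filter_upwards [baseSet_mem_nhds x₀ hy] with z hz using secCoord_secOfCoord x₀ a hz

theorem secOfCoord_add (x₀ : X) (a b : X → F) (y : X) :
    secOfCoord F V x₀ (fun z => a z + b z) y =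
      secOfCoord F V x₀ a y + secOfCoord F V x₀ b y := by
  simp only [secOfCoord, map_add]

theorem secOfCoord_smul (x₀ : X) (c : X → ℂ) (a : X → F) (y : X) :
    secOfCoord F V x₀ (fun z => c z • a z) y = c y • secOfCoord F V x₀ a y := by
  simp only [secOfCoord, map_smul]

theorem SmoothSectionAt.add {σ τ : ∀ x, V x} {x : X} (h : SmoothSectionAt F σ x)
    (h' : SmoothSectionAt F τ x) : SmoothSectionAt F (fun y => σ y + τ y) x :=
  ContMDiffAt.add_section h h'

theorem SmoothSectionAt.smul {g : X → ℝ} {σ : ∀ x, V x} {x : X}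
    (hg : ContMDiffAt 𝓘(ℝ, ℂ) 𝓘(ℝ, ℝ) ∞ g x) (h : SmoothSectionAt F σ x) :
    SmoothSectionAt F (fun y => g y • σ y) x :=
  ContMDiffAt.smul_section hg h

theorem smoothSectionAt_zero (x : X) : SmoothSectionAt F (fun y => (0 : V y)) x :=
  Bundle.contMDiff_zeroSection ℝ V x

/-- A bump function supported where σ is smooth, multiplied with σ, does it. This serves to apply
the smoothness axiom of ∇_A, which concerns sections over the whole surface, to local sections. -/
theorem SmoothSectionAt.exists_global [T2Space X] {σ : ∀ x, V x} {x : X}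
    (h : ∀ᶠ y in 𝓝 x, SmoothSectionAt F σ y) :
    ∃ τ : ∀ x, V x, (∀ y, SmoothSectionAt F τ y) ∧ ∀ᶠ y in 𝓝 x, τ y = σ y := by
  obtain ⟨χ, -, hχ⟩ := (SmoothBumpFunction.nhds_basis_tsupport (I := 𝓘(ℝ, ℂ)) x).mem_iff.1 h
  refine ⟨fun y => χ y • σ y, fun y => ?_, ?_⟩
  · by_cases hy : y ∈ tsupport χ
    · have : IsManifold 𝓘(ℝ, ℂ) ∞ X := IsManifold.of_le (n := ω) le_top
      exact SmoothSectionAt.smul (χ.contMDiffAt.of_le le_rfl) (hχ hy)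
    · refine (smoothSectionAt_zero y).congr ?_
      have : (tsupport χ)ᶜ ∈ 𝓝 y := (isClosed_tsupport _).isOpen_compl.mem_nhds hy
      filter_upwards [this] with z hz
      rw [image_eq_zero_of_notMem_tsupport hz, zero_smul]
  · filter_upwards [χ.eventuallyEq_one] with y hy
    rw [hy]; simp

end Sections

/-- In finite dimension an operator is the sum of the rank-one operators built from the coordinate
functionals and the images of the basis vectors, so smoothness on vectors is smoothness in operator
norm. -/
theorem contMDiffAt_clm_of_apply {X : Type*} [TopologicalSpace X] [ChartedSpace ℂ X]
    {F G : Type*} [NormedAddCommGroup F] [NormedSpace ℂ F] [FiniteDimensional ℂ F]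
    [NormedAddCommGroup G] [NormedSpace ℂ G] {n : ℕ∞ω} {L : X → F →L[ℂ] G} {x : X}
    (h : ∀ v, ContMDiffAt 𝓘(ℝ, ℂ) 𝓘(ℝ, G) n (fun y => L y v) x) :
    ContMDiffAt 𝓘(ℝ, ℂ) 𝓘(ℝ, F →L[ℂ] G) n L x := by
  classical
  let b := Module.finBasis ℂ F
  have hL : L = fun y => ∑ i, ContinuousLinearMap.smulRightL ℂ F G
      (LinearMap.toContinuousLinearMap (b.coord i)) (L y (b i)) := by
    ext y v
    conv_lhs => rw [← b.sum_repr v]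
    simp [-Module.Basis.sum_repr]
  rw [hL]
  refine ContMDiffAt.sum fun i _ => ?_
  have h1 : ContDiff ℝ n (fun w : G => ContinuousLinearMap.smulRightL ℂ F G
      (LinearMap.toContinuousLinearMap (b.coord i)) w) :=
    ((ContinuousLinearMap.smulRightL ℂ F G
      (LinearMap.toContinuousLinearMap (b.coord i))).restrictScalars ℝ).contDiff
  exact h1.contMDiff.contMDiffAt.comp x (h (b i))

theorem Complex.exists_real_smul_add_smul_I_mul (v w : ℂ) (hv : v ≠ 0) :
    ∃ a b : ℝ, w = a • v + b • (Complex.I * v) := by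
  refine ⟨(w / v).re, (w / v).im, ?_⟩
  have h1 : w = (w / v) * v := (div_mul_cancel₀ _ hv).symm
  conv_lhs => rw [h1, ← Complex.re_add_im (w / v)]
  simp only [Complex.real_smul]
  ring

/-! ### The flat connection ∇ = ∇_A + Φ + Φ^* -/

section

variable {X : Type*} [TopologicalSpace X] [ChartedSpace ℂ X] [IsManifold 𝓘(ℂ) ω X]
  {F : Type} [NormedAddCommGroup F] [NormedSpace ℂ F] [FiniteDimensional ℂ F]
  {V : X → Type} [∀ x, NormedAddCommGroup (V x)] [∀ x, InnerProductSpace ℂ (V x)]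
  [∀ x, FiniteDimensional ℂ (V x)]
  [TopologicalSpace (Bundle.TotalSpace F V)] [FiberBundle F V]
  [VectorBundle ℂ F V]

variable (F V) in
/-- The axioms of a smooth flat complex-linear connection `D`, where `D σ x v` is `D_v σ` at `x`. -/
structure IsFlatConnection
    (D : (∀ x, V x) → ∀ x : X, TangentSpace 𝓘(ℝ, ℂ) x → V x) : Prop where
  add_vec : ∀ σ x v w, D σ x (v + w) = D σ x v + D σ x w
  smul_vec : ∀ σ x (c : ℝ) v, D σ x (c • v) = c • D σ x v
  add : ∀ (x : X) (σ τ : ∀ x, V x), DiffSectionAt F σ x → DiffSectionAt F τ x → ∀ v,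
    D (fun y => σ y + τ y) x v = D σ x v + D τ x v
  smul : ∀ (x : X) (g : X → ℝ) (σ : ∀ x, V x), MDifferentiableAt 𝓘(ℝ, ℂ) 𝓘(ℝ, ℝ) g x →
    DiffSectionAt F σ x → ∀ v,
    D (fun y => g y • σ y) x v = g x • D σ x v + mvfderiv 𝓘(ℝ, ℂ) g x v • σ x
  smul_I : ∀ (x : X) (σ : ∀ x, V x), DiffSectionAt F σ x → ∀ v,
    D (fun y => Complex.I • σ y) x v = Complex.I • D σ x v
  congr : ∀ (x : X) (σ τ : ∀ x, V x), DiffSectionAt F σ x → (∀ᶠ y in 𝓝 x, σ y = τ y) → ∀ v,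
    D σ x v = D τ x v
  smooth : ∀ (x : X) (Y : ∀ x : X, TangentSpace 𝓘(ℝ, ℂ) x) (σ : ∀ x, V x),
    SmoothFieldAt Y x → (∀ᶠ y in 𝓝 x, SmoothSectionAt F σ y) →
    SmoothSectionAt F (fun y => D σ y (Y y)) x
  flat : ∀ (x : X) (Y Z : ∀ x : X, TangentSpace 𝓘(ℝ, ℂ) x) (σ : ∀ x, V x),
    (SmoothFieldAt Y x) → (SmoothFieldAt Z x) →
    (∀ᶠ y in 𝓝 x, SmoothSectionAt F σ y) →
    D (fun y => D σ y (Z y)) x (Y x) - D (fun y => D σ y (Y y)) x (Z x)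
      - D σ x (VectorField.mlieBracket 𝓘(ℝ, ℂ) Y Z x) = 0

namespace HitchinSolution

variable (H : HitchinSolution F V)

theorem A_add (x : X) (σ τ : ∀ x, V x) (hσ : DiffSectionAt F σ x) (hτ : DiffSectionAt F τ x) :
    H.A (fun y => σ y + τ y) x = H.A σ x + H.A τ x :=
  H.A.isCovariantDerivativeOnUniv.add hσ hτ

theorem A_congr (x : X) (σ τ : ∀ x, V x) (hσ : DiffSectionAt F σ x)
    (h : ∀ᶠ y in 𝓝 x, σ y = τ y) : H.A σ x = H.A τ x :=
  H.A.isCovariantDerivativeOnUniv.congr_of_eventuallyEq hσ (hσ.congr h) Filter.univ_mem h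

theorem A_smul (x : X) (g : X → ℝ) (σ : ∀ x, V x) (hg : MDifferentiableAt 𝓘(ℝ, ℂ) 𝓘(ℝ, ℝ) g x)
    (hσ : DiffSectionAt F σ x) (v) :
    H.A (fun y => g y • σ y) x v = g x • H.A σ x v + mvfderiv 𝓘(ℝ, ℂ) g x v • σ x := by
  have := H.A.isCovariantDerivativeOnUniv.leibniz hσ hg
  have h2 := congrArg (fun L => L v) this
  simp only [add_apply, smul_apply,
    ContinuousLinearMap.smulRight_apply] at h2
  exact h2

/-- For v ≠ 0 every tangent vector is av + bJv, and type (1,0) turns Φ of it into (a + ib)Φ(v). All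
values of Φ at a point are thus complex multiples of one endomorphism; this is [Φ, Φ] = 0. -/
theorem Φ_commute (x : X) (v w : TangentSpace 𝓘(ℝ, ℂ) x) (u : V x) :
    H.Φ x v (H.Φ x w u) = H.Φ x w (H.Φ x v u) := by
  by_cases hv : v = 0
  · simp [hv]
  · obtain ⟨a, b, hw⟩ : ∃ a b : ℝ, w = a • v + b • tangentJ x v :=
      Complex.exists_real_smul_add_smul_I_mul v w hv
    rw [hw]
    simp [H.Φ_type, map_add]

/-- The adjoint of the Higgs field. -/
noncomputable def Ψ (x : X) (v : TangentSpace 𝓘(ℝ, ℂ) x) : V x →ₗ[ℂ] V x :=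
  LinearMap.adjoint (H.Φ x v)

theorem Ψ_add (x : X) (v w : TangentSpace 𝓘(ℝ, ℂ) x) : H.Ψ x (v + w) = H.Ψ x v + H.Ψ x w := by
  simp [Ψ]

theorem Ψ_smul (x : X) (c : ℝ) (v : TangentSpace 𝓘(ℝ, ℂ) x) : H.Ψ x (c • v) = c • H.Ψ x v := by
  have h : c • H.Φ x v = (c : ℂ) • H.Φ x v := by
    ext u; simp
  have h' : c • H.Ψ x v = (c : ℂ) • H.Ψ x v := by
    ext u; simp
  rw [h', Ψ, Ψ, map_smul, h, map_smulₛₗ]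
  simp

theorem Ψ_commute (x : X) (v w : TangentSpace 𝓘(ℝ, ℂ) x) (u : V x) :
    H.Ψ x v (H.Ψ x w u) = H.Ψ x w (H.Ψ x v u) := by
  refine ext_inner_right ℂ fun z => ?_
  simp only [Ψ, LinearMap.adjoint_inner_left]
  rw [H.Φ_commute]

theorem inner_Ψ (x : X) (v : TangentSpace 𝓘(ℝ, ℂ) x) (u w : V x) :
    inner ℂ u (H.Ψ x v w) = inner ℂ (H.Φ x v u) w :=
  LinearMap.adjoint_inner_right _ _ _

theorem nabla_eq (σ : ∀ x, V x) (x : X) (v : TangentSpace 𝓘(ℝ, ℂ) x) :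
    H.nabla σ x v = H.A σ x v + H.Φ x v (σ x) + H.Ψ x v (σ x) := rfl

variable [ContMDiffVectorBundle ∞ F V 𝓘(ℝ, ℂ)]

theorem _root_.smoothSectionAt_secOfCoord_const (x₀ : X) (v : F) {y : X} (hy : y ∈ (trivializationAt F V x₀).baseSet) :
    SmoothSectionAt F (secOfCoord F V x₀ (fun _ => v)) y :=
  (smoothSectionAt_secOfCoord x₀ hy).2 contMDiffAt_const

/-- A section whose inner products with a local smooth frame are smooth is smooth. -/
theorem smooth_of_inner (H : HitchinSolution F V) (x : X) (s : ∀ x, V x)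
    (h : ∀ v : F, ContMDiffAt 𝓘(ℝ, ℂ) 𝓘(ℝ, ℂ) ∞
      (fun y => inner ℂ (secOfCoord F V x (fun _ => v) y) (s y)) x) :
    SmoothSectionAt F s x := by
  have hx := FiberBundle.mem_baseSet_trivializationAt F V x
  let b := Module.finBasis ℂ F
  -- The Gram operator of the frame sends the coordinates of a section to its inner products with
  -- the frame. It is invertible by nondegeneracy of the metric, and its smooth inverse recovers the
  -- coordinates from these inner products.
  let L : X → F →L[ℂ] (Fin (Module.finrank ℂ F) → ℂ) := fun y => LinearMap.toContinuousLinearMap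
    { toFun := fun a i => inner ℂ (secOfCoord F V x (fun _ => b i) y) (secOfCoord F V x (fun _ => a) y)
      map_add' := fun a a' => by
        ext i
        simp [secOfCoord_add x (fun _ => a) (fun _ => a') y]
      map_smul' := fun c a => by
        ext i
        simp [secOfCoord_smul x (fun _ => c) (fun _ => a) y] }
  have hL : ContMDiffAt 𝓘(ℝ, ℂ) 𝓘(ℝ, F →L[ℂ] (Fin (Module.finrank ℂ F) → ℂ)) ∞ L x := by
    refine contMDiffAt_clm_of_apply fun v => ?_
    rw [contMDiffAt_pi_space]
    intro i
    exact H.metric_smooth x _ _ (smoothSectionAt_secOfCoord_const x (b i) hx) (smoothSectionAt_secOfCoord_const x v hx)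
  have hLs : ContMDiffAt 𝓘(ℝ, ℂ) 𝓘(ℝ, Fin (Module.finrank ℂ F) → ℂ) ∞
      (fun y i => inner ℂ (secOfCoord F V x (fun _ => b i) y) (s y)) x := by
    rw [contMDiffAt_pi_space]
    exact fun i => h (b i)
  have hinj : ∀ y ∈ (trivializationAt F V x).baseSet, Function.Injective (L y) := by
    intro y hy
    rw [injective_iff_map_eq_zero]
    intro a ha
    have h1 : ∀ c : F, inner ℂ (secOfCoord F V x (fun _ => c) y)
        (secOfCoord F V x (fun _ => a) y) = 0 := by
      intro c
      have hc : secOfCoord F V x (fun _ => c) y =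
          ∑ i, b.repr c i • secOfCoord F V x (fun _ => b i) y := by
        have hlin : ∀ d : F, secOfCoord F V x (fun _ => d) y =
          ((trivializationAt F V x).symmₗ ℂ y) d := fun d => rfl
        simp only [hlin]
        conv_lhs => rw [← b.sum_repr c, map_sum]
        simp
      rw [hc, sum_inner]
      refine Finset.sum_eq_zero fun i _ => ?_
      rw [inner_smul_left]
      have : L y a i = 0 := by rw [ha]; rfl
      change _ * L y a i = 0
      rw [this, mul_zero]
    have h2 := inner_self_eq_zero.1 (h1 a)
    have h3 := secCoord_secOfCoord x (fun _ => a) hy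
    rw [← h3, secCoord, h2]
    exact ((trivializationAt F V x).linear ℂ hy).map_zero
  have hequiv : ∀ y ∈ (trivializationAt F V x).baseSet,
      ∃ M : F ≃L[ℂ] (Fin (Module.finrank ℂ F) → ℂ), (M : F →L[ℂ] (Fin (Module.finrank ℂ F) → ℂ)) = L y := by
    intro y hy
    refine ⟨(LinearEquiv.ofInjectiveOfFinrankEq (L y : F →ₗ[ℂ] _) (hinj y hy)
      (by simp)).toContinuousLinearEquiv, ?_⟩
    ext a
    rfl
  obtain ⟨M, hM⟩ := hequiv x hx
  have hinv : ContMDiffAt 𝓘(ℝ, ℂ) 𝓘(ℝ, (Fin (Module.finrank ℂ F) → ℂ) →L[ℂ] F) ∞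
      (fun y => ContinuousLinearMap.inverse (L y)) x := by
    have h1 : ContDiffAt ℂ ∞ (ContinuousLinearMap.inverse :
        (F →L[ℂ] (Fin (Module.finrank ℂ F) → ℂ)) → _)
        (M : F →L[ℂ] (Fin (Module.finrank ℂ F) → ℂ)) :=
      contDiffAt_map_inverse M
    have h2 := (h1.restrict_scalars ℝ).contMDiffAt
    rw [hM] at h2
    exact h2.comp x hL
  rw [smoothSectionAt_iff x hx]
  have h3 : ContMDiffAt 𝓘(ℝ, ℂ) 𝓘(ℝ, F) ∞ (fun y => ContinuousLinearMap.inverse (L y)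
      (fun i => inner ℂ (secOfCoord F V x (fun _ => b i) y) (s y))) x := by
    have h4 : ContDiff ℝ ∞ (fun p : ((Fin (Module.finrank ℂ F) → ℂ) →L[ℂ] F) ×
        (Fin (Module.finrank ℂ F) → ℂ) => p.1 p.2) :=
      (isBoundedBilinearMap_apply (𝕜 := ℂ) (E := Fin (Module.finrank ℂ F) → ℂ)
        (F := F)).contDiff.restrict_scalars ℝ
    exact h4.contMDiff.contMDiffAt.comp x (hinv.prodMk_space hLs)
  refine h3.congr_of_eventuallyEq ?_
  filter_upwards [baseSet_mem_nhds x hx] with y hy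
  obtain ⟨M', hM'⟩ := hequiv y hy
  rw [← hM', ContinuousLinearMap.inverse_equiv]
  symm
  rw [ContinuousLinearEquiv.coe_coe, ContinuousLinearEquiv.symm_apply_eq]
  change _ = (M' : F →L[ℂ] (Fin (Module.finrank ℂ F) → ℂ)) _
  rw [hM']
  funext i
  change _ = inner ℂ (secOfCoord F V x (fun _ => b i) y)
    (secOfCoord F V x (fun _ => secCoord F V x s y) y)
  congr 1
  exact (secOfCoord_secCoord x s hy).symm

/-- Pairing with a smooth frame moves the adjoint to the other side, where smoothness of Φ and of
the metric apply. -/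
theorem Ψ_smooth (x : X) (Y : ∀ x : X, TangentSpace 𝓘(ℝ, ℂ) x) (σ : ∀ x, V x)
    (hY : SmoothFieldAt Y x) (hσ : SmoothSectionAt F σ x) :
    SmoothSectionAt F (fun y => H.Ψ y (Y y) (σ y)) x := by
  have hx := FiberBundle.mem_baseSet_trivializationAt F V x
  refine H.smooth_of_inner x _ fun v => ?_
  simp only [inner_Ψ]
  exact H.metric_smooth x _ _ (H.Φ_smooth x Y _ hY (smoothSectionAt_secOfCoord_const x v hx)) hσ

theorem A_smooth_apply [T2Space X] (x : X) (Y : ∀ x : X, TangentSpace 𝓘(ℝ, ℂ) x) (σ : ∀ x, V x)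
    (hY : SmoothFieldAt Y x) (hσ : ∀ᶠ y in 𝓝 x, SmoothSectionAt F σ y) :
    SmoothSectionAt F (fun y => H.A σ y (Y y)) x := by
  obtain ⟨τ, hτ, hτσ⟩ := SmoothSectionAt.exists_global hσ
  have h1 := H.A_smooth.contMDiff.contMDiff (σ := τ) (fun y _ => (hτ y).contMDiffWithinAt)
  have h2 := (h1 x trivial).contMDiffAt Filter.univ_mem
  have h3 : SmoothSectionAt F (fun y => H.A τ y (Y y)) x :=
    ContMDiffAt.clm_bundle_apply h2 hY
  refine h3.congr ?_
  filter_upwards [hτσ.eventually_nhds, hσ] with y hy hy'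
  rw [H.A_congr y τ σ (hτ y).diff hy]

theorem inner_A (x : X) (σ τ : ∀ x, V x) (hσ : DiffSectionAt F σ x) (hτ : DiffSectionAt F τ x)
    (v : TangentSpace 𝓘(ℝ, ℂ) x) :
    inner ℂ (σ x) (H.A τ x v) = mvfderiv 𝓘(ℝ, ℂ) (fun y => inner ℂ (σ y) (τ y)) x v -
      inner ℂ (H.A σ x v) (τ x) := by
  rw [H.A_unitary x σ τ hσ hτ v]
  ring

/-- This is the adjoint of ∂̄_A Φ = 0. Both sides are paired with a local section τ extending a
given vector; as ∇_A is unitary, the covariant derivative of Φ^* is the adjoint of the covariant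
derivative of Φ, which is what `key` records. -/
theorem dbar_adjoint [T2Space X] (x : X) (Y Z : ∀ x : X, TangentSpace 𝓘(ℝ, ℂ) x) (σ : ∀ x, V x)
    (hY : SmoothFieldAt Y x) (hZ : SmoothFieldAt Z x)
    (hσ : ∀ᶠ y in 𝓝 x, SmoothSectionAt F σ y) :
    (H.A (fun y => H.Ψ y (Z y) (σ y)) x (Y x) - H.Ψ x (Z x) (H.A σ x (Y x)))
      - (H.A (fun y => H.Ψ y (Y y) (σ y)) x (Z x) - H.Ψ x (Y x) (H.A σ x (Z x)))
      - H.Ψ x (VectorField.mlieBracket 𝓘(ℝ, ℂ) Y Z x) (σ x) = 0 := by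
  have hx := FiberBundle.mem_baseSet_trivializationAt F V x
  refine ext_inner_left ℂ fun u => ?_
  obtain ⟨τ, hτ, hu⟩ : ∃ τ : ∀ x, V x, SmoothSectionAt F τ x ∧ τ x = u :=
    ⟨secOfCoord F V x (fun _ => (trivializationAt F V x ⟨x, u⟩).2), smoothSectionAt_secOfCoord_const x _ hx,
      by simp [secOfCoord, hx]⟩
  subst hu
  have hσ' := hσ.self_of_nhds
  have hΨY := H.Ψ_smooth x Y σ hY hσ'
  have hΨZ := H.Ψ_smooth x Z σ hZ hσ'
  have hΦY := H.Φ_smooth x Y τ hY hτ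
  have hΦZ := H.Φ_smooth x Z τ hZ hτ
  have key : ∀ (Y Z : ∀ x : X, TangentSpace 𝓘(ℝ, ℂ) x),
      SmoothSectionAt F (fun y => H.Ψ y (Z y) (σ y)) x →
      SmoothSectionAt F (fun y => H.Φ y (Z y) (τ y)) x →
      inner ℂ (τ x) (H.A (fun y => H.Ψ y (Z y) (σ y)) x (Y x) - H.Ψ x (Z x) (H.A σ x (Y x))) =
      inner ℂ (H.A (fun y => H.Φ y (Z y) (τ y)) x (Y x) - H.Φ x (Z x) (H.A τ x (Y x))) (σ x) := by
    intro Y Z h1 h2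
    rw [inner_sub_right, H.inner_A x τ _ hτ.diff h1.diff, inner_sub_left]
    simp only [inner_Ψ]
    rw [H.A_unitary x _ σ h2.diff hσ'.diff]
    ring
  have hd := H.dbar_eq x Y Z τ hY hZ hτ
  rw [inner_sub_right, inner_sub_right, key Y Z hΨZ hΦZ, key Z Y hΨY hΦY, inner_Ψ,
    ← inner_sub_left, ← inner_sub_left, hd, inner_zero_left, inner_zero_right]

/-- Both Hitchin equations enter in the last field. Expanding the curvature gives F_A + [Φ, Φ^*],
then d_A Φ and d_A Φ^*, and the two commutator terms killed by `Φ_commute` and `Ψ_commute`. -/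
theorem isFlatConnection_nabla [T2Space X] : IsFlatConnection F V H.nabla where
  add_vec σ x v w := by
    simp only [nabla_eq, map_add, Ψ_add, LinearMap.add_apply]
    abel
  smul_vec σ x c v := by
    simp only [nabla_eq, map_smul, Ψ_smul, LinearMap.smul_apply, smul_add]
  add x σ τ hσ hτ v := by
    simp only [nabla_eq, map_add, H.A_add x σ τ hσ hτ, add_apply]
    abel
  smul x g σ hg hσ v := by
    have h1 : ∀ (T : V x →ₗ[ℂ] V x) (c : ℝ) (u : V x), T (c • u) = c • T u := fun T c u =>
      LinearMap.map_smul_of_tower T c u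
    simp only [nabla_eq, h1, H.A_smul x g σ hg hσ, smul_add]
    abel
  smul_I x σ hσ v := by
    simp only [nabla_eq, map_smul, H.A_linear x σ hσ, smul_add]
  congr x σ τ hσ h v := by
    simp only [nabla_eq, H.A_congr x σ τ hσ h, h.self_of_nhds]
  smooth x Y σ hY hσ := by
    exact ((H.A_smooth_apply x Y σ hY hσ).add (H.Φ_smooth x Y σ hY hσ.self_of_nhds)).add
      (H.Ψ_smooth x Y σ hY hσ.self_of_nhds)
  flat x Y Z σ hY hZ hσ := by
    have hσ' := hσ.self_of_nhds
    have hA : ∀ (Y Z : ∀ x : X, TangentSpace 𝓘(ℝ, ℂ) x), SmoothFieldAt Y x → SmoothFieldAt Z x →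
        H.A (fun y => H.nabla σ y (Z y)) x (Y x) = H.A (fun y => H.A σ y (Z y)) x (Y x) +
          H.A (fun y => H.Φ y (Z y) (σ y)) x (Y x) + H.A (fun y => H.Ψ y (Z y) (σ y)) x (Y x) := by
      intro Y Z hY hZ
      have h1 := H.A_smooth_apply x Z σ hZ hσ
      have h2 := H.Φ_smooth x Z σ hZ hσ'
      have h3 := H.Ψ_smooth x Z σ hZ hσ'
      simp only [nabla_eq]
      rw [H.A_add x _ _ (h1.add h2).diff h3.diff, H.A_add x _ _ h1.diff h2.diff]
      rfl
    have e1 := H.curvature_eq x Y Z σ hY hZ hσ'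
    have e2 := H.dbar_eq x Y Z σ hY hZ hσ'
    have e3 := H.dbar_adjoint x Y Z σ hY hZ hσ
    have e4 := H.Φ_commute x (Y x) (Z x) (σ x)
    have e5 := H.Ψ_commute x (Y x) (Z x) (σ x)
    change _ + (⁅H.Φ x (Y x), H.Ψ x (Z x)⁆ - ⁅H.Φ x (Z x), H.Ψ x (Y x)⁆) (σ x) = 0 at e1
    simp only [Ring.lie_def, LinearMap.sub_apply, Module.End.mul_apply] at e1
    rw [H.nabla_eq (fun y => H.nabla σ y (Z y)), H.nabla_eq (fun y => H.nabla σ y (Y y)),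
      hA Y Z hY hZ, hA Z Y hZ hY]
    simp only [nabla_eq, map_add, e4, e5]
    have e := congrArg₂ (· + ·) (congrArg₂ (· + ·) e1 e2) e3
    simp only [add_zero] at e
    rw [← e]
    abel

end HitchinSolution

end

/-! ### Integration of flat connection forms on a vector space -/

section Frobenius

open MeasureTheory intervalIntegral

variable {P E : Type*} [NormedAddCommGroup P] [NormedSpace ℝ P] [FiniteDimensional ℝ P]
  [NormedRing E] [NormedAlgebra ℝ E]

/-- A `C¹` family of continuous functions on the unit interval is differentiable as a map to the
Banach space of continuous functions. -/
theorem hasFDerivAt_continuousMap {f : P × ℝ → E} (hf : ContDiff ℝ 1 f) (a : P → C(unitInterval, E))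
    (ha : ∀ p s, a p s = f (p, s)) (p₀ : P) :
    ∃ L : P →L[ℝ] C(unitInterval, E), HasFDerivAt a L p₀ ∧
      ∀ w s, L w s = fderiv ℝ f (p₀, s) (w, 0) := by
  have hcont : Continuous (fderiv ℝ f) := hf.continuous_fderiv one_ne_zero
  let L : P →L[ℝ] C(unitInterval, E) := LinearMap.toContinuousLinearMap
    { toFun := fun w => ⟨fun s => fderiv ℝ f (p₀, s) (w, 0), by fun_prop⟩
      map_add' := fun v w => by
        ext s
        have h : ((v + w, 0) : P × ℝ) = (v, 0) + (w, 0) := by simp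
        exact (congrArg (fderiv ℝ f (p₀, (s : ℝ))) h).trans ((fderiv ℝ f (p₀, (s : ℝ))).map_add _ _)
      map_smul' := fun c w => by
        ext s
        have h : ((c • w, 0) : P × ℝ) = c • (w, 0) := by simp
        exact (congrArg (fderiv ℝ f (p₀, (s : ℝ))) h).trans ((fderiv ℝ f (p₀, (s : ℝ))).map_smul _ _) }
  refine ⟨L, ?_, fun w s => rfl⟩
  rw [hasFDerivAt_iff_isLittleO, Asymptotics.isLittleO_iff]
  intro ε hε
  -- Compactness of the interval makes the derivative close to its value at p₀ uniformly in s; the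
  -- mean value inequality on the ball then gives the sup-norm estimate.
  have h1 : ∀ᶠ p in 𝓝 p₀, ∀ s ∈ (Set.univ : Set unitInterval),
      ‖fderiv ℝ f (p, (s : ℝ)) - fderiv ℝ f (p₀, (s : ℝ))‖ ≤ ε := by
    refine isCompact_univ.eventually_forall_of_forall_eventually fun s _ => ?_
    have hc : Continuous fun z : P × unitInterval =>
        ‖fderiv ℝ f (z.1, (z.2 : ℝ)) - fderiv ℝ f (p₀, (z.2 : ℝ))‖ := by fun_prop
    have := (hc.continuousAt (x := (p₀, s))).eventually_lt (continuousAt_const (y := ε)) (by simpa)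
    exact this.mono fun z hz => hz.le
  obtain ⟨δ, hδ, hball⟩ := Metric.eventually_nhds_iff_ball.1 h1
  filter_upwards [Metric.ball_mem_nhds p₀ hδ] with p hp
  rw [ContinuousMap.norm_le _ (by positivity)]
  intro s
  have hd : ∀ q ∈ Metric.ball p₀ δ, HasFDerivWithinAt (fun q : P => f (q, (s : ℝ)))
      ((fderiv ℝ f (q, (s : ℝ))).comp (ContinuousLinearMap.inl ℝ P ℝ)) (Metric.ball p₀ δ) q := by
    intro q _
    have h2 : HasFDerivAt f (fderiv ℝ f (q, (s : ℝ))) (q, (s : ℝ)) :=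
      (hf.differentiable one_ne_zero _).hasFDerivAt
    exact (h2.comp q (hasFDerivAt_prodMk_left q (s : ℝ))).hasFDerivWithinAt
  have h3 := (convex_ball p₀ δ).norm_image_sub_le_of_norm_hasFDerivWithin_le' (C := ε)
    (φ := (fderiv ℝ f (p₀, (s : ℝ))).comp (ContinuousLinearMap.inl ℝ P ℝ)) hd (fun q hq => by
      rw [← ContinuousLinearMap.sub_comp]
      refine (ContinuousLinearMap.opNorm_comp_le _ _).trans ?_
      refine (mul_le_mul (hball q hq s trivial) (ContinuousLinearMap.norm_inl_le_one ℝ P ℝ)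
        (norm_nonneg _) hε.le).trans ?_
      simp) (Metric.mem_ball_self hδ) hp
  have h4 : (a p - a p₀ - L (p - p₀)) s = f (p, s) - f (p₀, s) -
      fderiv ℝ f (p₀, (s : ℝ)) (p - p₀, 0) := by
    simp only [ContinuousMap.sub_apply, ha]
    rfl
  rw [h4]
  simpa using h3

variable [CompleteSpace E]

/-- The operator of integration from `0` on continuous functions on the unit interval. -/
noncomputable def primitiveCLM (E : Type*) [NormedRing E] [NormedAlgebra ℝ E] [CompleteSpace E] :
    C(unitInterval, E) →L[ℝ] C(unitInterval, E) :=
  LinearMap.mkContinuous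
    { toFun := fun u => ⟨fun t => ∫ s in (0 : ℝ)..t, Set.IccExtend zero_le_one u s, by
        have h : Continuous fun t : ℝ => ∫ s in (0 : ℝ)..t, Set.IccExtend zero_le_one u s :=
          intervalIntegral.continuous_primitive
            (fun a b => (u.continuous.Icc_extend' (h := zero_le_one)).intervalIntegrable a b) 0
        exact h.comp continuous_subtype_val⟩
      map_add' := fun u v => by
        ext t
        have hu := (u.continuous.Icc_extend' (h := zero_le_one (α := ℝ))).intervalIntegrable
          (μ := volume) 0 t
        have hv := (v.continuous.Icc_extend' (h := zero_le_one (α := ℝ))).intervalIntegrable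
          (μ := volume) 0 t
        exact intervalIntegral.integral_add hu hv
      map_smul' := fun c u => by
        ext t
        exact intervalIntegral.integral_smul c _ } 1 (fun u => by
      rw [ContinuousMap.norm_le _ (by positivity)]
      intro t
      change ‖∫ s in (0 : ℝ)..t, Set.IccExtend zero_le_one u s‖ ≤ _
      refine (intervalIntegral.norm_integral_le_of_norm_le_const (C := ‖u‖) fun s _ =>
        u.norm_coe_le_norm _).trans ?_
      rw [sub_zero, abs_of_nonneg t.2.1]
      have := mul_le_mul_of_nonneg_left t.2.2 (norm_nonneg u)
      linarith)

theorem primitiveCLM_apply (u : C(unitInterval, E)) (t : unitInterval) :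
    primitiveCLM E u t = ∫ s in (0 : ℝ)..t, Set.IccExtend zero_le_one u s := rfl

theorem primitiveCLM_eq_integral (u : C(unitInterval, E)) (t : unitInterval) (v : ℝ → E)
    (h : ∀ s : unitInterval, u s = v s) :
    primitiveCLM E u t = ∫ s in (0 : ℝ)..t, v s := by
  rw [primitiveCLM_apply]
  refine intervalIntegral.integral_congr fun s hs => ?_
  rw [Set.uIcc_of_le t.2.1] at hs
  have hs' : s ∈ Set.Icc (0 : ℝ) 1 := ⟨hs.1, hs.2.trans t.2.2⟩
  rw [Set.IccExtend_of_mem zero_le_one u hs', h]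

/-- The Volterra operator `u ↦ ∫₀ᵗ a u`, as a function of `a`. -/
noncomputable def volterraCLM (E : Type*) [NormedRing E] [NormedAlgebra ℝ E] [CompleteSpace E] :
    C(unitInterval, E) →L[ℝ] C(unitInterval, E) →L[ℝ] C(unitInterval, E) :=
  (ContinuousLinearMap.compL ℝ _ _ _ (primitiveCLM E)).comp
    (ContinuousLinearMap.mul ℝ C(unitInterval, E))

theorem volterraCLM_apply (a u : C(unitInterval, E)) :
    volterraCLM E a u = primitiveCLM E (a * u) := rfl

/-- Solving `u + K (a p) u = e` near a zero of the differentiable function `a`, with the derivative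
of the solution. -/
theorem exists_hasFDerivAt_solution {Z : Type*} [NormedAddCommGroup Z] [NormedSpace ℝ Z]
    [CompleteSpace Z] (K : Z →L[ℝ] Z →L[ℝ] Z) (a : P → Z) (a' : P → P →L[ℝ] Z)
    (ha : ∀ p, HasFDerivAt a (a' p) p) (ha0 : a 0 = 0) (e : Z) :
    ∃ (u : P → Z) (u' : P → P →L[ℝ] Z), u 0 = e ∧ ∀ᶠ p in 𝓝 (0 : P),
      u p + K (a p) (u p) = e ∧ (∀ η, η + K (a p) η = 0 → η = 0) ∧ HasFDerivAt u (u' p) p ∧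
      ∀ w, u' p w + K (a p) (u' p w) + K (a' p w) (u p) = 0 := by
  -- At p = 0 this operator is the identity, and units are open, so near 0 the solution is T(p)⁻¹e.
  -- Its differentiability is that of inversion, and the product rule for T(p)u(p) = e gives the
  -- last identity.
  let T : P → (Z →L[ℝ] Z) := fun p => 1 + K (a p)
  have hTd : ∀ p, HasFDerivAt T (K.comp (a' p)) p := fun p =>
    (K.hasFDerivAt.comp p (ha p)).const_add _
  have hTcont : Continuous T := continuous_iff_continuousAt.2 fun p => (hTd p).continuousAt
  have hT0 : T 0 = 1 := by simp [T, ha0]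
  have hunit : ∀ᶠ p in 𝓝 (0 : P), IsUnit (T p) := by
    have : {S : Z →L[ℝ] Z | IsUnit S} ∈ 𝓝 (T 0) := by
      rw [hT0]; exact Units.isOpen.mem_nhds isUnit_one
    exact hTcont.continuousAt this
  let u : P → Z := fun p => Ring.inverse (T p) e
  have hTu : ∀ q, IsUnit (T q) → T q (u q) = e := by
    intro q hq
    have := Ring.mul_inverse_cancel _ hq
    exact congrArg (fun S => S e) this
  have hu' : ∀ p, ∃ u' : P →L[ℝ] Z, IsUnit (T p) → HasFDerivAt u u' p := by
    intro p
    by_cases hp : IsUnit (T p)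
    · obtain ⟨S, hS⟩ := hp
      have h1 := hasFDerivAt_ringInverse (𝕜 := ℝ) S
      rw [hS] at h1
      exact ⟨_, fun _ => (h1.comp p (hTd p)).clm_apply (hasFDerivAt_const e p)⟩
    · exact ⟨0, fun h => absurd h hp⟩
  choose u' hu' using hu'
  refine ⟨u, u', by simp [u, hT0], ?_⟩
  filter_upwards [hunit.eventually_nhds] with p hp
  have hpu := hp.self_of_nhds
  refine ⟨hTu p hpu, fun η hη => ?_, hu' p hpu, fun w => ?_⟩
  · have h1 := Ring.inverse_mul_cancel _ hpu
    have h2 : Ring.inverse (T p) (T p η) = η := congrArg (fun S => S η) h1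
    have h3 : T p η = 0 := hη
    rw [← h2, h3, map_zero]
  · have h1 := (hTd p).clm_apply (hu' p hpu)
    have h2 : HasFDerivAt (fun q => T q (u q)) (0 : P →L[ℝ] Z) p := by
      refine (hasFDerivAt_const e p).congr_of_eventuallyEq ?_
      filter_upwards [hp] with q hq using hTu q hq
    have h3 := congrArg (fun L => L w) (h1.unique h2)
    simpa [T] using h3

theorem hasDerivAt_smul_apply_ray {A : P → P →L[ℝ] E} (p w : P) (t : ℝ)
    (hA : DifferentiableAt ℝ A (t • p)) :
    HasDerivAt (fun s : ℝ => s • A (s • p) w)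
      (A (t • p) w + t • fderiv ℝ A (t • p) p w) t := by
  have h1 : HasDerivAt (fun s : ℝ => s • p) p t := by
    simpa using (hasDerivAt_id t).smul_const p
  have h2 : HasDerivAt (fun s : ℝ => A (s • p)) (fderiv ℝ A (t • p) p) t :=
    HasFDerivAt.comp_hasDerivAt (f := fun s : ℝ => s • p) t hA.hasFDerivAt h1
  have h3 : HasDerivAt (fun s : ℝ => A (s • p) w) (fderiv ℝ A (t • p) p w) t := by
    simpa using h2.clm_apply (hasDerivAt_const t w)
  have h4 := (hasDerivAt_id t).smul h3
  simp only [id, one_smul] at h4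
  rw [add_comm]
  exact h4

/-- Local existence of parallel frames for a flat `C¹` connection form. -/
theorem exists_parallel_of_flat (A : P → P →L[ℝ] E) (hA : ContDiff ℝ 1 A) {r : ℝ} (hr : 0 < r)
    (hflat : ∀ q ∈ Metric.ball (0 : P) r, ∀ v w,
      fderiv ℝ A q v w - fderiv ℝ A q w v + (A q v * A q w - A q w * A q v) = 0) :
    ∃ g : P → E, g 0 = 1 ∧ ∀ᶠ p in 𝓝 (0 : P), ∃ L : P →L[ℝ] E, HasFDerivAt g L p ∧
      ∀ w, L w = -(A p w * g p) := by
  -- The frame is found by parallel transport along rays: u solves u' = -A(sp)p u with u(0) = 1,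
  -- written as a Volterra equation in the Banach space of continuous functions so that
  -- differentiability in p comes from inverting an operator. The frame is g(p) = u(1).
  let f : P × ℝ → E := fun z => A (z.2 • z.1) z.1
  have hf : ContDiff ℝ 1 f :=
    (hA.comp (contDiff_snd.smul contDiff_fst)).clm_apply contDiff_fst
  let a : P → C(unitInterval, E) := fun p => ⟨fun s => f (p, s), by
    have := hf.continuous
    fun_prop⟩
  have hfd : ∀ p w (s : ℝ), fderiv ℝ f (p, s) (w, 0) =
      s • fderiv ℝ A (s • p) w p + A (s • p) w := by
    intro p w s
    have h0 : HasFDerivAt A (fderiv ℝ A (s • p)) (s • p) :=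
      (hA.differentiable one_ne_zero _).hasFDerivAt
    have h1 : HasFDerivAt (fun q : P => s • q) (s • ContinuousLinearMap.id ℝ P) p :=
      (hasFDerivAt_id p).const_smul s
    have h2 : HasFDerivAt (fun q : P => A (s • q) q) _ p :=
      (h0.comp p h1).clm_apply (hasFDerivAt_id p)
    have h3' : HasFDerivAt f (fderiv ℝ f (p, s)) (p, s) :=
      (hf.differentiable one_ne_zero (p, s)).hasFDerivAt
    have h3 : HasFDerivAt (fun q : P => f (q, s))
        ((fderiv ℝ f (p, s)).comp (ContinuousLinearMap.inl ℝ P ℝ)) p :=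
      HasFDerivAt.comp (g := f) (f := fun q : P => (q, s)) p h3' (hasFDerivAt_prodMk_left p s)
    have h4 := congrArg (fun L => L w) (h3.unique h2)
    simp at h4
    rw [h4]
    abel
  have hder : ∀ p, ∃ L : P →L[ℝ] C(unitInterval, E), HasFDerivAt a L p ∧
      ∀ w s, L w s = (s : ℝ) • fderiv ℝ A ((s : ℝ) • p) w p + A ((s : ℝ) • p) w := by
    intro p
    obtain ⟨L, h1, h2⟩ := hasFDerivAt_continuousMap hf a (fun _ _ => rfl) p
    exact ⟨L, h1, fun w s => (h2 w s).trans (hfd p w s)⟩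
  choose a' ha' ha'w using hder
  obtain ⟨u, u', hu0, hu⟩ := exists_hasFDerivAt_solution (volterraCLM E) a a' ha'
    (by ext s; simp [a, f]) 1
  refine ⟨fun p => u p 1, by simp [hu0], ?_⟩
  filter_upwards [hu, Metric.ball_mem_nhds (0 : P) hr] with p ⟨hup, hinj, hu', hprod⟩ hpr
  let ev1 : C(unitInterval, E) →L[ℝ] E := ContinuousMap.evalCLM ℝ (1 : unitInterval)
  refine ⟨ev1.comp (u' p), ev1.hasFDerivAt.comp p hu', fun w => ?_⟩
  change u' p w 1 = _
  set k := u' p w with hk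
  -- Moving p in the direction w moves the point sp by sw, and N(s) is A on this variation. Hence η
  -- = ∂_w u + N u is the covariant derivative of u along the variation; at s = 1 its vanishing is
  -- the required equation. It vanishes because it solves the homogeneous Volterra equation.
  let N : ℝ → E := fun s => s • A (s • p) w
  have hAs : Continuous fun s : ℝ => A (s • p) := hA.continuous.comp (by fun_prop)
  have hNcont : Continuous N := by fun_prop
  let η : C(unitInterval, E) := k + ⟨fun s => N s, by fun_prop⟩ * u p
  have hηs : ∀ s : unitInterval, η s = k s + N s * u p s := fun s => rfl
  suffices hη : η = 0 by
    have h1 : η 1 = 0 := by rw [hη]; rfl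
    rw [hηs] at h1
    have h2 : N ((1 : unitInterval) : ℝ) = A p w := by simp [N]
    rw [h2] at h1
    exact eq_neg_of_add_eq_zero_left h1
  refine hinj η ?_
  -- the functions on the real line extending `u p`, `k`, given by the integral equations
  let ue : ℝ → E := Set.IccExtend zero_le_one (u p)
  let ke : ℝ → E := Set.IccExtend zero_le_one k
  have huec : Continuous ue := (u p).continuous.Icc_extend'
  have hkec : Continuous ke := k.continuous.Icc_extend'
  let α : ℝ → E := fun s => A (s • p) p
  have hαc : Continuous α := by fun_prop
  let β : ℝ → E := fun s => s • fderiv ℝ A (s • p) w p + A (s • p) w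
  have hDA : Continuous (fderiv ℝ A) := hA.continuous_fderiv one_ne_zero
  have hβc : Continuous β := by fun_prop
  let uh : ℝ → E := fun t => 1 - ∫ s in (0 : ℝ)..t, α s * ue s
  let kh : ℝ → E := fun t => -∫ s in (0 : ℝ)..t, (β s * ue s + α s * ke s)
  have huh : ∀ t : unitInterval, u p t = uh t := by
    intro t
    have h1 := congrArg (fun v => v t) hup
    simp only [ContinuousMap.add_apply, volterraCLM_apply, ContinuousMap.one_apply] at h1
    rw [primitiveCLM_eq_integral _ t (fun s => α s * ue s) (fun s => by
      simp [a, f, α, ue])] at h1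
    exact eq_sub_of_add_eq h1
  have hkh : ∀ t : unitInterval, k t = kh t := by
    intro t
    have h1 := congrArg (fun v => v t) (hprod w)
    simp only [ContinuousMap.add_apply, volterraCLM_apply, ContinuousMap.zero_apply] at h1
    rw [primitiveCLM_eq_integral _ t (fun s => α s * ke s) (fun s => by
      simp [a, f, α, ke, hk]), primitiveCLM_eq_integral _ t (fun s => β s * ue s) (fun s => by
      simp [β, ue, ha'w])] at h1
    simp only [kh]
    have h2 : ∫ s in (0 : ℝ)..t, (β s * ue s + α s * ke s) =
        (∫ s in (0 : ℝ)..t, β s * ue s) + ∫ s in (0 : ℝ)..t, α s * ke s :=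
      intervalIntegral.integral_add ((hβc.mul huec).intervalIntegrable _ _)
        ((hαc.mul hkec).intervalIntegrable _ _)
    rw [h2]
    rw [← hk] at h1
    rw [eq_neg_iff_add_eq_zero, ← h1]
    abel
  have huhd : ∀ t, HasDerivAt uh (-(α t * ue t)) t := by
    intro t
    have := (hαc.mul huec).integral_hasStrictDerivAt 0 t
    simpa using (this.hasDerivAt.const_sub 1)
  have hkhd : ∀ t, HasDerivAt kh (-(β t * ue t + α t * ke t)) t := by
    intro t
    have := ((hβc.mul huec).add (hαc.mul hkec)).integral_hasStrictDerivAt 0 t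
    exact this.hasDerivAt.neg
  have hNd : ∀ t, HasDerivAt N (A (t • p) w + t • fderiv ℝ A (t • p) p w) t := by
    intro t
    exact hasDerivAt_smul_apply_ray p w t (hA.differentiable one_ne_zero _)
  ext t
  simp only [ContinuousMap.add_apply, volterraCLM_apply, ContinuousMap.zero_apply]
  let ηh : ℝ → E := fun s => kh s + N s * uh s
  have hint : Continuous fun s => -(β s * ue s + α s * ke s) +
      ((A (s • p) w + s • fderiv ℝ A (s • p) p w) * uh s + N s * -(α s * ue s)) := by
    have : Continuous uh := continuous_iff_continuousAt.2 fun t => (huhd t).continuousAt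
    fun_prop
  have hFTC := intervalIntegral.integral_eq_sub_of_hasDerivAt (a := 0) (b := (t : ℝ))
    (fun s _ => (hkhd s).add ((hNd s).mul (huhd s))) (hint.intervalIntegrable _ _)
  have hη0 : kh 0 + N 0 * uh 0 = 0 := by simp [kh, N]
  simp only [Pi.add_apply, Pi.mul_apply] at hFTC
  rw [hη0, sub_zero, ← huh, ← hkh, ← hηs] at hFTC
  rw [← hFTC, primitiveCLM_apply, ← intervalIntegral.integral_add (hint.intervalIntegrable _ _)
    ((a p * η).continuous.Icc_extend'.intervalIntegrable _ _)]
  rw [← intervalIntegral.integral_zero (a := 0) (b := (t : ℝ)) (μ := volume) (E := E)]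
  refine intervalIntegral.integral_congr fun s hs => ?_
  rw [Set.uIcc_of_le t.2.1] at hs
  have hs' : s ∈ Set.Icc (0 : ℝ) 1 := ⟨hs.1, hs.2.trans t.2.2⟩
  have e1 : uh s = u p ⟨s, hs'⟩ := (huh ⟨s, hs'⟩).symm
  have e2 : ue s = u p ⟨s, hs'⟩ := Set.IccExtend_of_mem _ _ hs'
  have e3 : ke s = k ⟨s, hs'⟩ := Set.IccExtend_of_mem _ _ hs'
  have e4 : Set.IccExtend zero_le_one (⇑(a p * η)) s = α s * (k ⟨s, hs'⟩ + N s * u p ⟨s, hs'⟩) :=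
    Set.IccExtend_of_mem _ _ hs'
  have hsp : s • p ∈ Metric.ball (0 : P) r := by
    rw [mem_ball_zero_iff] at hpr ⊢
    rw [norm_smul, Real.norm_of_nonneg hs'.1]
    exact (mul_le_of_le_one_left (norm_nonneg _) hs'.2).trans_lt hpr
  -- Flatness is used at this point only, on the segment from 0 to p: it exchanges the derivative of
  -- A along the ray with that along w, at the cost of the commutator that cancels the remaining
  -- terms.
  have hfl := hflat _ hsp p w
  have e5 : fderiv ℝ A (s • p) p w = fderiv ℝ A (s • p) w p -
      (A (s • p) p * A (s • p) w - A (s • p) w * A (s • p) p) := by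
    rw [← sub_eq_zero, ← hfl]; abel
  simp only [e1, e2, e3, e4, e5, β, N, α]
  simp only [smul_sub, add_mul, sub_mul, mul_add, mul_neg, smul_mul_assoc, mul_smul_comm, mul_assoc]
  abel

end Frobenius

/-- Bootstrapping: dg = -A g with A smooth, so if g is Cⁿ then dg is Cⁿ and g is Cⁿ⁺¹. -/
theorem contDiffOn_of_hasFDerivAt_eq {P E : Type*} [NormedAddCommGroup P] [NormedSpace ℝ P]
    [NormedRing E] [NormedAlgebra ℝ E] {U : Set P} (hU : IsOpen U) {A : P → P →L[ℝ] E}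
    (hA : ContDiffOn ℝ ∞ A U) {g : P → E}
    (hg : ∀ p ∈ U, ∃ L : P →L[ℝ] E, HasFDerivAt g L p ∧ ∀ w, L w = -(A p w * g p)) :
    ContDiffOn ℝ ∞ g U := by
  have hfd : ∀ p ∈ U, HasFDerivAt g (-((ContinuousLinearMap.compL ℝ P E E)
      ((ContinuousLinearMap.mul ℝ E).flip (g p)) (A p))) p := by
    intro p hp
    obtain ⟨L, hL, hLw⟩ := hg p hp
    convert hL using 1
    ext w
    simp [hLw]
  rw [contDiffOn_infty]
  intro n
  induction n with
  | zero =>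
    rw [Nat.cast_zero, contDiffOn_zero]
    exact fun p hp => (hfd p hp).continuousAt.continuousWithinAt
  | succ n ih =>
    rw [Nat.cast_succ, contDiffOn_succ_iff_fderiv_of_isOpen hU]
    refine ⟨fun p hp => (hfd p hp).differentiableAt.differentiableWithinAt, by simp, ?_⟩
    have h1 : ContDiffOn ℝ n (fun p => -((ContinuousLinearMap.compL ℝ P E E)
      ((ContinuousLinearMap.mul ℝ E).flip (g p)) (A p))) U := by
      refine ContDiffOn.neg (ContDiffOn.clm_apply ?_ (hA.of_le (by exact_mod_cast le_top)))
      exact (ContinuousLinearMap.contDiff _).comp_contDiffOn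
        ((ContinuousLinearMap.contDiff _).comp_contDiffOn ih)
    exact h1.congr fun p hp => (hfd p hp).fderiv

/-! ### Coordinate vector fields and connection matrices -/

section

variable {X : Type*} [TopologicalSpace X] [ChartedSpace ℂ X] [IsManifold 𝓘(ℂ) ω X]
  {F : Type} [NormedAddCommGroup F] [NormedSpace ℂ F] [FiniteDimensional ℂ F]
  {V : X → Type} [∀ x, NormedAddCommGroup (V x)] [∀ x, InnerProductSpace ℂ (V x)]
  [TopologicalSpace (Bundle.TotalSpace F V)] [FiberBundle F V]
  [VectorBundle ℂ F V]

/-- The constant vector field on `ℂ`. -/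
def constField (c : ℂ) : ∀ z : ℂ, TangentSpace 𝓘(ℝ, ℂ) z := fun _ => c

/-- The coordinate vector fields of the preferred chart at `x₀`. -/
noncomputable def coordField (x₀ : X) (c : ℂ) : ∀ y : X, TangentSpace 𝓘(ℝ, ℂ) y :=
  VectorField.mpullback 𝓘(ℝ, ℂ) 𝓘(ℝ, ℂ) (extChartAt 𝓘(ℝ, ℂ) x₀) (constField c)

theorem coordField_apply (x₀ : X) (c : ℂ) (y : X) :
    coordField x₀ c y = (mfderiv 𝓘(ℝ, ℂ) 𝓘(ℝ, ℂ) (extChartAt 𝓘(ℝ, ℂ) x₀) y).inverse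
      (constField c (extChartAt 𝓘(ℝ, ℂ) x₀ y)) := rfl

theorem isManifold_real_infty : IsManifold 𝓘(ℝ, ℂ) ∞ X := IsManifold.of_le (n := ω) le_top

theorem contMDiffAt_constField (c z : ℂ) :
    ContMDiffAt 𝓘(ℝ, ℂ) (𝓘(ℝ, ℂ).prod 𝓘(ℝ, ℂ)) ∞
      (fun y => (⟨y, constField c y⟩ : TangentBundle 𝓘(ℝ, ℂ) ℂ)) z :=
  contMDiffAt_vectorSpace_iff_contDiffAt.2 contDiffAt_const

theorem isInvertible_mfderiv_chart {x₀ y : X} (hy : y ∈ (chartAt ℂ x₀).source) :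
    (mfderiv 𝓘(ℝ, ℂ) 𝓘(ℝ, ℂ) (extChartAt 𝓘(ℝ, ℂ) x₀) y).IsInvertible := by
  have := isManifold_real_infty (X := X)
  have : IsManifold 𝓘(ℝ, ℂ) 1 X := IsManifold.of_le (n := ω) le_top
  exact isInvertible_mfderiv_extChartAt (by simpa using hy)

theorem contMDiffAt_chart {x₀ y : X} (hy : y ∈ (chartAt ℂ x₀).source) :
    ContMDiffAt 𝓘(ℝ, ℂ) 𝓘(ℝ, ℂ) ∞ (extChartAt 𝓘(ℝ, ℂ) x₀) y := by
  have := isManifold_real_infty (X := X)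
  exact contMDiffAt_extChartAt' hy

theorem smoothFieldAt_coordField {x₀ y : X} (hy : y ∈ (chartAt ℂ x₀).source) (c : ℂ) :
    SmoothFieldAt (coordField x₀ c) y := by
  have := isManifold_real_infty (X := X)
  have := isManifold_real_infty (X := ℂ)
  exact ContMDiffAt.mpullback_vectorField_preimage (n := ∞) (m := ∞)
    (contMDiffAt_constField c _) (contMDiffAt_chart hy) (isInvertible_mfderiv_chart hy) (by simp)

/-- The chart pulls brackets back to brackets, and constant fields on ℂ commute. The bracket term
therefore drops out of the curvature in coordinates. -/
theorem mlieBracket_coordField {x₀ y : X} (hy : y ∈ (chartAt ℂ x₀).source) (c d : ℂ) :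
    VectorField.mlieBracket 𝓘(ℝ, ℂ) (coordField x₀ c) (coordField x₀ d) y = 0 := by
  have := isManifold_real_infty (X := X)
  have h := VectorField.mpullback_mlieBracket (I := 𝓘(ℝ, ℂ)) (I' := 𝓘(ℝ, ℂ)) (n := ∞)
    (f := extChartAt 𝓘(ℝ, ℂ) x₀) (x₀ := y)
    ((contMDiffAt_constField c (extChartAt 𝓘(ℝ, ℂ) x₀ y)).mdifferentiableAt (by simp))
    ((contMDiffAt_constField d (extChartAt 𝓘(ℝ, ℂ) x₀ y)).mdifferentiableAt (by simp))
    (contMDiffAt_chart hy) (by rw [minSmoothness_of_isRCLikeNormedField]; exact WithTop.coe_le_coe.2 (le_top : (2 : ℕ∞) ≤ ⊤))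
  rw [coordField, coordField, ← h, VectorField.mpullback_apply, ← VectorField.mlieBracketWithin_univ,
    VectorField.mlieBracketWithin_eq_lieBracketWithin]
  have h0 : ∀ (c z : ℂ), fderivWithin ℝ (constField c) Set.univ z = 0 := fun c z =>
    fderivWithin_const_apply (𝕜 := ℝ) (c : ℂ)
  simp only [VectorField.lieBracketWithin, h0]
  exact (congrArg _ (sub_zero (0 : ℂ))).trans (map_zero _)

theorem mfderiv_chart_coordField {x₀ y : X} (hy : y ∈ (chartAt ℂ x₀).source) (c : ℂ) :
    mfderiv 𝓘(ℝ, ℂ) 𝓘(ℝ, ℂ) (extChartAt 𝓘(ℝ, ℂ) x₀) y (coordField x₀ c y) = c := by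
  rw [coordField_apply]
  exact (isInvertible_mfderiv_chart hy).self_apply_inverse _

theorem exists_coordField_eq {x₀ y : X} (hy : y ∈ (chartAt ℂ x₀).source)
    (w : TangentSpace 𝓘(ℝ, ℂ) y) : ∃ c : ℂ, coordField x₀ c y = w := by
  refine ⟨mfderiv 𝓘(ℝ, ℂ) 𝓘(ℝ, ℂ) (extChartAt 𝓘(ℝ, ℂ) x₀) y w, ?_⟩
  exact (isInvertible_mfderiv_chart hy).inverse_apply_self _

theorem coordField_add (x₀ : X) (c d : ℂ) (y : X) :
    coordField x₀ (c + d) y = coordField x₀ c y + coordField x₀ d y := by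
  simp only [coordField_apply]
  exact map_add _ _ _

theorem coordField_smul (x₀ : X) (r : ℝ) (c : ℂ) (y : X) :
    coordField x₀ (r • c) y = r • coordField x₀ c y := by
  simp only [coordField_apply]
  exact map_smul _ _ _

theorem mvfderiv_comp_chart {x₀ y : X} (hy : y ∈ (chartAt ℂ x₀).source) {γ : ℂ → ℝ}
    (hγ : DifferentiableAt ℝ γ (extChartAt 𝓘(ℝ, ℂ) x₀ y)) (c : ℂ) :
    mvfderiv 𝓘(ℝ, ℂ) (fun z => γ (extChartAt 𝓘(ℝ, ℂ) x₀ z)) y (coordField x₀ c y) =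
      fderiv ℝ γ (extChartAt 𝓘(ℝ, ℂ) x₀ y) c := by
  have h1 := mfderiv_comp y hγ.mdifferentiableAt
    ((contMDiffAt_chart hy).mdifferentiableAt (by simp))
  have h2 := congrArg (fun L => L (coordField x₀ c y)) h1
  rw [mfderiv_eq_fderiv] at h2
  refine h2.trans ?_
  change fderiv ℝ γ _ (mfderiv 𝓘(ℝ, ℂ) 𝓘(ℝ, ℂ) (extChartAt 𝓘(ℝ, ℂ) x₀) y (coordField x₀ c y)) = _
  rw [mfderiv_chart_coordField hy]

end

section

variable {X : Type*} [TopologicalSpace X] [ChartedSpace ℂ X] [IsManifold 𝓘(ℂ) ω X]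
  {F : Type} [NormedAddCommGroup F] [NormedSpace ℂ F] [FiniteDimensional ℂ F]
  {V : X → Type} [∀ x, NormedAddCommGroup (V x)] [∀ x, InnerProductSpace ℂ (V x)]
  [TopologicalSpace (Bundle.TotalSpace F V)] [FiberBundle F V]
  [VectorBundle ℂ F V] [ContMDiffVectorBundle ∞ F V 𝓘(ℝ, ℂ)]

theorem diffSectionAt_sum {ι : Type*} (s : Finset ι) {σ : ι → ∀ x, V x} {x : X}
    (h : ∀ i ∈ s, DiffSectionAt F (σ i) x) : DiffSectionAt F (fun y => ∑ i ∈ s, σ i y) x :=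
  MDifferentiableAt.sum_section h

theorem DiffSectionAt.smul {g : X → ℝ} {σ : ∀ x, V x} {x : X}
    (hg : MDifferentiableAt 𝓘(ℝ, ℂ) 𝓘(ℝ, ℝ) g x) (h : DiffSectionAt F σ x) :
    DiffSectionAt F (fun y => g y • σ y) x :=
  MDifferentiableAt.smul_section hg h

/-- The constant section in the preferred trivialization, as a linear map to the fibre. -/
theorem secOfCoord_apply (x₀ : X) (a : X → F) (y : X) :
    secOfCoord F V x₀ a y = (trivializationAt F V x₀).symmₗ ℂ y (a y) := rfl

theorem secOfCoord_injective (x₀ : X) {y : X} (hy : y ∈ (trivializationAt F V x₀).baseSet)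
    {v : F} (h : (trivializationAt F V x₀).symmₗ ℂ y v = 0) : v = 0 := by
  have h1 := secCoord_secOfCoord (V := V) x₀ (fun _ => v) hy
  rw [← h1, secCoord, secOfCoord_apply, h]
  exact ((trivializationAt F V x₀).linear ℂ hy).map_zero

namespace IsFlatConnection

variable {D : (∀ x, V x) → ∀ x : X, TangentSpace 𝓘(ℝ, ℂ) x → V x} (hD : IsFlatConnection F V D)

include hD

theorem apply_zero (σ : ∀ x, V x) (x : X) : D σ x 0 = 0 := by
  have := hD.smul_vec σ x 0 0
  simpa using this

theorem zero (x : X) (v) : D (fun y => (0 : V y)) x v = 0 := by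
  have h := hD.smul x (fun _ => 0) (fun y => 0) mdifferentiableAt_const
    (smoothSectionAt_zero x).diff v
  simpa using h

theorem sum {ι : Type*} (s : Finset ι) (σ : ι → ∀ x, V x) (x : X)
    (h : ∀ i ∈ s, DiffSectionAt F (σ i) x) (v) :
    D (fun y => ∑ i ∈ s, σ i y) x v = ∑ i ∈ s, D (σ i) x v := by
  classical
  induction s using Finset.induction_on with
  | empty => simpa using hD.zero x v
  | insert i s hi ih =>
    simp only [Finset.sum_insert hi]
    rw [hD.add x _ _ (h i (by simp)) (diffSectionAt_sum s fun j hj => h j (by simp [hj])),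
      ih fun j hj => h j (by simp [hj])]

/-- The Leibniz rule is given for real functions, so the coordinates are expanded in a real basis of
F. -/
theorem secOfCoord_comp_chart_aux (x₀ : X) {y : X} (hy : y ∈ (trivializationAt F V x₀).baseSet)
    (hy' : y ∈ (chartAt ℂ x₀).source) {α : ℂ → F}
    (hα : DifferentiableAt ℝ α (extChartAt 𝓘(ℝ, ℂ) x₀ y)) (c : ℂ) :
    D (secOfCoord F V x₀ (fun z => α (extChartAt 𝓘(ℝ, ℂ) x₀ z))) y (coordField x₀ c y) =
      ∑ i, (Module.finBasis ℝ F).coord i (α (extChartAt 𝓘(ℝ, ℂ) x₀ y)) •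
        D (secOfCoord F V x₀ (fun _ => Module.finBasis ℝ F i)) y (coordField x₀ c y) +
      (trivializationAt F V x₀).symmₗ ℂ y (fderiv ℝ α (extChartAt 𝓘(ℝ, ℂ) x₀ y) c) := by
  set b := Module.finBasis ℝ F
  set κ := extChartAt 𝓘(ℝ, ℂ) x₀
  have hsmul : ∀ (z : X) (r : ℝ) (v : F), (trivializationAt F V x₀).symmₗ ℂ z (r • v) =
      r • (trivializationAt F V x₀).symmₗ ℂ z v := fun z r v =>
    LinearMap.map_smul_of_tower _ r v
  have hexp : ∀ (z : X) (v : F), (trivializationAt F V x₀).symmₗ ℂ z v =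
      ∑ i, b.coord i v • (trivializationAt F V x₀).symmₗ ℂ z (b i) := by
    intro z v
    conv_lhs => rw [← b.sum_repr v, map_sum]
    simp only [hsmul, Module.Basis.coord_apply]
  have h1 : secOfCoord F V x₀ (fun z => α (κ z)) = fun z => ∑ i, b.coord i (α (κ z)) •
      secOfCoord F V x₀ (fun _ => b i) z := by
    funext z
    exact hexp z _
  have hγ : ∀ i, DifferentiableAt ℝ (fun u => b.coord i (α u)) (κ y) := fun i =>
    ((LinearMap.toContinuousLinearMap (b.coord i)).differentiableAt).comp _ hα
  have hγ' : ∀ i, MDifferentiableAt 𝓘(ℝ, ℂ) 𝓘(ℝ, ℝ) (fun z => b.coord i (α (κ z))) y := fun i =>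
    (hγ i).mdifferentiableAt.comp y ((contMDiffAt_chart hy').mdifferentiableAt (by simp))
  have hs : ∀ i, DiffSectionAt F (secOfCoord F V x₀ (fun _ => b i)) y := fun i =>
    (diffSectionAt_secOfCoord x₀ hy).2 mdifferentiableAt_const
  rw [h1, hD.sum _ _ _ fun i _ => DiffSectionAt.smul (hγ' i) (hs i)]
  have h2 : ∀ i, fderiv ℝ (fun u => b.coord i (α u)) (κ y) c =
      b.coord i (fderiv ℝ α (κ y) c) := by
    intro i
    have h3 := (LinearMap.toContinuousLinearMap (b.coord i)).hasFDerivAt.comp (κ y)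
      hα.hasFDerivAt
    exact congrArg (fun L => L c) h3.fderiv
  rw [hexp y (fderiv ℝ α (κ y) c), ← Finset.sum_add_distrib]
  refine Finset.sum_congr rfl fun i _ => ?_
  rw [hD.smul y _ _ (hγ' i) (hs i), mvfderiv_comp_chart hy' (hγ i), h2]
  rfl

/-- The connection in the preferred chart and trivialization. -/
theorem secOfCoord_comp_chart (x₀ : X) {y : X} (hy : y ∈ (trivializationAt F V x₀).baseSet)
    (hy' : y ∈ (chartAt ℂ x₀).source) {α : ℂ → F}
    (hα : DifferentiableAt ℝ α (extChartAt 𝓘(ℝ, ℂ) x₀ y)) (c : ℂ) :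
    D (secOfCoord F V x₀ (fun z => α (extChartAt 𝓘(ℝ, ℂ) x₀ z))) y (coordField x₀ c y) =
      D (secOfCoord F V x₀ (fun _ => α (extChartAt 𝓘(ℝ, ℂ) x₀ y))) y (coordField x₀ c y) +
      (trivializationAt F V x₀).symmₗ ℂ y (fderiv ℝ α (extChartAt 𝓘(ℝ, ℂ) x₀ y) c) := by
  rw [hD.secOfCoord_comp_chart_aux x₀ hy hy' hα c]
  have h := hD.secOfCoord_comp_chart_aux x₀ hy hy'
    (differentiableAt_const (α (extChartAt 𝓘(ℝ, ℂ) x₀ y))) c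
  simp only [fderiv_fun_const, Pi.zero_apply, zero_apply, map_zero, add_zero] at h
  rw [h]

/-- The connection matrices in the preferred trivialization. -/
theorem exists_connectionMatrix (x₀ : X) : ∃ B : ℂ → X → F →L[ℂ] F,
    ∀ y ∈ (trivializationAt F V x₀).baseSet, y ∈ (chartAt ℂ x₀).source → ∀ c,
      (∀ v, D (secOfCoord F V x₀ (fun _ => v)) y (coordField x₀ c y) =
        (trivializationAt F V x₀).symmₗ ℂ y (B c y v)) ∧
      ContMDiffAt 𝓘(ℝ, ℂ) 𝓘(ℝ, F →L[ℂ] F) ∞ (B c) y := by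
  have hex : ∀ (c : ℂ) (y : X), ∃ L : F →L[ℂ] F, y ∈ (trivializationAt F V x₀).baseSet →
      ∀ v, L v = secCoord F V x₀
        (fun z => D (secOfCoord F V x₀ (fun _ => v)) z (coordField x₀ c z)) y := by
    intro c y
    by_cases hy : y ∈ (trivializationAt F V x₀).baseSet
    · have hs : ∀ v, DiffSectionAt F (secOfCoord F V x₀ (fun _ => v)) y := fun v =>
        (diffSectionAt_secOfCoord x₀ hy).2 mdifferentiableAt_const
      have hlin := (trivializationAt F V x₀).linear ℂ hy
      have hadd : ∀ v w : F, secCoord F V x₀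
          (fun z => D (secOfCoord F V x₀ (fun _ => v + w)) z (coordField x₀ c z)) y =
          secCoord F V x₀ (fun z => D (secOfCoord F V x₀ (fun _ => v)) z (coordField x₀ c z)) y +
          secCoord F V x₀ (fun z => D (secOfCoord F V x₀ (fun _ => w)) z (coordField x₀ c z)) y := by
        intro v w
        have h1 : secOfCoord F V x₀ (fun _ => v + w) = fun z => secOfCoord F V x₀ (fun _ => v) z +
          secOfCoord F V x₀ (fun _ => w) z := funext fun z => secOfCoord_add x₀ _ _ z
        simp only [secCoord, h1, hD.add y _ _ (hs v) (hs w)]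
        exact hlin.map_add _ _
      have hreal : ∀ (r : ℝ) (v : F), secCoord F V x₀
          (fun z => D (secOfCoord F V x₀ (fun _ => r • v)) z (coordField x₀ c z)) y =
          (r : ℂ) • secCoord F V x₀
            (fun z => D (secOfCoord F V x₀ (fun _ => v)) z (coordField x₀ c z)) y := by
        intro r v
        have h1 : secOfCoord F V x₀ (fun _ => r • v) =
            fun z => r • secOfCoord F V x₀ (fun _ => v) z :=
          funext fun z => LinearMap.map_smul_of_tower _ r v
        have h2 := hD.smul y (fun _ => r) _ mdifferentiableAt_const (hs v) (coordField x₀ c y)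
        simp only [mvfderiv_const, zero_apply, zero_smul, add_zero] at h2
        simp only [secCoord, h1, h2]
        exact hlin.map_smul (r : ℂ) _
      have hI : ∀ (v : F), secCoord F V x₀
          (fun z => D (secOfCoord F V x₀ (fun _ => Complex.I • v)) z (coordField x₀ c z)) y =
          Complex.I • secCoord F V x₀
            (fun z => D (secOfCoord F V x₀ (fun _ => v)) z (coordField x₀ c z)) y := by
        intro v
        have h1 : secOfCoord F V x₀ (fun _ => Complex.I • v) =
            fun z => Complex.I • secOfCoord F V x₀ (fun _ => v) z :=
          funext fun z => map_smul _ _ v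
        simp only [secCoord, h1, hD.smul_I y _ (hs v)]
        exact hlin.map_smul _ _
      -- Homogeneity over ℂ is put together from the Leibniz rule with constant real functions and
      -- commutation with i.
      refine ⟨LinearMap.toContinuousLinearMap
        { toFun := fun v => secCoord F V x₀
            (fun z => D (secOfCoord F V x₀ (fun _ => v)) z (coordField x₀ c z)) y
          map_add' := hadd
          map_smul' := fun a v => ?_ }, fun _ v => rfl⟩
      have h1 : a • v = a.re • v + a.im • (Complex.I • v) := by
        conv_lhs => rw [← Complex.re_add_im a, add_smul, mul_smul]
        simp
      rw [h1, hadd, hreal, hreal, hI, ← mul_smul, ← add_smul, Complex.re_add_im]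
      rfl
    · exact ⟨0, fun h => absurd h hy⟩
  choose B hB using hex
  refine ⟨B, fun y hy hy' c => ⟨fun v => ?_, contMDiffAt_clm_of_apply fun v => ?_⟩⟩
  · rw [hB c y hy v]
    exact (secOfCoord_secCoord x₀
      (fun z => D (secOfCoord F V x₀ (fun _ => v)) z (coordField x₀ c z)) hy).symm
  · have h1 : SmoothSectionAt F
        (fun z => D (secOfCoord F V x₀ (fun _ => v)) z (coordField x₀ c z)) y := by
      refine hD.smooth y _ _ (smoothFieldAt_coordField hy' c) ?_
      filter_upwards [baseSet_mem_nhds x₀ hy] with z hz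
      exact (smoothSectionAt_secOfCoord x₀ hz).2 contMDiffAt_const
    refine ((smoothSectionAt_iff x₀ hy).1 h1).congr_of_eventuallyEq ?_
    filter_upwards [baseSet_mem_nhds x₀ hy] with z hz using hB c z hz v

end IsFlatConnection

end

/-! ### Local parallel frames on the surface -/

theorem contDiffAt_smulRight {Z : Type*} [NormedAddCommGroup Z] [NormedSpace ℝ Z] {n : ℕ∞ω}
    (L : ℂ →L[ℝ] ℝ) {f : ℂ → Z} {u : ℂ} (hf : ContDiffAt ℝ n f u) :
    ContDiffAt ℝ n (fun z => L.smulRight (f z)) u :=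
  ((ContinuousLinearMap.smulRightL ℝ ℂ Z L).contDiff.contDiffAt).comp u hf

/-- The form is cut off to a globally defined C¹ form; flatness is only needed in a ball where the
cut-off function is 1. The solution is invertible near z₀ because it is 1 there. -/
theorem exists_parallel_near {E : Type*} [NormedRing E] [NormedAlgebra ℝ E] [CompleteSpace E]
    {W : Set ℂ} (hW : IsOpen W) {z₀ : ℂ} (hz : z₀ ∈ W) {A : ℂ → ℂ →L[ℝ] E}
    (hA : ContDiffOn ℝ ∞ A W)
    (hflat : ∀ q ∈ W, ∀ v w,
      fderiv ℝ A q v w - fderiv ℝ A q w v + (A q v * A q w - A q w * A q v) = 0) :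
    ∃ U ⊆ W, IsOpen U ∧ z₀ ∈ U ∧ ∃ g : ℂ → E, ContDiffOn ℝ ∞ g U ∧
      ∀ u ∈ U, IsUnit (g u) ∧ ∀ w, fderiv ℝ g u w = -(A u w * g u) := by
  obtain ⟨χ, hχ⟩ : ∃ χ : ContDiffBump z₀, tsupport χ ⊆ W := by
    obtain ⟨r, hr, hrW⟩ := Metric.nhds_basis_closedBall.mem_iff.1 (hW.mem_nhds hz)
    refine ⟨⟨r / 2, r, by linarith, by linarith⟩, ?_⟩
    rw [ContDiffBump.tsupport_eq]
    exact hrW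
  set B : ℂ → ℂ →L[ℝ] E := fun u => χ u • A u with hB
  have hBsm : ContDiff ℝ 1 B := by
    rw [contDiff_iff_contDiffAt]
    intro u
    by_cases hu : u ∈ tsupport χ
    · exact χ.contDiffAt.smul
        ((hA.contDiffAt (hW.mem_nhds (hχ hu))).of_le (WithTop.coe_le_coe.2 le_top))
    · refine (contDiffAt_const (c := (0 : ℂ →L[ℝ] E))).congr_of_eventuallyEq ?_
      filter_upwards [(isClosed_tsupport _).isOpen_compl.mem_nhds hu] with v hv
      change χ v • A v = 0
      rw [image_eq_zero_of_notMem_tsupport hv]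
      exact zero_smul ℝ (A v)
  have hev : ∀ᶠ u in 𝓝 z₀, B =ᶠ[𝓝 u] A := by
    refine Filter.Eventually.eventually_nhds (p := fun u => B u = A u) ?_
    filter_upwards [χ.eventuallyEq_one] with u hu
    simp [hB, hu]
  obtain ⟨r, hr, hrW⟩ := Metric.mem_nhds_iff.1 (hev.and (hW.mem_nhds hz))
  have hshift : ∀ q, fderiv ℝ (fun p => B (z₀ + p)) q = fderiv ℝ B (z₀ + q) := fun q =>
    fderiv_comp_add_left z₀
  obtain ⟨g, hg0, hg⟩ := exists_parallel_of_flat (fun p => B (z₀ + p))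
    (hBsm.comp (contDiff_const.add contDiff_id)) hr (fun q hq v w => by
      have h1 : z₀ + q ∈ Metric.ball z₀ r := by simpa using hq
      obtain ⟨h2, h3⟩ := hrW h1
      simp only [hshift]
      rw [h2.fderiv_eq, h2.self_of_nhds]
      exact hflat _ h3 v w)
  have htend : Filter.Tendsto (fun u => u - z₀) (𝓝 z₀) (𝓝 0) := by
    have : ContinuousAt (fun u => u - z₀) z₀ := by fun_prop
    simpa [ContinuousAt] using this
  have hgc : ContinuousAt g 0 := by
    obtain ⟨L, hL, -⟩ := hg.self_of_nhds
    exact hL.continuousAt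
  have hunit : ∀ᶠ u in 𝓝 z₀, IsUnit (g (u - z₀)) := by
    have h1 : ∀ᶠ p in 𝓝 0, IsUnit (g p) := by
      refine hgc.eventually ?_
      rw [hg0]
      exact Units.isOpen.mem_nhds (isUnit_one)
    exact htend.eventually h1
  obtain ⟨U, hU, hUo, hzU⟩ := eventually_nhds_iff.1
    ((htend.eventually hg).and (hunit.and (hev.and (hW.mem_nhds hz))))
  have hder : ∀ u ∈ U, ∃ L : ℂ →L[ℝ] E, HasFDerivAt (fun u => g (u - z₀)) L u ∧
      ∀ w, L w = -(A u w * g (u - z₀)) := by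
    intro u hu
    obtain ⟨⟨L, hL, hLw⟩, -, hBA, -⟩ := hU u hu
    refine ⟨L, ?_, fun w => ?_⟩
    · have h1 := HasFDerivAt.comp (g := g) (f := fun u => u - z₀) u hL
        ((hasFDerivAt_id u).sub_const z₀)
      rw [ContinuousLinearMap.comp_id] at h1
      exact h1
    · have := hLw w
      simp only [add_sub_cancel] at this
      rw [this, hBA.self_of_nhds]
  have hUW : U ⊆ W := fun u hu => (hU u hu).2.2.2
  refine ⟨U, hUW, hUo, hzU, fun u => g (u - z₀),
    contDiffOn_of_hasFDerivAt_eq hUo (hA.mono hUW) hder, fun u hu => ⟨(hU u hu).2.1, ?_⟩⟩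
  obtain ⟨L, hL, hLw⟩ := hder u hu
  rw [hL.fderiv]
  exact hLw

section

variable {X : Type*} [TopologicalSpace X] [ChartedSpace ℂ X] [IsManifold 𝓘(ℂ) ω X]
  {F : Type} [NormedAddCommGroup F] [NormedSpace ℂ F] [FiniteDimensional ℂ F]
  {V : X → Type} [∀ x, NormedAddCommGroup (V x)] [∀ x, InnerProductSpace ℂ (V x)]
  [TopologicalSpace (Bundle.TotalSpace F V)] [FiberBundle F V]
  [VectorBundle ℂ F V] [ContMDiffVectorBundle ∞ F V 𝓘(ℝ, ℂ)]

/-- In the chart and trivialization at x₀ the connection is d + A. As coordinate fields commute,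
flatness reads dA + A ∧ A = 0, and an invertible solution of dg = -A g turns the constant frame into
a parallel one. -/
theorem IsFlatConnection.exists_parallel_frame
    {D : (∀ x, V x) → ∀ x : X, TangentSpace 𝓘(ℝ, ℂ) x → V x} (hD : IsFlatConnection F V D)
    (x₀ : X) : ∃ U : Set X, IsOpen U ∧ x₀ ∈ U ∧ ∃ e : ∀ x, F →ₗ[ℂ] V x, ∀ x ∈ U,
      Function.Bijective (e x) ∧
      ∀ v, SmoothSectionAt F (fun y => e y v) x ∧ ∀ w, D (fun y => e y v) x w = 0 := by
  obtain ⟨B, hB⟩ := hD.exists_connectionMatrix x₀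
  set κ := extChartAt 𝓘(ℝ, ℂ) x₀ with hκ
  set W : Set ℂ := κ.target ∩ κ.symm ⁻¹' ((trivializationAt F V x₀).baseSet) with hWdef
  have hWo : IsOpen W :=
    (continuousOn_extChartAt_symm x₀).isOpen_inter_preimage
      (isOpen_extChartAt_target x₀) (trivializationAt F V x₀).open_baseSet
  have hsrc : ∀ u ∈ W, κ.symm u ∈ (chartAt ℂ x₀).source := fun u hu => by
    simpa [hκ] using κ.map_target hu.1
  have hinv : ∀ u ∈ W, κ (κ.symm u) = u := fun u hu => κ.right_inv hu.1
  have hM : IsManifold 𝓘(ℝ, ℂ) ∞ X := isManifold_real_infty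
  have hBsm : ∀ c, ∀ u ∈ W, ContDiffAt ℝ ∞ (fun u => B c (κ.symm u)) u := by
    intro c u hu
    have h1 := (hB _ hu.2 (hsrc u hu) c).2
    have h2 : ContMDiffAt 𝓘(ℝ, ℂ) 𝓘(ℝ, ℂ) ∞ κ.symm u :=
      (contMDiffOn_extChartAt_symm x₀).contMDiffAt ((isOpen_extChartAt_target x₀).mem_nhds hu.1)
    exact contMDiffAt_iff_contDiffAt.1 (h1.comp u h2)
  -- Linear interpolation between the directions 1 and i makes A a one-form by construction; `hBlin`
  -- shows that it gives the connection matrix in every direction.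
  set A : ℂ → ℂ →L[ℝ] (F →L[ℂ] F) := fun u =>
    Complex.reCLM.smulRight (B 1 (κ.symm u)) + Complex.imCLM.smulRight (B Complex.I (κ.symm u))
    with hA
  have hAapp : ∀ u w, A u w = w.re • B 1 (κ.symm u) + w.im • B Complex.I (κ.symm u) :=
    fun u w => rfl
  have hBlin : ∀ u ∈ W, ∀ w, B w (κ.symm u) = A u w := by
    intro u hu w
    ext v
    have h1 := fun c => (hB _ hu.2 (hsrc u hu) c).1 v
    have h2 : coordField x₀ w (κ.symm u) = w.re • coordField x₀ 1 (κ.symm u) +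
        w.im • coordField x₀ Complex.I (κ.symm u) := by
      rw [← coordField_smul, ← coordField_smul, ← coordField_add]
      congr 1
      simp
    have h3 := h1 w
    rw [h2, hD.add_vec, hD.smul_vec, hD.smul_vec, h1, h1] at h3
    refine sub_eq_zero.1 (secOfCoord_injective (V := V) x₀ hu.2 ?_)
    rw [map_sub, ← h3, hAapp]
    rw [add_apply, smul_apply, smul_apply, map_add]
    rw [LinearMap.map_smul_of_tower, LinearMap.map_smul_of_tower]
    exact sub_self _
  have hAsm : ContDiffOn ℝ ∞ A W := fun u hu => by
    refine (ContDiffAt.add (contDiffAt_smulRight Complex.reCLM (hBsm 1 u hu))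
      (contDiffAt_smulRight Complex.imCLM (hBsm Complex.I u hu))).contDiffWithinAt
  have hAd : ∀ u ∈ W, ∀ (c v : ℂ), fderiv ℝ A u c v =
      fderiv ℝ (fun z => B v (κ.symm z)) u c := by
    intro u hu c v
    have h1 : (fun z => B v (κ.symm z)) =ᶠ[𝓝 u] fun z => A z v := by
      filter_upwards [hWo.mem_nhds hu] with z hz using hBlin z hz v
    rw [h1.fderiv_eq, fderiv_clm_apply
      ((hAsm.contDiffAt (hWo.mem_nhds hu)).differentiableAt (by simp)) (differentiableAt_const _)]
    simp
  have hflat : ∀ q ∈ W, ∀ v w,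
      fderiv ℝ A q v w - fderiv ℝ A q w v + (A q v * A q w - A q w * A q v) = 0 := by
    intro q hq c d
    set y := κ.symm q with hy
    have hyb : y ∈ (trivializationAt F V x₀).baseSet := hq.2
    have hys : y ∈ (chartAt ℂ x₀).source := hsrc q hq
    have hκy : κ y = q := hinv q hq
    -- The second covariant derivative of a constant section has the coordinates B_c B_d v + (∂_c
    -- A)(d) v; antisymmetrizing in c and d yields dA + A ∧ A.
    have hcd : ∀ c d v, D (fun y => D (secOfCoord F V x₀ (fun _ => v)) y (coordField x₀ d y)) y
        (coordField x₀ c y) = (trivializationAt F V x₀).symmₗ ℂ y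
          (B c y (B d y v) + fderiv ℝ A q c d v) := by
      intro c d v
      have hα : DifferentiableAt ℝ (fun z => B d (κ.symm z) v) (κ y) := by
        rw [hκy]
        exact (((ContinuousLinearMap.apply ℂ F v).restrictScalars ℝ).differentiableAt).comp q
          ((hBsm d q hq).differentiableAt (by simp))
      have hnear : ∀ᶠ z in 𝓝 y, secOfCoord F V x₀ (fun z => B d (κ.symm (κ z)) v) z =
          D (secOfCoord F V x₀ (fun _ => v)) z (coordField x₀ d z) := by
        filter_upwards [baseSet_mem_nhds x₀ hyb, (chartAt ℂ x₀).open_source.mem_nhds hys]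
          with z hz hz'
        rw [(hB z hz hz' d).1 v, secOfCoord_apply, κ.left_inv (by simpa [hκ] using hz')]
      have h1 := hD.secOfCoord_comp_chart x₀ hyb hys hα c
      rw [← hD.congr y _ _ ?_ hnear, h1, (hB y hyb hys c).1, map_add]
      · congr 2
        · rw [κ.left_inv (by simpa [hκ] using hys)]
        · rw [hκy, hAd q hq]
          have h2 := ((ContinuousLinearMap.apply ℂ F v).restrictScalars ℝ).hasFDerivAt.comp q
            ((hBsm d q hq).differentiableAt (by simp)).hasFDerivAt
          exact congrArg (fun L => L c) h2.fderiv
      · refine (diffSectionAt_secOfCoord x₀ hyb).2 ?_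
        exact (hα.mdifferentiableAt).comp y ((contMDiffAt_chart hys).mdifferentiableAt (by simp))
    ext v
    have h1 := hD.flat y (coordField x₀ c) (coordField x₀ d) (secOfCoord F V x₀ (fun _ => v))
      (smoothFieldAt_coordField hys c) (smoothFieldAt_coordField hys d) (by
        filter_upwards [baseSet_mem_nhds x₀ hyb] with z hz
        exact (smoothSectionAt_secOfCoord x₀ hz).2 contMDiffAt_const)
    rw [hcd, hcd, mlieBracket_coordField hys, hD.apply_zero, sub_zero, ← map_sub] at h1
    have h2 := secOfCoord_injective (V := V) x₀ hyb h1
    rw [← hBlin q hq, ← hBlin q hq]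
    change fderiv ℝ A q c d v - fderiv ℝ A q d c v +
      (B c y (B d y v) - B d y (B c y v)) = 0
    rw [← h2]
    abel
  have hx₀b := FiberBundle.mem_baseSet_trivializationAt F V x₀
  have hκ0 : κ.symm (κ x₀) = x₀ := κ.left_inv (mem_extChartAt_source x₀)
  have hz₀ : κ x₀ ∈ W := by
    refine ⟨mem_extChartAt_target x₀, ?_⟩
    rw [Set.mem_preimage, hκ0]
    exact hx₀b
  obtain ⟨U, hUW, hUo, hzU, g, hgsm, hg⟩ := exists_parallel_near hWo hz₀ hAsm hflat
  refine ⟨(κ.source ∩ κ ⁻¹' U) ∩ (trivializationAt F V x₀).baseSet,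
    ((continuousOn_extChartAt x₀).isOpen_inter_preimage (isOpen_extChartAt_source x₀) hUo).inter
      (trivializationAt F V x₀).open_baseSet, ⟨⟨mem_extChartAt_source x₀, hzU⟩, hx₀b⟩,
    fun x => (trivializationAt F V x₀).symmₗ ℂ x ∘ₗ (g (κ x) : F →ₗ[ℂ] F), ?_⟩
  rintro y ⟨⟨hyκ, hyU⟩, hyb⟩
  have hys : y ∈ (chartAt ℂ x₀).source := by simpa [hκ] using hyκ
  have hleft : κ.symm (κ y) = y := κ.left_inv hyκ
  refine ⟨?_, fun v => ?_⟩
  · have h1 : Function.Bijective (g (κ y)) := by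
      obtain ⟨a, ha⟩ := (hg _ hyU).1
      rw [← ha]
      refine Function.bijective_iff_has_inverse.2 ⟨(↑a⁻¹ : F →L[ℂ] F), fun v => ?_, fun v => ?_⟩
      · exact congrArg (fun L : F →L[ℂ] F => L v) a.inv_mul
      · exact congrArg (fun L : F →L[ℂ] F => L v) a.mul_inv
    have h2 : Function.Bijective ((trivializationAt F V x₀).symmₗ ℂ y) := by
      refine ⟨(injective_iff_map_eq_zero _).2 fun a ha => secOfCoord_injective x₀ hyb ha,
        fun w => ⟨(trivializationAt F V x₀ ⟨y, w⟩).2, ?_⟩⟩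
      rw [Bundle.Trivialization.symmₗ_apply]
      · exact Bundle.Trivialization.symm_apply_apply_mk _ hyb w
      · exact hyb
    exact h2.comp h1
  · have hgy : ContDiffAt ℝ ∞ g (κ y) := hgsm.contDiffAt (hUo.mem_nhds hyU)
    have hgv : ContDiffAt ℝ ∞ (fun u => g u v) (κ y) :=
      (((ContinuousLinearMap.apply ℂ F v).restrictScalars ℝ).contDiff.contDiffAt).comp _ hgy
    refine ⟨?_, fun w => ?_⟩
    · refine (smoothSectionAt_secOfCoord x₀ (a := fun z => g (κ z) v) hyb).2 ?_
      exact (hgv.contMDiffAt).comp y (contMDiffAt_chart hys)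
    · obtain ⟨c, rfl⟩ := exists_coordField_eq hys w
      have h1 := hD.secOfCoord_comp_chart x₀ hyb hys (hgv.differentiableAt (by simp)) c
      refine h1.trans ?_
      rw [(hB y hyb hys c).1, ← map_add]
      have h2 := ((ContinuousLinearMap.apply ℂ F v).restrictScalars ℝ).hasFDerivAt.comp (κ y)
        (hgy.differentiableAt (by simp)).hasFDerivAt
      have h3 : fderiv ℝ (fun u => g u v) (κ y) c = fderiv ℝ g (κ y) c v :=
        congrArg (fun L => L c) h2.fderiv
      have h4 := hBlin _ (hUW hyU) c
      rw [hleft] at h4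
      rw [h3, (hg _ hyU).2, ← h4]
      change (trivializationAt F V x₀).symmₗ ℂ y (B c y (g (κ y) v) + -(B c y (g (κ y) v))) = 0
      rw [add_neg_cancel, map_zero]

end

/-! ### Parallel sections in parallel frames -/

section

variable {X : Type*} [TopologicalSpace X] [ChartedSpace ℂ X] [IsManifold 𝓘(ℂ) ω X]
  {F : Type} [NormedAddCommGroup F] [NormedSpace ℂ F] [FiniteDimensional ℂ F]
  {V : X → Type} [∀ x, NormedAddCommGroup (V x)] [∀ x, InnerProductSpace ℂ (V x)]
  [TopologicalSpace (Bundle.TotalSpace F V)] [FiberBundle F V]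
  [VectorBundle ℂ F V] [ContMDiffVectorBundle ∞ F V 𝓘(ℝ, ℂ)]

theorem contDiffAt_clm_inverse {n : ℕ∞ω} {x : X} {L : X → F →L[ℂ] F}
    (hL : ContMDiffAt 𝓘(ℝ, ℂ) 𝓘(ℝ, F →L[ℂ] F) n L x) (hb : Function.Bijective (L x)) :
    ContMDiffAt 𝓘(ℝ, ℂ) 𝓘(ℝ, F →L[ℂ] F) n (fun y => ContinuousLinearMap.inverse (L y)) x := by
  let M : F ≃L[ℂ] F := (LinearEquiv.ofBijective (L x : F →ₗ[ℂ] F) hb).toContinuousLinearEquiv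
  have hM : (M : F →L[ℂ] F) = L x := by ext v; rfl
  have h1 : ContDiffAt ℂ n (ContinuousLinearMap.inverse : (F →L[ℂ] F) → _) (M : F →L[ℂ] F) :=
    contDiffAt_map_inverse M
  have h2 := (h1.restrict_scalars ℝ).contMDiffAt
  rw [hM] at h2
  exact h2.comp x hL

theorem ContMDiffAt.clm_apply_complex {n : ℕ∞ω} {x : X} {L : X → F →L[ℂ] F} {a : X → F}
    (hL : ContMDiffAt 𝓘(ℝ, ℂ) 𝓘(ℝ, F →L[ℂ] F) n L x)
    (ha : ContMDiffAt 𝓘(ℝ, ℂ) 𝓘(ℝ, F) n a x) :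
    ContMDiffAt 𝓘(ℝ, ℂ) 𝓘(ℝ, F) n (fun y => L y (a y)) x := by
  have h4 : ContDiff ℝ n (fun p : (F →L[ℂ] F) × F => p.1 p.2) :=
    (isBoundedBilinearMap_apply (𝕜 := ℂ) (E := F) (F := F)).contDiff.restrict_scalars ℝ
  exact h4.contMDiff.contMDiffAt.comp x (hL.prodMk_space ha)

/-- Smoothness of a section can be tested in any smooth frame. -/
theorem smoothSectionAt_frame_iff {e : ∀ x, F ≃ₗ[ℂ] V x} {x : X}
    (he : ∀ v, SmoothSectionAt F (fun y => e y v) x) {a : X → F} :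
    SmoothSectionAt F (fun y => e y (a y)) x ↔ ContMDiffAt 𝓘(ℝ, ℂ) 𝓘(ℝ, F) ∞ a x := by
  have hx := FiberBundle.mem_baseSet_trivializationAt F V x
  let t := trivializationAt F V x
  let L : X → F →L[ℂ] F := fun y =>
    LinearMap.toContinuousLinearMap (t.linearMapAt ℂ y ∘ₗ (e y : F →ₗ[ℂ] V y))
  have hLapp : ∀ y ∈ t.baseSet, ∀ v, L y v = (t ⟨y, e y v⟩).2 := by
    intro y hy v
    change t.linearMapAt ℂ y (e y v) = _
    rw [t.linearMapAt_apply, if_pos hy]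
  have hLsm : ContMDiffAt 𝓘(ℝ, ℂ) 𝓘(ℝ, F →L[ℂ] F) ∞ L x := by
    refine contMDiffAt_clm_of_apply fun v => ?_
    refine ((smoothSectionAt_iff x hx).1 (he v)).congr_of_eventuallyEq ?_
    filter_upwards [baseSet_mem_nhds x hx] with y hy using hLapp y hy v
  have hbij : ∀ y ∈ t.baseSet, Function.Bijective (L y) := by
    intro y hy
    have h1 : ⇑(L y) = ⇑((e y).trans (t.linearEquivAt ℂ y hy)) := by
      funext v
      rw [hLapp y hy]
      rfl
    rw [h1]
    exact LinearEquiv.bijective _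
  rw [smoothSectionAt_iff x hx]
  have heq : secCoord F V x (fun y => e y (a y)) =ᶠ[𝓝 x] fun y => L y (a y) := by
    filter_upwards [baseSet_mem_nhds x hx] with y hy using (hLapp y hy _).symm
  rw [heq.contMDiffAt_iff]
  refine ⟨fun h => ?_, fun h => hLsm.clm_apply_complex h⟩
  refine ((contDiffAt_clm_inverse hLsm (hbij x hx)).clm_apply_complex h).congr_of_eventuallyEq ?_
  filter_upwards [baseSet_mem_nhds x hx] with y hy
  let M : F ≃L[ℂ] F :=
    (LinearEquiv.ofBijective (L y : F →ₗ[ℂ] F) (hbij y hy)).toContinuousLinearEquiv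
  have hM : (M : F →L[ℂ] F) = L y := by ext v; rfl
  rw [← hM, ContinuousLinearMap.inverse_equiv]
  exact (M.symm_apply_apply _).symm

theorem mvfderiv_continuousLinearMap_comp {G : Type*} [NormedAddCommGroup G] [NormedSpace ℝ G]
    (L : F →L[ℝ] G) {a : X → F} {x : X} (ha : MDifferentiableAt 𝓘(ℝ, ℂ) 𝓘(ℝ, F) a x)
    (w : TangentSpace 𝓘(ℝ, ℂ) x) :
    mvfderiv 𝓘(ℝ, ℂ) (fun y => L (a y)) x w = L (mvfderiv 𝓘(ℝ, ℂ) a x w) := by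
  have h1 := mfderiv_comp (g := L) (f := a) x L.differentiableAt.mdifferentiableAt ha
  have h2 := congrArg (fun M => M w) h1
  rw [mfderiv_eq_fderiv, L.fderiv] at h2
  exact h2

/-- A function with vanishing differential is locally constant. -/
theorem eventually_eq_of_mvfderiv_eq_zero {G : Type*} [NormedAddCommGroup G] [NormedSpace ℝ G]
    {a : X → G} {x : X} (ha : ∀ᶠ y in 𝓝 x, MDifferentiableAt 𝓘(ℝ, ℂ) 𝓘(ℝ, G) a y ∧
      ∀ w, mvfderiv 𝓘(ℝ, ℂ) a y w = 0) : ∀ᶠ y in 𝓝 x, a y = a x := by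
  have hM : IsManifold 𝓘(ℝ, ℂ) ∞ X := isManifold_real_infty
  set κ := extChartAt 𝓘(ℝ, ℂ) x with hκ
  have hκ0 : κ.symm (κ x) = x := κ.left_inv (mem_extChartAt_source x)
  have hc : ContinuousAt κ.symm (κ x) := continuousAt_extChartAt_symm x
  have h1 : ∀ᶠ u in 𝓝 (κ x), HasFDerivAt (fun u => a (κ.symm u)) (0 : ℂ →L[ℝ] G) u := by
    have h2 := hc.eventually (by rw [hκ0]; exact ha)
    filter_upwards [h2, extChartAt_target_mem_nhds x] with u hu hut
    have h3 : MDifferentiableAt 𝓘(ℝ, ℂ) 𝓘(ℝ, ℂ) κ.symm u :=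
      ((contMDiffOn_extChartAt_symm (n := ∞) x).contMDiffAt
        ((isOpen_extChartAt_target x).mem_nhds hut)).mdifferentiableAt (by simp)
    have h4 := (hu.1.comp u h3).differentiableAt.hasFDerivAt
    have h5 : fderiv ℝ (a ∘ κ.symm) u = 0 := by
      rw [← mfderiv_eq_fderiv, mfderiv_comp u hu.1 h3]
      ext w
      exact hu.2 _
    rw [h5] at h4
    exact h4
  obtain ⟨r, hr, hball⟩ := Metric.eventually_nhds_iff_ball.1 h1
  have h6 : ∀ u ∈ Metric.ball (κ x) r, a (κ.symm u) = a x := by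
    intro u hu
    have := (convex_ball (κ x) r).is_const_of_fderivWithin_eq_zero (𝕜 := ℝ)
      (f := fun u => a (κ.symm u))
      (fun z hz => (hball z hz).differentiableAt.differentiableWithinAt)
      (fun z hz => by
        rw [fderivWithin_of_isOpen Metric.isOpen_ball hz, (hball z hz).fderiv])
      hu (Metric.mem_ball_self hr)
    rw [hκ0] at this
    exact this
  have hc' : ContinuousAt κ x := continuousAt_extChartAt x
  filter_upwards [hc'.eventually (Metric.ball_mem_nhds _ hr), extChartAt_source_mem_nhds (I := 𝓘(ℝ, ℂ)) x]
    with y hy hys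
  have := h6 _ hy
  rwa [κ.left_inv hys] at this

variable (F) in
/-- `σ` is smooth at `x` and its covariant derivative vanishes there. -/
def ParallelAt (D : (∀ x, V x) → ∀ x : X, TangentSpace 𝓘(ℝ, ℂ) x → V x) (σ : ∀ x, V x) (x : X) :
    Prop :=
  SmoothSectionAt F σ x ∧ ∀ w, D σ x w = 0

namespace IsFlatConnection

variable {D : (∀ x, V x) → ∀ x : X, TangentSpace 𝓘(ℝ, ℂ) x → V x}

/-- In a parallel frame only the derivative of the coefficients survives the Leibniz rule, so the
connection is the trivial one. -/
theorem apply_parallel_frame (hD : IsFlatConnection F V D) {e : ∀ x, F ≃ₗ[ℂ] V x} {x : X}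
    (he : ∀ v, ParallelAt F D (fun y => e y v) x) {a : X → F}
    (ha : ContMDiffAt 𝓘(ℝ, ℂ) 𝓘(ℝ, F) ∞ a x) (w : TangentSpace 𝓘(ℝ, ℂ) x) :
    D (fun y => e y (a y)) x w = e x (mvfderiv 𝓘(ℝ, ℂ) a x w) := by
  set b := Module.finBasis ℝ F
  have hexp : ∀ (z : X) (v : F), e z v = ∑ i, b.coord i v • e z (b i) := by
    intro z v
    conv_lhs => rw [← b.sum_repr v, map_sum]
    refine Finset.sum_congr rfl fun i _ => ?_
    exact LinearMap.map_smul_of_tower (e z : F →ₗ[ℂ] V z) _ _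
  have ha' := ha.mdifferentiableAt (by simp)
  have h1 : (fun y => e y (a y)) = fun z => ∑ i, b.coord i (a z) • e z (b i) :=
    funext fun z => hexp z _
  have hγ : ∀ i, MDifferentiableAt 𝓘(ℝ, ℂ) 𝓘(ℝ, ℝ) (fun z => b.coord i (a z)) x := fun i =>
    (LinearMap.toContinuousLinearMap (b.coord i)).differentiableAt.mdifferentiableAt.comp x ha'
  rw [h1, hD.sum _ _ _ fun i _ => DiffSectionAt.smul (hγ i) (he (b i)).1.diff, hexp x]
  refine Finset.sum_congr rfl fun i _ => ?_
  rw [hD.smul x _ _ (hγ i) (he (b i)).1.diff, (he (b i)).2, smul_zero, zero_add]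
  congr 1
  exact mvfderiv_continuousLinearMap_comp (LinearMap.toContinuousLinearMap (b.coord i)) ha' w

theorem _root_.ParallelAt.congr (hD : IsFlatConnection F V D) {σ τ : ∀ x, V x} {x : X}
    (h : ParallelAt F D σ x) (hst : ∀ᶠ y in 𝓝 x, σ y = τ y) : ParallelAt F D τ x :=
  ⟨h.1.congr hst, fun w => by rw [← hD.congr x σ τ h.1.diff hst, h.2]⟩

/-- By `apply_parallel_frame`, the coordinates of a parallel section have zero differential, hence
are locally constant; conversely, constant combinations of a parallel frame are parallel. All later
arguments about ∇ go through this equivalence. -/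
theorem eventually_parallelAt_iff (hD : IsFlatConnection F V D) {e : ∀ x, F ≃ₗ[ℂ] V x} {x : X}
    (he : ∀ᶠ y in 𝓝 x, ∀ v, ParallelAt F D (fun y => e y v) y) (σ : ∀ x, V x) :
    (∀ᶠ y in 𝓝 x, ParallelAt F D σ y) ↔
      ∀ᶠ y in 𝓝 x, (e y).symm (σ y) = (e x).symm (σ x) := by
  have hσ : (fun y => e y ((e y).symm (σ y))) = σ := by simp
  constructor
  · intro h
    refine eventually_eq_of_mvfderiv_eq_zero (a := fun y => (e y).symm (σ y)) ?_
    filter_upwards [h, he] with y hy hey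
    have h1 := (smoothSectionAt_frame_iff (a := fun y => (e y).symm (σ y)) fun v => (hey v).1).1
      (by rw [hσ]; exact hy.1)
    refine ⟨h1.mdifferentiableAt (by simp), fun w => ?_⟩
    have h2 := hD.apply_parallel_frame hey h1 w
    rw [hσ, hy.2] at h2
    exact (e y).map_eq_zero_iff.1 h2.symm
  · intro h
    filter_upwards [h.eventually_nhds, he] with y hy hey
    refine (hey ((e x).symm (σ x))).congr hD ?_
    filter_upwards [hy] with z hz
    rw [← hz, LinearEquiv.apply_symm_apply]

theorem exists_parallel_linearEquiv (hD : IsFlatConnection F V D) (x₀ : X) :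
    ∃ e : ∀ x, F ≃ₗ[ℂ] V x, ∀ᶠ y in 𝓝 x₀, ∀ v, ParallelAt F D (fun y => e y v) y := by
  classical
  obtain ⟨U, hU, hx, e, he⟩ := hD.exists_parallel_frame x₀
  -- Off U the preferred trivialization at each point supplies some isomorphism, with no continuity
  -- intended; only the values on U matter.
  refine ⟨fun x => if h : x ∈ U then LinearEquiv.ofBijective (e x) (he x h).1 else
    ((trivializationAt F V x).linearEquivAt ℂ x
      (FiberBundle.mem_baseSet_trivializationAt F V x)).symm, ?_⟩
  filter_upwards [hU.mem_nhds hx] with y hy v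
  refine ParallelAt.congr hD (σ := fun y => e y v) ((he y hy).2 v) ?_
  filter_upwards [hU.mem_nhds hy] with z hz
  simp [hz]

end IsFlatConnection

end

/-! ### Lifts of the involution and invariant parallel frames -/

/-- A fibrewise linear lift of the involution `f` to an involution. -/
structure IsLift {X : Type*} [TopologicalSpace X] (f : TopInvolution X) (F : Type) {V : X → Type}
    [∀ x, AddCommGroup (V x)] [∀ x, Module ℂ (V x)] (ψ : ∀ x, V x →ₗ[ℂ] V (f x)) : Prop where
  involutive : Function.Involutive
    (fun p : Bundle.TotalSpace F V => (⟨f p.1, ψ p.1 p.2⟩ : Bundle.TotalSpace F V))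

theorem Bundle.TotalSpace.snd_eq {X : Type*} {F : Type} {V : X → Type} {x : X} {v w : V x}
    (h : (⟨x, v⟩ : Bundle.TotalSpace F V) = ⟨x, w⟩) : v = w := by
  simpa using h

namespace IsLift

variable {X : Type*} [TopologicalSpace X] {f : TopInvolution X} {F : Type} {V : X → Type}
    [∀ x, AddCommGroup (V x)] [∀ x, Module ℂ (V x)] {ψ : ∀ x, V x →ₗ[ℂ] V (f x)}

theorem apply_apply (h : IsLift f F ψ) (x : X) (v : V x) :
    (⟨f (f x), ψ (f x) (ψ x v)⟩ : Bundle.TotalSpace F V) = ⟨x, v⟩ :=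
  h.involutive ⟨x, v⟩

theorem injective (h : IsLift f F ψ) (x : X) : Function.Injective (ψ x) := by
  intro v w hvw
  have := h.apply_apply x v
  rw [hvw, h.apply_apply] at this
  exact (Bundle.TotalSpace.snd_eq this).symm

theorem surjective (h : IsLift f F ψ) (x : X) : Function.Surjective (ψ x) := by
  intro w
  -- A preimage of w is first found over f (f x), which is only propositionally x; the variable base
  -- point y allows the equation to be substituted.
  have key : ∀ y (hy : y = x), ∀ u : V (f y), (⟨f y, u⟩ : Bundle.TotalSpace F V) = ⟨f x, w⟩ →
      (∃ v : V y, ψ y v = u) → ∃ v, ψ x v = w := by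
    rintro y rfl u hu ⟨v, hv⟩
    exact ⟨v, hv.trans (Bundle.TotalSpace.snd_eq hu)⟩
  exact key (f (f x)) (f.involutive x) _ (h.apply_apply (f x) w) ⟨_, rfl⟩

/-- The lift as a family of linear isomorphisms. -/
noncomputable def equiv (h : IsLift f F ψ) (x : X) : V x ≃ₗ[ℂ] V (f x) :=
  LinearEquiv.ofBijective (ψ x) ⟨h.injective x, h.surjective x⟩

theorem neg (h : IsLift f F ψ) : IsLift f F (fun x => -ψ x) :=
  ⟨fun p => by
    have h1 := h.involutive p
    simpa using h1⟩

/-- A family over `f` of elements can be reindexed. -/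
theorem _root_.TopInvolution.exists_section {X : Type*} [TopologicalSpace X] (f : TopInvolution X)
    {W : X → Type} (m : ∀ x, W (f x)) : ∃ s : ∀ x, W x, ∀ x, s (f x) = m x := by
  have h : ∀ y, ∃ w : W y, ∀ x, ∀ h : f x = y, w = h ▸ m x := by
    intro y
    obtain ⟨x, rfl⟩ := f.involutive.surjective y
    refine ⟨m x, fun x' h => ?_⟩
    obtain rfl := f.involutive.injective h
    rfl
  choose s hs using h
  exact ⟨s, fun x => hs _ x rfl⟩

/-- Transport of a frame by the lift. -/
theorem exists_frame (h : IsLift f F ψ) {G : Type} [AddCommGroup G] [Module ℂ G]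
    (e : ∀ x, G ≃ₗ[ℂ] V x) :
    ∃ e' : ∀ x, G ≃ₗ[ℂ] V x, ∀ x v, e' (f x) v = ψ x (e x v) := by
  have h : ∀ y, ∃ E : G ≃ₗ[ℂ] V y, ∀ x v, f x = y →
      (⟨y, E v⟩ : Bundle.TotalSpace F V) = ⟨f x, ψ x (e x v)⟩ := by
    intro y
    obtain ⟨x, rfl⟩ := f.involutive.surjective y
    refine ⟨(e x).trans (h.equiv x), fun x' v hx' => ?_⟩
    obtain rfl := f.involutive.injective hx'
    rfl
  choose E hE using h
  exact ⟨E, fun x v => Bundle.TotalSpace.snd_eq (hE (f x) x v rfl)⟩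

/-- The transport of a frame, transported once more, is the frame. -/
theorem apply_frame (h : IsLift f F ψ) {G : Type} [AddCommGroup G] [Module ℂ G]
    {e e' : ∀ x, G ≃ₗ[ℂ] V x}
    (he : ∀ x v, e' (f x) v = ψ x (e x v)) (x : X) (v : G) : e (f x) v = ψ x (e' x v) := by
  have h1 := h.apply_apply (f x) (e (f x) v)
  rw [← he] at h1
  have key : ∀ y, y = x → (⟨f y, ψ y (e' y v)⟩ : Bundle.TotalSpace F V) = ⟨f x, ψ x (e' x v)⟩ := by
    rintro y rfl; rfl
  rw [key _ (f.involutive x)] at h1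
  exact (Bundle.TotalSpace.snd_eq h1).symm

end IsLift

/-- The lift is the identity over the fixed points. -/
def FixesFibres {X : Type*} [TopologicalSpace X] (f : TopInvolution X) (F : Type) {V : X → Type}
    [∀ x, AddCommGroup (V x)] [∀ x, Module ℂ (V x)] (ψ : ∀ x, V x →ₗ[ℂ] V (f x)) : Prop :=
  ∀ x, f x = x → ∀ v, (⟨f x, ψ x v⟩ : Bundle.TotalSpace F V) = ⟨x, v⟩

/-- Separate x from f x and intersect with the preimage of the neighbourhood of f x. Then W is
disjoint from its mirror image, so data chosen on W can be transported there without any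
compatibility condition. -/
theorem TopInvolution.exists_isOpen_disjoint {X : Type*} [TopologicalSpace X] [T2Space X]
    (f : TopInvolution X) {x : X} (hx : f x ≠ x) {U : Set X} (hU : U ∈ 𝓝 x) :
    ∃ W ⊆ U, IsOpen W ∧ x ∈ W ∧ ∀ y ∈ W, f y ∉ W := by
  obtain ⟨A, B, hA, hB, hxA, hxB, hAB⟩ := t2_separation hx
  refine ⟨B ∩ f ⁻¹' A ∩ interior U, fun y hy => interior_subset hy.2,
    (hB.inter (hA.preimage f.continuous_toFun)).inter isOpen_interior,
    ⟨⟨hxB, hxA⟩, mem_interior_iff_mem_nhds.2 hU⟩, fun y hy hfy => ?_⟩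
  exact Set.disjoint_left.1 hAB hy.1.2 hfy.1.1

section

variable {X : Type*} [TopologicalSpace X] [ChartedSpace ℂ X] [IsManifold 𝓘(ℂ) ω X]
  {F : Type} [NormedAddCommGroup F] [NormedSpace ℂ F] [FiniteDimensional ℂ F]
  {V : X → Type} [∀ x, NormedAddCommGroup (V x)] [∀ x, InnerProductSpace ℂ (V x)]
  [TopologicalSpace (Bundle.TotalSpace F V)] [FiberBundle F V]
  [VectorBundle ℂ F V] [ContMDiffVectorBundle ∞ F V 𝓘(ℝ, ℂ)]

/-- The lift maps parallel sections to parallel sections. -/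
def PreservesParallel (D : (∀ x, V x) → ∀ x : X, TangentSpace 𝓘(ℝ, ℂ) x → V x)
    (f : TopInvolution X) (F : Type) [NormedAddCommGroup F] [NormedSpace ℂ F]
    [TopologicalSpace (Bundle.TotalSpace F V)] [FiberBundle F V]
    (ψ : ∀ x, V x →ₗ[ℂ] V (f x)) : Prop :=
  ∀ σ σ' : ∀ x, V x, (∀ x, σ' (f x) = ψ x (σ x)) → ∀ x, ParallelAt F D σ x → ParallelAt F D σ' (f x)

/-- Around every point there is a parallel frame which is invariant under the lift. -/
theorem exists_invariant_parallel_frame [T2Space X]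
    {D : (∀ x, V x) → ∀ x : X, TangentSpace 𝓘(ℝ, ℂ) x → V x} (hD : IsFlatConnection F V D)
    {f : TopInvolution X} {ψ : ∀ x, V x →ₗ[ℂ] V (f x)} (hψ : IsLift f F ψ)
    (hfix : FixesFibres f F ψ) (hpar : PreservesParallel D f F ψ) (x₀ : X) :
    ∃ U : Set X, IsOpen U ∧ x₀ ∈ U ∧ (∀ x ∈ U, f x ∈ U) ∧ ∃ e : ∀ x, F ≃ₗ[ℂ] V x,
      ∀ x ∈ U, ∀ v, e (f x) v = ψ x (e x v) ∧ ParallelAt F D (fun y => e y v) x := by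
  classical
  obtain ⟨e, he⟩ := hD.exists_parallel_linearEquiv x₀
  obtain ⟨U, hUe, hU, hxU⟩ := eventually_nhds_iff.1 he
  obtain ⟨e', he'⟩ := hψ.exists_frame e
  have hpar' : ∀ x, f x ∈ U → ∀ v, ParallelAt F D (fun y => e' y v) x := by
    intro x hx v
    have h1 := hpar _ (fun y => e' y v) (fun y => he' y v) (f x) (hUe _ hx v)
    rwa [f.involutive x] at h1
  by_cases hx : f x₀ = x₀
  -- At a fixed point the transported frame e' equals e at x₀, because the lift is the identity on
  -- that fibre. Both are parallel, so they agree nearby and e is itself invariant.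
  · have hbase : ∀ v, e' x₀ v = e x₀ v := by
      intro v
      have h1 := hfix x₀ hx (e x₀ v)
      rw [← he'] at h1
      have key : ∀ y, y = x₀ → (⟨y, e' y v⟩ : Bundle.TotalSpace F V) = ⟨x₀, e' x₀ v⟩ := by
        rintro y rfl; rfl
      rw [key _ hx] at h1
      exact Bundle.TotalSpace.snd_eq h1
    have hev : ∀ v, ∀ᶠ y in 𝓝 x₀, e' y v = e y v := by
      intro v
      have h1 : ∀ᶠ y in 𝓝 x₀, ParallelAt F D (fun y => e' y v) y := by
        have : f ⁻¹' U ∈ 𝓝 x₀ :=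
          (hU.preimage f.continuous_toFun).mem_nhds (by simpa [hx] using hxU)
        filter_upwards [this] with y hy using hpar' y hy v
      filter_upwards [(hD.eventually_parallelAt_iff he _).1 h1] with y hy
      rw [hbase, LinearEquiv.symm_apply_apply, LinearEquiv.symm_apply_eq] at hy
      exact hy
    have hev' : ∀ᶠ y in 𝓝 x₀, ∀ v, e' y v = e y v := by
      let b := Module.finBasis ℂ F
      filter_upwards [Filter.eventually_all.2 fun i => hev (b i)] with y hy v
      have : (e' y : F →ₗ[ℂ] V y) = e y := b.ext hy
      exact congrArg (fun L => L v) this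
    obtain ⟨N, hN, hNo, hxN⟩ := eventually_nhds_iff.1 hev'
    refine ⟨(N ∩ U) ∩ f ⁻¹' (N ∩ U), (hNo.inter hU).inter
      ((hNo.inter hU).preimage f.continuous_toFun), ⟨⟨hxN, hxU⟩, ?_⟩, ?_, e, ?_⟩
    · rw [Set.mem_preimage, hx]
      exact ⟨hxN, hxU⟩
    · rintro x ⟨h1, h2⟩
      refine ⟨h2, ?_⟩
      rw [Set.mem_preimage, f.involutive x]
      exact h1
    · rintro x ⟨h1, h2⟩ v
      refine ⟨?_, hUe x h1.2 v⟩
      rw [← hN _ h2.1 v, he']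
  -- Away from the fixed points, W and its mirror image are disjoint: e is used on the one and its
  -- transport on the other.
  · obtain ⟨W, hWU, hWo, hxW, hW⟩ := f.exists_isOpen_disjoint hx (hU.mem_nhds hxU)
    refine ⟨W ∪ f ⁻¹' W, hWo.union (hWo.preimage f.continuous_toFun), Or.inl hxW, ?_,
      fun x => if x ∈ W then e x else e' x, ?_⟩
    · rintro x (h | h)
      · right
        rw [Set.mem_preimage, f.involutive x]
        exact h
      · exact Or.inl h
    · rintro x (h | h) v
      · refine ⟨?_, ParallelAt.congr hD (hUe x (hWU h) v) ?_⟩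
        · simp only [h, if_true, hW x h, if_false, he']
        · filter_upwards [hWo.mem_nhds h] with y hy
          simp [hy]
      · have hxW' : x ∉ W := by
          intro hx
          exact hW x hx h
        refine ⟨?_, ParallelAt.congr hD (hpar' x (hWU h) v) ?_⟩
        · have h' : f x ∈ W := h
          simp only [h', if_true, hxW', if_false]
          exact hψ.apply_frame he' x v
        · filter_upwards [(hWo.preimage f.continuous_toFun).mem_nhds h] with y hy
          have hy' : y ∉ W := fun hy' => hW y hy' hy
          simp [hy']

variable {f : RealStructure X}

theorem LiftedInvolution.isLift (φ : LiftedInvolution F V f) :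
    IsLift f.toTopInvolution F φ.φ := ⟨φ.involutive⟩

theorem LiftedInvolution.contMDiff_base (φ : LiftedInvolution F V f) :
    ContMDiff 𝓘(ℝ, ℂ) 𝓘(ℝ, ℂ) ∞ f := by
  have h1 := φ.smooth.comp (Bundle.contMDiff_zeroSection ℝ V)
  exact (Bundle.contMDiff_proj V).comp h1

variable [∀ x, FiniteDimensional ℂ (V x)]

/-- The section σ' is φ ∘ σ ∘ f, which gives smoothness. The hypothesis on φ controls ∇σ' only on
vectors in the image of df, but f ∘ f = id makes df surjective. -/
theorem LiftedInvolution.preservesParallel [T2Space X] {H : HitchinSolution F V}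
    {φ : LiftedInvolution F V f} (hφ : H.PreservedBy φ) :
    PreservesParallel H.nabla f.toTopInvolution F φ.φ := by
  intro σ σ' hσ x hx
  have hinv : f (f x) = x := f.involutive x
  have hf := φ.contMDiff_base
  refine ⟨?_, fun w => ?_⟩
  · have h1 : ContMDiffAt 𝓘(ℝ, ℂ) (𝓘(ℝ, ℂ).prod 𝓘(ℝ, F)) ∞
        (fun y => (⟨y, σ y⟩ : Bundle.TotalSpace F V)) (f (f x)) := by
      rw [hinv]; exact hx.1
    have h2 := (φ.smooth _).comp (f x) (h1.comp (f x) (hf (f x)))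
    refine h2.congr_of_eventuallyEq (Filter.Eventually.of_forall fun y => ?_)
    have key : ∀ y z, f z = y → (⟨y, σ' y⟩ : Bundle.TotalSpace F V) = ⟨f z, φ.φ z (σ z)⟩ := by
      rintro _ z rfl
      rw [← hσ]
    exact key y (f y) (f.involutive y)
  · have hd : MDifferentiable 𝓘(ℝ, ℂ) 𝓘(ℝ, ℂ) f := hf.mdifferentiable (by simp)
    have h1 := hφ σ σ' hσ x hx.1
    have hid : (mfderiv 𝓘(ℝ, ℂ) 𝓘(ℝ, ℂ) (f ∘ f) (f x)) =
        (mfderiv 𝓘(ℝ, ℂ) 𝓘(ℝ, ℂ) f (f (f x))).comp (mfderiv 𝓘(ℝ, ℂ) 𝓘(ℝ, ℂ) f (f x)) :=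
      mfderiv_comp (f x) (hd _) (hd _)
    have hid2 : (f ∘ f : X → X) = id := funext f.involutive
    have key : ∀ y, y = x → ∀ u : TangentSpace 𝓘(ℝ, ℂ) y,
        H.nabla σ' (f x) (mfderiv 𝓘(ℝ, ℂ) 𝓘(ℝ, ℂ) f y u : ℂ) = 0 := by
      rintro y rfl u
      refine (h1 u).trans ?_
      rw [hx.2, map_zero]
    have h3 := key _ hinv (mfderiv 𝓘(ℝ, ℂ) 𝓘(ℝ, ℂ) f (f x) w)
    have h4 : (mfderiv 𝓘(ℝ, ℂ) 𝓘(ℝ, ℂ) f (f (f x)) (mfderiv 𝓘(ℝ, ℂ) 𝓘(ℝ, ℂ) f (f x) w) : ℂ) = w := by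
      have h5 := congrArg (fun L => (L w : ℂ)) hid
      refine h5.symm.trans ?_
      have h6 : ∀ g : X → X, g = id → (mfderiv 𝓘(ℝ, ℂ) 𝓘(ℝ, ℂ) g (f x) w : ℂ) = w := by
        rintro _ rfl
        rw [mfderiv_id]
        rfl
      exact h6 _ hid2
    refine Eq.trans ?_ h3
    exact congrArg (fun u : ℂ => H.nabla σ' (f x) u) h4.symm

theorem PreservesParallel.neg {D : (∀ x, V x) → ∀ x : X, TangentSpace 𝓘(ℝ, ℂ) x → V x}
    (hD : IsFlatConnection F V D) {f : TopInvolution X} {ψ : ∀ x, V x →ₗ[ℂ] V (f x)}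
    (h : PreservesParallel D f F ψ) : PreservesParallel D f F (fun x => -ψ x) := by
  intro σ σ' hσ x hx
  refine h (fun y => (-1 : ℝ) • σ y) σ' (fun y => ?_) x ⟨hx.1.smul contMDiffAt_const, fun w => ?_⟩
  · rw [hσ]
    simp
  · have := hD.smul x (fun _ => (-1 : ℝ)) σ mdifferentiableAt_const hx.1.diff w
    rw [this, hx.2, mvfderiv_const]
    simp

end

/-! ### Descent of invariant frames to flat bundles on M -/

section

variable {X : Type*} [TopologicalSpace X]

theorem MSpace.isOpen_iff (f : TopInvolution X) {S : Set (MSpace f)} :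
    IsOpen S ↔ IsOpen {p : X × Set.Icc (-1 : ℝ) 1 | (Quot.mk _ p : MSpace f) ∈ S} :=
  Iff.rfl

/-- The function on `M` induced by an `f`-invariant function on `X`. -/
def MSpace.lift (f : TopInvolution X) {α : Type*} (g : X → α) (hg : ∀ x, g (f x) = g x)
    (m : MSpace f) : α :=
  Quot.lift (fun p : X × Set.Icc (-1 : ℝ) 1 => g p.1)
    (by rintro p q (rfl : q = tau f p); exact (hg p.1).symm) m

theorem MSpace.exists_mk (f : TopInvolution X) (m : MSpace f) : ∃ p : X × Set.Icc (-1 : ℝ) 1,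
    (Quot.mk _ p : MSpace f) = m := Quot.exists_rep m

/-- Invariant frames over an invariant open cover of `X` with locally constant transition functions
descend to a flat bundle over `M`. -/
noncomputable def FlatBundle.ofInvariantFrames (f : TopInvolution X) {F : Type}
    [NormedAddCommGroup F] [NormedSpace ℂ F] {U : X → Set X} (hU : ∀ i, IsOpen (U i))
    (hmem : ∀ i, i ∈ U i) (hinv : ∀ i x, f x ∈ U i ↔ x ∈ U i)
    (g : X → X → X → F →L[ℂ] F) (hg : ∀ i j x, g i j (f x) = g i j x)
    (hself : ∀ i, ∀ x ∈ U i, ∀ v, g i i x v = v)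
    (hcomp : ∀ i j k, ∀ x, x ∈ U i → x ∈ U j → x ∈ U k → ∀ v, g j k x (g i j x v) = g i k x v)
    (hconst : ∀ i j, ∀ x, x ∈ U i → x ∈ U j → ∀ᶠ y in 𝓝 x, g i j y = g i j x) :
    FlatBundle (MSpace f) F :=
  have hflat : ∀ i j, ∀ m : MSpace f,
      MSpace.lift f (· ∈ U i) (fun x => propext (hinv i x)) m →
      MSpace.lift f (· ∈ U j) (fun x => propext (hinv j x)) m →
      ∀ᶠ z in 𝓝 m, MSpace.lift f (g i j) (hg i j) z = MSpace.lift f (g i j) (hg i j) m := by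
    intro i j m hi hj
    have hopen : IsOpen {z : MSpace f | MSpace.lift f (· ∈ U i) (fun x => propext (hinv i x)) z ∧
        MSpace.lift f (· ∈ U j) (fun x => propext (hinv j x)) z ∧
        MSpace.lift f (g i j) (hg i j) z = MSpace.lift f (g i j) (hg i j) m} := by
      rw [MSpace.isOpen_iff]
      refine IsOpen.preimage (t := {x | x ∈ U i ∧ x ∈ U j ∧
        g i j x = MSpace.lift f (g i j) (hg i j) m}) continuous_fst ?_
      rw [isOpen_iff_mem_nhds]
      rintro x ⟨h1, h2, h3⟩
      filter_upwards [(hU i).mem_nhds h1, (hU j).mem_nhds h2, hconst i j x h1 h2] with y h4 h5 h6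
      exact ⟨h4, h5, h6.trans h3⟩
    filter_upwards [hopen.mem_nhds ⟨hi, hj, rfl⟩] with z hz using hz.2.2
  { ι := X
    core :=
      { baseSet := fun i => {m | MSpace.lift f (· ∈ U i) (fun x => propext (hinv i x)) m}
        isOpen_baseSet := fun i => (MSpace.isOpen_iff f).2 ((hU i).preimage continuous_fst)
        -- The cover is indexed by the points of X with i ∈ U i, so the first coordinate of any
        -- representative of m is an admissible index.
        indexAt := fun m => (MSpace.exists_mk f m).choose.1
        mem_baseSet_at := fun m => by
          have h := (MSpace.exists_mk f m).choose_spec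
          exact (congrArg (MSpace.lift f (· ∈ U (MSpace.exists_mk f m).choose.1)
            (fun x => propext (hinv _ x))) h).mp (hmem _)
        coordChange := fun i j => MSpace.lift f (g i j) (hg i j)
        coordChange_self := by
          intro i m
          obtain ⟨p, rfl⟩ := MSpace.exists_mk f m
          exact hself i p.1
        continuousOn_coordChange := fun i j m hm =>
          (continuousAt_const.congr (Filter.EventuallyEq.symm
            (hflat i j m hm.1 hm.2))).continuousWithinAt
        coordChange_comp := by
          rintro i j k m ⟨⟨hi, hj⟩, hk⟩
          obtain ⟨p, rfl⟩ := MSpace.exists_mk f m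
          exact hcomp i j k p.1 hi hj hk }
    flat := fun i j m hm => hflat i j m hm.1 hm.2 }

end

section

variable {X : Type*} [TopologicalSpace X] [ChartedSpace ℂ X] [IsManifold 𝓘(ℂ) ω X]
  {F : Type} [NormedAddCommGroup F] [NormedSpace ℂ F] [FiniteDimensional ℂ F]
  {V : X → Type} [∀ x, NormedAddCommGroup (V x)] [∀ x, InnerProductSpace ℂ (V x)]
  [TopologicalSpace (Bundle.TotalSpace F V)] [FiberBundle F V]
  [VectorBundle ℂ F V] [ContMDiffVectorBundle ∞ F V 𝓘(ℝ, ℂ)]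

/-- Each basis vector has locally constant coordinates in the other frame; finiteness of the basis
makes the neighbourhood independent of the vector. -/
theorem IsFlatConnection.eventually_transition_eq
    {D : (∀ x, V x) → ∀ x : X, TangentSpace 𝓘(ℝ, ℂ) x → V x} (hD : IsFlatConnection F V D)
    {e e' : ∀ x, F ≃ₗ[ℂ] V x} {x : X}
    (he : ∀ᶠ y in 𝓝 x, ∀ v, ParallelAt F D (fun y => e y v) y)
    (he' : ∀ᶠ y in 𝓝 x, ∀ v, ParallelAt F D (fun y => e' y v) y) :
    ∀ᶠ y in 𝓝 x, ∀ v, (e' y).symm (e y v) = (e' x).symm (e x v) := by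
  let b := Module.finBasis ℂ F
  have h1 := fun v => (hD.eventually_parallelAt_iff he' (fun y => e y v)).1
    (he.mono fun y hy => hy v)
  filter_upwards [Filter.eventually_all.2 fun i => h1 (b i)] with y hy v
  have : ((e y).trans (e' y).symm : F →ₗ[ℂ] F) = (e x).trans (e' x).symm := b.ext hy
  exact congrArg (fun L => L v) this

variable [∀ x, FiniteDimensional ℂ (V x)]

/-- The invariant frames are thought of as constant in t on U i × [-1,1]. Their transition functions
are f-invariant because ψ cancels, so they descend to M. On the boundary, θ takes coordinates in the
chosen frame, and parallel and flat both mean locally constant coordinates. -/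
theorem HitchinSolution.extendsOverM_of_lift [T2Space X] {f : RealStructure X}
    (H : HitchinSolution F V) {ψ : ∀ x, V x →ₗ[ℂ] V (f x)}
    (hψ : IsLift f.toTopInvolution F ψ) (hfix : FixesFibres f.toTopInvolution F ψ)
    (hpar : PreservesParallel H.nabla f.toTopInvolution F ψ) : H.ExtendsOverM f := by
  classical
  have hD := H.isFlatConnection_nabla
  choose U hU hmem hinv e he using exists_invariant_parallel_frame hD hψ hfix hpar
  have hinv' : ∀ i x, f x ∈ U i ↔ x ∈ U i := fun i x =>
    ⟨fun h => by have := hinv i _ h; rwa [f.involutive x] at this, hinv i x⟩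
  have hev : ∀ i, ∀ x ∈ U i, ∀ᶠ y in 𝓝 x, ∀ v, ParallelAt F H.nabla (fun y => e i y v) y :=
    fun i x hx => by
      filter_upwards [(hU i).mem_nhds hx] with y hy v using (he i y hy v).2
  -- The value 0 off the overlap makes g invariant under f at every point, as descent to the
  -- quotient demands.
  let g : X → X → X → F →L[ℂ] F := fun i j x => if x ∈ U i ∧ x ∈ U j then
    LinearMap.toContinuousLinearMap (((e i x).trans (e j x).symm : F ≃ₗ[ℂ] F) : F →ₗ[ℂ] F) else 0
  have hgapp : ∀ i j x, x ∈ U i → x ∈ U j → ∀ v, g i j x v = (e j x).symm (e i x v) := by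
    intro i j x hi hj v
    simp only [g, hi, hj, and_self, if_true]
    rfl
  have hg : ∀ i j x, g i j (f x) = g i j x := by
    intro i j x
    by_cases h : x ∈ U i ∧ x ∈ U j
    · ext v
      rw [hgapp i j x h.1 h.2, hgapp i j (f x) ((hinv' i x).2 h.1) ((hinv' j x).2 h.2),
        LinearEquiv.symm_apply_eq, (he i x h.1 v).1, (he j x h.2 _).1,
        LinearEquiv.apply_symm_apply]
    · have h' : ¬ (f x ∈ U i ∧ f x ∈ U j) := by rwa [hinv', hinv']
      simp only [g]
      rw [if_neg h, if_neg h']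
  have hconst : ∀ i j, ∀ x, x ∈ U i → x ∈ U j → ∀ᶠ y in 𝓝 x, g i j y = g i j x := by
    intro i j x hi hj
    filter_upwards [hD.eventually_transition_eq (hev i x hi) (hev j x hj), (hU i).mem_nhds hi,
      (hU j).mem_nhds hj] with y hy hyi hyj
    ext v
    rw [hgapp i j x hi hj, hgapp i j y hyi hyj, hy]
  let W := FlatBundle.ofInvariantFrames f.toTopInvolution hU hmem hinv' g hg
    (fun i x hx v => by rw [hgapp i i x hx hx, LinearEquiv.symm_apply_apply])
    (fun i j k x hi hj hk v => by
      rw [hgapp i j x hi hj, hgapp j k x hj hk, hgapp i k x hi hk, LinearEquiv.apply_symm_apply])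
    hconst
  let k : X → X := fun x => W.core.indexAt (boundaryInclusion f.toTopInvolution x)
  have hk : ∀ x, x ∈ U (k x) := fun x =>
    W.core.mem_baseSet_at (boundaryInclusion f.toTopInvolution x)
  refine ⟨W, fun x => (e (k x) x).symm, fun S s hS => ?_⟩
  have htriv : ∀ i x, x ∈ U i → (W.core.localTriv i ⟨boundaryInclusion f.toTopInvolution x,
      (e (k x) x).symm (s x)⟩).2 = (e i x).symm (s x) := by
    intro i x hx
    have h1 := hgapp (k x) i x (hk x) hx ((e (k x) x).symm (s x))
    rw [LinearEquiv.apply_symm_apply] at h1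
    exact h1
  constructor
  · intro h x hx i hi
    have h1 := (hD.eventually_parallelAt_iff (hev i x hi) s).1
      (by filter_upwards [hS.mem_nhds hx] with y hy using h y hy)
    filter_upwards [h1, (hU i).mem_nhds hi] with y hy hyi
    exact (htriv i y hyi).trans (hy.trans (htriv i x hi).symm)
  · intro h x hx
    have h1 := h x hx x (hmem x)
    refine ((hD.eventually_parallelAt_iff (hev x x (hmem x)) s).2 ?_).self_of_nhds
    filter_upwards [h1, (hU x).mem_nhds (hmem x)] with y hy hyi
    exact (htriv x y hyi).symm.trans (hy.trans (htriv x x (hmem x)))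

end

/-! ### The -1-eigenspace at a fixed point as an invariant in K-theory -/

namespace EqBundle

variable {X : Type*} [TopologicalSpace X] {f : TopInvolution X}

theorem isLift (V : EqBundle f) : IsLift f V.F V.φ := ⟨V.involutive_φ⟩

/-- Transport between equal fibres. -/
noncomputable def fibreCast (V : EqBundle f) {x y : X} (h : x = y) : V.E x ≃ₗ[ℂ] V.E y :=
  h ▸ LinearEquiv.refl ℂ (V.E x)

theorem mk_fibreCast (V : EqBundle f) {x y : X} (h : x = y) (v : V.E x) :
    (⟨y, V.fibreCast h v⟩ : Bundle.TotalSpace V.F V.E) = ⟨x, v⟩ := by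
  subst h; rfl

/-- The action of the lift on the fibre at a fixed point. -/
noncomputable def fixedAction (V : EqBundle f) {x : X} (h : f x = x) : V.E x →ₗ[ℂ] V.E x :=
  (V.fibreCast h : V.E (f x) →ₗ[ℂ] V.E x) ∘ₗ V.φ x

theorem mk_fixedAction (V : EqBundle f) {x : X} (h : f x = x) (v : V.E x) :
    (⟨x, V.fixedAction h v⟩ : Bundle.TotalSpace V.F V.E) = ⟨f x, V.φ x v⟩ :=
  V.mk_fibreCast h _

theorem fixedAction_fixedAction (V : EqBundle f) {x : X} (h : f x = x) (v : V.E x) :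
    V.fixedAction h (V.fixedAction h v) = v := by
  apply Bundle.TotalSpace.snd_eq (F := V.F)
  rw [V.mk_fixedAction h]
  have h1 := V.involutive_φ ⟨x, v⟩
  have h2 := V.mk_fixedAction h v
  refine Eq.trans ?_ h1
  exact congrArg (fun p : Bundle.TotalSpace V.F V.E =>
    (⟨f p.1, V.φ p.1 p.2⟩ : Bundle.TotalSpace V.F V.E)) h2

/-- The dimension of the `-1`-eigenspace of the lift at a fixed point. -/
noncomputable def negRank (V : EqBundle f) {x : X} (h : f x = x) : ℕ :=
  Module.finrank ℂ (LinearMap.ker (V.fixedAction h + LinearMap.id))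

theorem finiteDimensional_fibre (V : EqBundle f) (x : X) : FiniteDimensional ℂ (V.E x) :=
  ((trivializationAt V.F V.E x).linearEquivAt ℂ x
    (FiberBundle.mem_baseSet_trivializationAt V.F V.E x)).symm.finiteDimensional

theorem negRank_congr {V W : EqBundle f} (hVW : IsIso V W) {x : X} (h : f x = x) :
    V.negRank h = W.negRank h := by
  obtain ⟨e, -, -, he⟩ := hVW
  have hcast : ∀ {y z : X} (hyz : y = z) (v : V.E y),
      e z (V.fibreCast hyz v) = W.fibreCast hyz (e y v) := by
    rintro y z rfl v; rfl
  have hcomm : ∀ v, e x (V.fixedAction h v) = W.fixedAction h (e x v) := by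
    intro v
    change e x (V.fibreCast h _) = W.fibreCast h _
    rw [hcast, he]
  have hmap : (LinearMap.ker (V.fixedAction h + LinearMap.id)).map (e x : V.E x →ₗ[ℂ] W.E x) =
      LinearMap.ker (W.fixedAction h + LinearMap.id) := by
    ext w
    constructor
    · rintro ⟨v, hv, rfl⟩
      change W.fixedAction h (e x v) + e x v = 0
      rw [← hcomm, ← map_add]
      exact (e x).map_eq_zero_iff.2 hv
    · intro hw
      refine ⟨(e x).symm w, (e x).map_eq_zero_iff.1 ?_, (e x).apply_symm_apply w⟩
      change e x (V.fixedAction h _ + (e x).symm w) = 0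
      rw [map_add, hcomm, LinearEquiv.apply_symm_apply]
      exact hw
  rw [negRank, negRank, ← hmap]
  exact (LinearEquiv.finrank_map_eq (e x) _).symm

theorem negRank_directSum (V W : EqBundle f) {x : X} (h : f x = x) :
    (V.directSum W).negRank h = V.negRank h + W.negRank h := by
  have := V.finiteDimensional_fibre x
  have := W.finiteDimensional_fibre x
  have hcast : ∀ {y z : X} (hyz : y = z) (v : V.E y) (w : W.E y),
      (V.directSum W).fibreCast hyz (v, w) = (V.fibreCast hyz v, W.fibreCast hyz w) := by
    rintro y z rfl v w; rfl
  let p : ((V.directSum W).fixedAction h + LinearMap.id).ker ≃ₗ[ℂ]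
      (V.fixedAction h + LinearMap.id).ker × (W.fixedAction h + LinearMap.id).ker :=
    { toFun := fun u => (⟨u.1.1, by
          have h1 : (V.directSum W).fibreCast h (V.φ x u.1.1, W.φ x u.1.2) + u.1 = 0 := u.2
          rw [hcast] at h1
          exact congrArg Prod.fst h1⟩, ⟨u.1.2, by
          have h1 : (V.directSum W).fibreCast h (V.φ x u.1.1, W.φ x u.1.2) + u.1 = 0 := u.2
          rw [hcast] at h1
          exact congrArg Prod.snd h1⟩)
      map_add' := fun _ _ => rfl
      map_smul' := fun _ _ => rfl
      invFun := fun q => ⟨(q.1.1, q.2.1), by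
          have h1 := hcast h (V.φ x q.1.1) (W.φ x q.2.1)
          exact (congrArg (fun u : (V.directSum W).E x =>
            u + (show (V.directSum W).E x from (q.1.1, q.2.1))) h1).trans
            (Prod.ext q.1.2 q.2.2)⟩
      left_inv := fun _ => rfl
      right_inv := fun _ => rfl }
  rw [negRank, p.finrank_eq, Module.finrank_prod]
  rfl

theorem negRank_trivial (n : ℕ) {x : X} (h : f x = x) : (trivial f n).negRank h = 0 := by
  have hcast : ∀ {y z : X} (hyz : y = z) (v : Fin n → ℂ),
      (trivial f n).fibreCast hyz v = v := by
    rintro y z rfl v; rfl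
  have hker : LinearMap.ker ((trivial f n).fixedAction h + LinearMap.id) = ⊥ := by
    refine (LinearMap.ker_eq_bot').2 fun v hv => ?_
    have h1 : (2 : ℂ) • (show Fin n → ℂ from v) = 0 :=
      (two_smul ℂ _).trans ((congrArg (fun u : Fin n → ℂ =>
        u + (show Fin n → ℂ from v)) (hcast h v)).symm.trans hv)
    exact (smul_eq_zero.1 h1).resolve_left two_ne_zero
  rw [negRank, hker]
  exact finrank_bot ℂ _

/-- The rank of the `-1`-eigenbundle at a fixed point, on isomorphism classes. -/
noncomputable def negRankHom {x : X} (h : f x = x) : IsoClass f →+ ℤ where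
  toFun := Quotient.lift (fun V => (V.negRank h : ℤ)) fun _ _ hVW => by
    exact_mod_cast negRank_congr hVW h
  map_zero' := by
    change ((trivial f 0).negRank h : ℤ) = 0
    rw [negRank_trivial]; rfl
  map_add' := by
    rintro ⟨V⟩ ⟨W⟩
    change ((V.directSum W).negRank h : ℤ) = V.negRank h + W.negRank h
    rw [negRank_directSum]; push_cast; rfl

/-- The rank of the -1-eigenspace extends to a homomorphism on the Grothendieck group which kills
the generator of the quotiented subgroup. Hence the eigenspace is zero, and an involution without
eigenvalue -1 is the identity. -/
theorem fixesFibres_of_reducedClass_eq_zero {V : EqBundle f} (hV : V.reducedClass = 0) :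
    FixesFibres f V.F V.φ := by
  intro x h
  have h1 : V.kClass ∈ AddSubgroup.zmultiples (trivial f 1).kClass :=
    (QuotientAddGroup.eq_zero_iff _).1 hV
  obtain ⟨n, hn⟩ := AddSubgroup.mem_zmultiples_iff.1 h1
  have h2 : ∀ W : EqBundle f, Algebra.GrothendieckAddGroup.lift (negRankHom h) W.kClass =
      (W.negRank h : ℤ) := fun W =>
    DFunLike.congr_fun (Algebra.GrothendieckAddGroup.lift.symm_apply_apply (negRankHom h))
      W.isoClass
  have h3 := h2 V
  rw [← hn, map_zsmul, h2, negRank_trivial] at h3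
  have h4 : V.negRank h = 0 := by
    have : (V.negRank h : ℤ) = 0 := by rw [← h3]; simp
    exact_mod_cast this
  have := V.finiteDimensional_fibre x
  have h5 := Submodule.finrank_eq_zero.1 h4
  intro v
  -- For an involution, the difference of the image of v and v is an eigenvector for -1, hence zero.
  have h6 : V.fixedAction h v - v ∈ LinearMap.ker (V.fixedAction h + LinearMap.id) := by
    change V.fixedAction h (V.fixedAction h v - v) + (V.fixedAction h v - v) = 0
    rw [map_sub, V.fixedAction_fixedAction h]
    abel
  rw [h5, Submodule.mem_bot, sub_eq_zero] at h6
  rw [← V.mk_fixedAction h, h6]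

end EqBundle

/-! ### Flat frames along the intervals of M and parallel transport -/

theorem isOpen_ordConnectedComponent {I : Type*} [LinearOrder I] [TopologicalSpace I]
    [OrderTopology I] {s : Set I} (hs : IsOpen s) (t : I) : IsOpen (s.ordConnectedComponent t) := by
  rw [isOpen_iff_mem_nhds]
  intro y hy
  filter_upwards [Set.ordConnectedComponent_mem_nhds.2
    (hs.mem_nhds (Set.ordConnectedComponent_subset hy))] with z hz
  exact Set.mem_ordConnectedComponent_trans hy hz

namespace FlatBundle

universe u

variable {Y : Type u} [TopologicalSpace Y] {F : Type} [NormedAddCommGroup F] [NormedSpace ℂ F]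
  (W : FlatBundle Y F) {Z : Type*} [TopologicalSpace Z] {j : Z → Y}

/-- The section `s` of the pull-back of `W` along `j` is flat at `z`. -/
def FlatAt (j : Z → Y) (s : ∀ z, W.core.Fiber (j z)) (z : Z) : Prop :=
  ∀ i, j z ∈ W.core.baseSet i → ∀ᶠ z' in 𝓝 z,
    W.core.coordChange (W.core.indexAt (j z')) i (j z') (s z') =
      W.core.coordChange (W.core.indexAt (j z)) i (j z) (s z)

variable {W}

theorem coordChange_coordChange (i k : W.ι) {y : Y} (hi : y ∈ W.core.baseSet i)
    (hk : y ∈ W.core.baseSet k) (v : F) :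
    W.core.coordChange k i y (W.core.coordChange i k y v) = v := by
  rw [W.core.coordChange_comp i k i y ⟨⟨hi, hk⟩, hi⟩, W.core.coordChange_self i y hi]

theorem FlatAt.congr {s s' : ∀ z, W.core.Fiber (j z)} {z : Z} (h : W.FlatAt j s z)
    (hs : ∀ᶠ z' in 𝓝 z, s z' = s' z') : W.FlatAt j s' z := by
  intro i hi
  filter_upwards [h i hi, hs] with z' h1 h2
  rw [← h2, h1, hs.self_of_nhds]

/-- Flatness of a section, tested in a flat frame. -/
theorem flatAt_iff {E : Z → F ≃ₗ[ℂ] F} {z : Z} (hj : ContinuousAt j z)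
    (hE : ∀ v, W.FlatAt j (fun z => E z v) z) (s : Z → F) :
    W.FlatAt j s z ↔ ∀ᶠ z' in 𝓝 z, (E z').symm (s z') = (E z).symm (s z) := by
  constructor
  · intro h
    have hz := W.core.mem_baseSet_at (j z)
    filter_upwards [h _ hz, hE ((E z).symm (s z)) _ hz,
      hj ((W.core.isOpen_baseSet _).mem_nhds hz)] with z' h1 h2 h3
    rw [LinearEquiv.apply_symm_apply, ← h1] at h2
    have h4 := congrArg (W.core.coordChange (W.core.indexAt (j z)) (W.core.indexAt (j z')) (j z')) h2
    rw [coordChange_coordChange _ _ (W.core.mem_baseSet_at (j z')) h3,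
      coordChange_coordChange _ _ (W.core.mem_baseSet_at (j z')) h3] at h4
    rw [← h4, LinearEquiv.symm_apply_apply]
  · intro h
    refine FlatAt.congr (hE ((E z).symm (s z))) ?_
    filter_upwards [h] with z' hz'
    rw [← hz', LinearEquiv.apply_symm_apply]

variable (W) in
/-- The flat frame given by a flat trivialization. -/
theorem exists_frame (hj : Continuous j) (i : W.ι) :
    ∃ E : Z → F ≃ₗ[ℂ] F, ∀ z, j z ∈ W.core.baseSet i → ∀ v, W.FlatAt j (fun z => E z v) z := by
  classical
  have h : ∀ z, ∃ E : F ≃ₗ[ℂ] F, j z ∈ W.core.baseSet i →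
      ∀ v, E v = W.core.coordChange i (W.core.indexAt (j z)) (j z) v := by
    intro z
    by_cases hz : j z ∈ W.core.baseSet i
    · refine ⟨LinearEquiv.ofBijective
        (W.core.coordChange i (W.core.indexAt (j z)) (j z) : F →ₗ[ℂ] F)
        (Function.bijective_iff_has_inverse.2
          ⟨W.core.coordChange (W.core.indexAt (j z)) i (j z),
            fun v => coordChange_coordChange _ _ hz (W.core.mem_baseSet_at _) v,
            fun v => coordChange_coordChange _ _ (W.core.mem_baseSet_at _) hz v⟩), fun _ v => rfl⟩
    · exact ⟨LinearEquiv.refl ℂ F, fun h => absurd h hz⟩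
  choose E hE using h
  refine ⟨E, fun z hz v k hk => ?_⟩
  have hcomp : ∀ z, j z ∈ W.core.baseSet i → j z ∈ W.core.baseSet k →
      W.core.coordChange (W.core.indexAt (j z)) k (j z) (E z v) = W.core.coordChange i k (j z) v := by
    intro z hi hk
    rw [hE z hi, W.core.coordChange_comp _ _ _ _ ⟨⟨hi, W.core.mem_baseSet_at _⟩, hk⟩]
  have hj' := hj.continuousAt (x := z)
  filter_upwards [hj'.eventually (W.flat i k (j z) ⟨hz, hk⟩),
    hj' ((W.core.isOpen_baseSet i).mem_nhds hz), hj' ((W.core.isOpen_baseSet k).mem_nhds hk)]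
    with z' h1 h2 h3
  rw [hcomp z' h2 h3, hcomp z hz hk, h1]

variable (W) in
/-- A flat frame along an interval, locally uniformly in a parameter. -/
theorem exists_frame_interval {X I : Type*} [TopologicalSpace X] [LinearOrder I]
    [TopologicalSpace I] [OrderTopology I] [PreconnectedSpace I] {j : X × I → Y} (hj : Continuous j)
    [FiniteDimensional ℂ F] {a b : I} (ha : ∀ t, a ≤ t) (hb : ∀ t, t ≤ b) (x₀ : X) :
    ∃ N : Set X, IsOpen N ∧ x₀ ∈ N ∧ ∃ E : X × I → F ≃ₗ[ℂ] F, ∀ p : X × I, p.1 ∈ N →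
      ∀ v, W.FlatAt j (fun z => E z v) p := by
  classical
  -- Continuity method: S consists of the times t up to which a flat frame exists over a
  -- neighbourhood of {x₀} × [a, t]. It is open, closed and contains a, hence contains b.
  let S : Set I := {t | ∃ N : Set X, IsOpen N ∧ x₀ ∈ N ∧ ∃ T : Set I, IsOpen T ∧ Set.Iic t ⊆ T ∧
    ∃ E : X × I → F ≃ₗ[ℂ] F, ∀ p : X × I, p.1 ∈ N → p.2 ∈ T →
      ∀ v, W.FlatAt j (fun z => E z v) p}
  have hloc : ∀ t : I, ∃ N : Set X, IsOpen N ∧ x₀ ∈ N ∧ ∃ T : Set I, IsOpen T ∧ t ∈ T ∧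
      T.OrdConnected ∧ ∃ E : X × I → F ≃ₗ[ℂ] F, ∀ p : X × I, p.1 ∈ N → p.2 ∈ T →
      ∀ v, W.FlatAt j (fun z => E z v) p := by
    intro t
    obtain ⟨E, hE⟩ := W.exists_frame hj (W.core.indexAt (j (x₀, t)))
    have h1 : j ⁻¹' W.core.baseSet (W.core.indexAt (j (x₀, t))) ∈ 𝓝 (x₀, t) :=
      hj.continuousAt ((W.core.isOpen_baseSet _).mem_nhds (W.core.mem_baseSet_at _))
    rw [nhds_prod_eq, Filter.mem_prod_iff] at h1
    obtain ⟨A, hA, B, hB, hAB⟩ := h1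
    refine ⟨interior A, isOpen_interior, mem_interior_iff_mem_nhds.2 hA,
      (interior B).ordConnectedComponent t, isOpen_ordConnectedComponent isOpen_interior t,
      Set.self_mem_ordConnectedComponent.2 (mem_interior_iff_mem_nhds.2 hB),
      inferInstance, E, fun p h1 h2 => hE p ?_⟩
    exact hAB ⟨interior_subset h1, interior_subset (Set.ordConnectedComponent_subset h2)⟩
  have hopen : IsOpen S := by
    rw [isOpen_iff_mem_nhds]
    rintro t ⟨N, hN, hxN, T, hT, htT, hE⟩
    have h1 : T.ordConnectedComponent t ∈ 𝓝 t :=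
      Set.ordConnectedComponent_mem_nhds.2 (hT.mem_nhds (htT le_rfl))
    filter_upwards [h1] with t' ht'
    refine ⟨N, hN, hxN, T, hT, fun s hs => ?_, hE⟩
    rcases le_total s t with h | h
    · exact htT h
    · exact ht' ⟨inf_le_left.trans h, le_trans hs le_sup_right⟩
  have hclosed : IsClosed S := by
    rw [← isOpen_compl_iff, isOpen_iff_mem_nhds]
    intro t ht
    obtain ⟨N', hN', hxN', T', hT', htT', hT'c, B, hB⟩ := hloc t
    filter_upwards [hT'.mem_nhds htT'] with t' ht' htS
    apply ht
    obtain ⟨N, hN, hxN, T, hT, htT, E, hE⟩ := htS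
    rcases le_total t t' with h | h
    · exact ⟨N, hN, hxN, T, hT, fun s hs => htT (le_trans hs h), E, hE⟩
    -- the comparison of the two frames at time `t'`
    have hcmp : ∀ x, x ∈ N → x ∈ N' → ∀ v, ∀ᶠ p in 𝓝 (x, t'),
        (B p).symm (E p v) = (B (x, t')).symm (E (x, t') v) := fun x h1 h2 v =>
      (flatAt_iff hj.continuousAt (hB (x, t') h2 ht') _).1 (hE (x, t') h1 (htT le_rfl) v)
    let b := Module.finBasis ℂ F
    have hcmp' : ∀ x, x ∈ N → x ∈ N' → ∀ᶠ p in 𝓝 (x, t'), ∀ v,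
        (B p).symm (E p v) = (B (x, t')).symm (E (x, t') v) := by
      intro x h1 h2
      filter_upwards [Filter.eventually_all.2 fun i => hcmp x h1 h2 (b i)] with p hp v
      have : ((E p).trans (B p).symm : F →ₗ[ℂ] F) = (E (x, t')).trans (B (x, t')).symm :=
        b.ext hp
      exact congrArg (fun L => L v) this
    -- The constant change of basis M aligns B with E at (x₀, t'). Since the comparison of the two
    -- flat frames is locally constant, they then agree near (x, t') for all x close to x₀, so E
    -- continues past t' as B with M applied first.
    let M : F ≃ₗ[ℂ] F := (E (x₀, t')).trans (B (x₀, t')).symm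
    have hcurve : ContinuousAt (fun x : X => (x, t')) x₀ := by fun_prop
    obtain ⟨N₁, hN₁, hN₁o, hxN₁⟩ := eventually_nhds_iff.1 (hcurve.eventually (hcmp' x₀ hxN hxN'))
    refine ⟨N ∩ N' ∩ N₁, (hN.inter hN').inter hN₁o, ⟨⟨hxN, hxN'⟩, hxN₁⟩, Set.Iio t' ∪ T',
      isOpen_Iio.union hT', fun s hs => ?_, fun p => if p.2 ≤ t' then E p else M.trans (B p), ?_⟩
    · rcases lt_or_ge s t' with h1 | h1
      · exact Or.inl h1
      · exact Or.inr (hT'c.out ht' htT' ⟨h1, hs⟩)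
    · rintro ⟨x, s⟩ ⟨⟨h1, h2⟩, h3⟩ hs v
      rcases lt_trichotomy s t' with h4 | rfl | h4
      · refine FlatAt.congr (hE (x, s) h1 (htT h4.le) v) ?_
        have : ∀ᶠ p : X × I in 𝓝 (x, s), p.2 < t' :=
          continuous_snd.continuousAt.eventually (Iio_mem_nhds h4)
        filter_upwards [this] with p hp
        rw [if_pos hp.le]
      · refine FlatAt.congr (hE (x, s) h1 (htT le_rfl) v) ?_
        filter_upwards [hcmp' x h1 h2] with p hp
        split_ifs with h5
        · rfl
        · have h6 := hN₁ x h3 v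
          have h7 := hp v
          rw [h6] at h7
          change E p v = B p (M v)
          change _ = M v at h7
          rw [← h7, LinearEquiv.apply_symm_apply]
      · have hsT : s ∈ T' := hs.resolve_left fun h => lt_asymm h4 h
        refine FlatAt.congr (hB (x, s) h2 hsT (M v)) ?_
        have : ∀ᶠ p : X × I in 𝓝 (x, s), t' < p.2 :=
          continuous_snd.continuousAt.eventually (Ioi_mem_nhds h4)
        filter_upwards [this] with p hp
        rw [if_neg hp.not_ge]
        rfl
  have hne : S.Nonempty := by
    obtain ⟨N, hN, hxN, T, hT, haT, -, hE⟩ := hloc a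
    exact ⟨a, N, hN, hxN, T, hT, fun s hs => le_antisymm hs (ha s) ▸ haT, hE⟩
  have huniv : S = Set.univ := IsClopen.eq_univ ⟨hclosed, hopen⟩ hne
  obtain ⟨N, hN, hxN, T, -, hT, E, hE⟩ : b ∈ S := huniv ▸ Set.mem_univ b
  exact ⟨N, hN, hxN, E, fun p hp v => hE p hp (hT (hb p.2)) v⟩

end FlatBundle

namespace FlatBundle

universe u

variable {Y : Type u} [TopologicalSpace Y] {F : Type} [NormedAddCommGroup F] [NormedSpace ℂ F]
  {W : FlatBundle Y F} {Z : Type*} [TopologicalSpace Z]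

theorem FlatAt.comp {Z' : Type*} [TopologicalSpace Z'] {j : Z → Y} {s : Z → F} {g : Z' → Z} {z : Z'}
    (h : W.FlatAt j s (g z)) (hg : ContinuousAt g z) :
    W.FlatAt (fun z => j (g z)) (fun z => s (g z)) z :=
  fun i hi => hg.eventually (h i hi)

theorem flatAt_congr_map {j j' : Z → Y} (hj : ∀ z, j z = j' z) {s : Z → F} {z : Z} :
    W.FlatAt j s z ↔ W.FlatAt j' s z := by
  obtain rfl : j = j' := funext hj
  rfl

/-- Flat frames over a connected space differ by a constant. -/
theorem frame_comparison [PreconnectedSpace Z] {j : Z → Y} (hj : Continuous j)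
    {E E' : Z → F ≃ₗ[ℂ] F} (hE : ∀ z v, W.FlatAt j (fun z => E z v) z)
    (hE' : ∀ z v, W.FlatAt j (fun z => E' z v) z) (z z' : Z) (v : F) :
    (E z).symm (E' z v) = (E z').symm (E' z' v) := by
  have h : IsLocallyConstant fun z => (E z).symm (E' z v) :=
    (IsLocallyConstant.iff_eventually_eq _).2 fun z =>
      (flatAt_iff hj.continuousAt (hE z) _).1 (hE' z v)
  exact h.apply_eq_of_preconnectedSpace z z'

variable {X : Type u} [TopologicalSpace X] {f : TopInvolution X}

theorem continuous_mk : Continuous (fun p : X × Set.Icc (-1 : ℝ) 1 => (Quot.mk _ p : MSpace f)) :=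
  continuous_coinduced_rng

theorem mk_tau (p : X × Set.Icc (-1 : ℝ) 1) :
    (Quot.mk _ (tau f p) : MSpace f) = Quot.mk _ p :=
  (Quot.sound (r := fun p q => q = tau f p) rfl).symm

/-- The map P is parallel transport from (x, 1) to (x, -1), and the latter is the same point of M as
(f x, 1). Over a fixed point, t and -t give the same point of M, so the transport goes back along
its own path and is trivial. -/
theorem exists_transport [FiniteDimensional ℂ F] (W : FlatBundle (MSpace f) F) :
    ∃ P : X → F ≃ₗ[ℂ] F,
      (∀ (x : X) (s : X → F), W.FlatAt (boundaryInclusion f) s x →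
        W.FlatAt (fun y => boundaryInclusion f (f y)) (fun y => P y (s y)) x) ∧
      ∀ x, f x = x → ∀ v, P x v = v := by
  let I := Set.Icc (-1 : ℝ) 1
  let j : X × I → MSpace f := fun p => Quot.mk _ p
  have hj : Continuous j := continuous_mk
  have : PreconnectedSpace I := Subtype.preconnectedSpace isPreconnected_Icc
  let a : I := ⟨-1, le_rfl, by norm_num⟩
  let b : I := ⟨1, by norm_num, le_rfl⟩
  let o : I := ⟨0, by norm_num, by norm_num⟩
  choose N hN hxN E hE using fun x₀ => W.exists_frame_interval hj (a := a) (b := b)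
    (fun t => t.2.1) (fun t => t.2.2) x₀
  have hcurve : ∀ x : X, Continuous fun t : I => (x, t) := fun x => by fun_prop
  have hline : ∀ x₀ x, x ∈ N x₀ → ∀ t v,
      W.FlatAt (fun t => j (x, t)) (fun t => E x₀ (x, t) v) t := fun x₀ x hx t v =>
    FlatAt.comp (g := fun t => (x, t)) (hE x₀ (x, t) hx v) (hcurve x).continuousAt
  -- The frame built around x is used at x itself; `hP` shows that the frame around any other base
  -- point gives the same transport, and this makes P preserve flat sections.
  let P : X → F ≃ₗ[ℂ] F := fun x => (E x (x, b)).symm.trans (E x (x, a))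
  have hP : ∀ x₀ x, x ∈ N x₀ → ∀ v, P x (E x₀ (x, b) v) = E x₀ (x, a) v := by
    intro x₀ x hx v
    have h1 := frame_comparison (hj.comp (hcurve x)) (hline x x (hxN x)) (hline x₀ x hx) a b v
    change E x (x, a) ((E x (x, b)).symm (E x₀ (x, b) v)) = _
    rw [← h1, LinearEquiv.apply_symm_apply]
  refine ⟨P, fun x s hs => ?_, fun x hx v => ?_⟩
  · have hb : ∀ v, W.FlatAt (boundaryInclusion f) (fun y => E x (y, b) v) x := fun v =>
      FlatAt.comp (g := fun y => (y, b)) (hE x (x, b) (hxN x) v) (by fun_prop)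
    have ha : ∀ v, W.FlatAt (fun y => j (y, a)) (fun y => E x (y, a) v) x := fun v =>
      FlatAt.comp (g := fun y => (y, a)) (hE x (x, a) (hxN x) v) (by fun_prop)
    have hbc : Continuous (boundaryInclusion f) := hj.comp (by fun_prop : Continuous fun y => (y, b))
    have hmap : ∀ y, j (y, a) = boundaryInclusion f (f y) := by
      intro y
      refine (mk_tau (f := f) (y, a)).symm.trans ?_
      refine congrArg (fun p => (Quot.mk _ p : MSpace f)) (Prod.ext rfl (Subtype.ext ?_))
      change -(-1 : ℝ) = 1
      norm_num
    have h1 := (flatAt_iff hbc.continuousAt hb s).1 hs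
    refine (flatAt_congr_map hmap).1 (FlatAt.congr (ha ((E x (x, b)).symm (s x))) ?_)
    filter_upwards [h1, (hN x).mem_nhds (hxN x)] with y hy hyN
    rw [← hP x y hyN, ← hy, LinearEquiv.apply_symm_apply]
  -- Reflecting t turns a flat frame along the path over a fixed point into another flat frame along
  -- the same path in M.
  · have hneg : Continuous fun t : I => (⟨-t.1, neg_le_neg t.2.2, neg_le.1 t.2.1⟩ : I) := by fun_prop
    have hsymm : ∀ t : I, j (x, ⟨-t.1, neg_le_neg t.2.2, neg_le.1 t.2.1⟩) = j (x, t) := by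
      intro t
      have h1 : tau f (x, t) = (x, ⟨-t.1, neg_le_neg t.2.2, neg_le.1 t.2.1⟩) :=
        Prod.ext hx rfl
      rw [← h1]
      exact mk_tau _
    have h2 : ∀ t v, W.FlatAt (fun t => j (x, t))
        (fun t => E x (x, ⟨-t.1, neg_le_neg t.2.2, neg_le.1 t.2.1⟩) v) t := by
      intro t v
      have h3 := FlatAt.comp (g := fun t : I => (⟨-t.1, neg_le_neg t.2.2, neg_le.1 t.2.1⟩ : I))
        (hline x x (hxN x) ⟨-t.1, neg_le_neg t.2.2, neg_le.1 t.2.1⟩ v) hneg.continuousAt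
      exact (flatAt_congr_map hsymm).1 h3
    -- The original and the reflected frame differ by a constant. At t = 0 they coincide, so they
    -- coincide at t = 1, where the reflected frame is the original one at t = -1.
    have h4 := frame_comparison (hj.comp (hcurve x)) (hline x x (hxN x))
      (E' := fun t => E x (x, ⟨-t.1, neg_le_neg t.2.2, neg_le.1 t.2.1⟩)) h2 b o
      ((E x (x, b)).symm v)
    have h5 : (⟨-(b : I).1, neg_le_neg b.2.2, neg_le.1 b.2.1⟩ : I) = a := rfl
    have h6 : (⟨-(o : I).1, neg_le_neg o.2.2, neg_le.1 o.2.1⟩ : I) = o :=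
      Subtype.ext neg_zero
    simp only [h5, h6, LinearEquiv.symm_apply_apply] at h4
    change E x (x, a) ((E x (x, b)).symm v) = v
    rw [LinearEquiv.symm_apply_eq] at h4
    rw [h4, LinearEquiv.apply_symm_apply]

end FlatBundle

/-! ### Extension over M determines the lift at the fixed points up to sign -/

theorem IsLift.apply_section {X : Type*} [TopologicalSpace X] {f : TopInvolution X} {F : Type}
    {V : X → Type} [∀ x, AddCommGroup (V x)] [∀ x, Module ℂ (V x)] {ψ : ∀ x, V x →ₗ[ℂ] V (f x)}
    (h : IsLift f F ψ) {s s' : ∀ x, V x} (hs : ∀ x, s' (f x) = ψ x (s x)) (x : X) :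
    s (f x) = ψ x (s' x) := by
  have h1 := h.apply_apply (f x) (s (f x))
  rw [← hs] at h1
  have key : ∀ y, y = x → (⟨f y, ψ y (s' y)⟩ : Bundle.TotalSpace F V) = ⟨f x, ψ x (s' x)⟩ := by
    rintro y rfl; rfl
  rw [key _ (f.involutive x)] at h1
  exact (Bundle.TotalSpace.snd_eq h1).symm

section

universe u

variable {X : Type u} [TopologicalSpace X] [ChartedSpace ℂ X] [IsManifold 𝓘(ℂ) ω X]
  {F : Type} [NormedAddCommGroup F] [NormedSpace ℂ F] [FiniteDimensional ℂ F]
  {V : X → Type} [∀ x, NormedAddCommGroup (V x)] [∀ x, InnerProductSpace ℂ (V x)]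
  [TopologicalSpace (Bundle.TotalSpace F V)] [FiberBundle F V]
  [VectorBundle ℂ F V] [ContMDiffVectorBundle ∞ F V 𝓘(ℝ, ℂ)]
  [∀ x, FiniteDimensional ℂ (V x)] [T2Space X]

/-- An endomorphism which preserves parallel sections is a scalar, if the connection is simple. -/
theorem HitchinSolution.IsSimple.eq_smul {H : HitchinSolution F V} (hH : H.IsSimple)
    (T : ∀ x, V x →ₗ[ℂ] V x)
    (hT : ∀ s x, (∀ᶠ y in 𝓝 x, ParallelAt F H.nabla s y) →
      ∀ᶠ y in 𝓝 x, ParallelAt F H.nabla (fun y => T y (s y)) y) :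
    ∃ c : ℂ, ∀ x v, T x v = c • v := by
  have hD := H.isFlatConnection_nabla
  refine hH T fun x σ hσ => ?_
  obtain ⟨e, he⟩ := hD.exists_parallel_linearEquiv x
  -- Simplicity concerns endomorphisms commuting with ∇ on all smooth sections. In a parallel frame,
  -- T has the locally constant matrix M, so it commutes with differentiating coordinates.
  let M : F →L[ℂ] F := LinearMap.toContinuousLinearMap
    (((e x).symm : V x →ₗ[ℂ] F) ∘ₗ T x ∘ₗ (e x : F →ₗ[ℂ] V x))
  have hM : ∀ᶠ y in 𝓝 x, ∀ v, T y (e y v) = e y (M v) := by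
    let b := Module.finBasis ℂ F
    have h1 := fun v => (hD.eventually_parallelAt_iff he _).1
      (hT (fun y => e y v) x (he.mono fun y hy => hy v))
    filter_upwards [Filter.eventually_all.2 fun i => h1 (b i)] with y hy v
    have h2 : T y ∘ₗ (e y : F →ₗ[ℂ] V y) = (e y : F →ₗ[ℂ] V y) ∘ₗ (M : F →ₗ[ℂ] F) := by
      refine b.ext fun i => ?_
      have := hy i
      rw [LinearEquiv.symm_apply_eq] at this
      exact this
    exact congrArg (fun L => L v) h2
  have he' := he.self_of_nhds
  have hσe : σ = fun y => e y ((e y).symm (σ y)) := by simp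
  have ha := (smoothSectionAt_frame_iff (a := fun y => (e y).symm (σ y))
    fun v => (he' v).1).1 (by rw [← hσe]; exact hσ)
  have hMa : ContMDiffAt 𝓘(ℝ, ℂ) 𝓘(ℝ, F) ∞ (fun y => M ((e y).symm (σ y))) x :=
    ((M.restrictScalars ℝ).contDiff.contMDiff.contMDiffAt).comp x ha
  have hnear : ∀ᶠ y in 𝓝 x, e y (M ((e y).symm (σ y))) = T y (σ y) := by
    filter_upwards [hM] with y hy
    rw [← hy, LinearEquiv.apply_symm_apply]
  have hsm := (smoothSectionAt_frame_iff fun v => (he' v).1).2 hMa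
  refine ⟨hsm.congr hnear, fun w => ?_⟩
  rw [← hD.congr x _ _ hsm.diff hnear, hD.apply_parallel_frame he' hMa]
  refine (congrArg (e x) (mvfderiv_continuousLinearMap_comp (M.restrictScalars ℝ)
    (ha.mdifferentiableAt (by simp)) w)).trans ?_
  have h3 := hD.apply_parallel_frame he' ha w
  rw [← hσe] at h3
  rw [h3]
  exact (hM.self_of_nhds _).symm

/-- Transport in M gives χ : V_x → V_{f x}, and T = ψ⁻¹χ maps parallel sections to parallel
sections, so T is a scalar c by simplicity. Where f x = x, χ is the identity, hence cψ = 1; together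
with ψ² = 1 this makes c² act as 1. -/
theorem HitchinSolution.fixesFibres_of_extendsOverM {f : RealStructure X}
    {H : HitchinSolution F V} (hH : H.IsSimple) {ψ : ∀ x, V x →ₗ[ℂ] V (f x)}
    (hψ : IsLift f.toTopInvolution F ψ)
    (hpar : PreservesParallel H.nabla f.toTopInvolution F ψ) (hext : H.ExtendsOverM f) :
    FixesFibres f.toTopInvolution F ψ ∨ FixesFibres f.toTopInvolution F (fun x => -ψ x) := by
  have hD := H.isFlatConnection_nabla
  obtain ⟨W, θ, hθ⟩ : ∃ (W : FlatBundle (MSpace f.toTopInvolution) F) (θ : ∀ x, V x ≃ₗ[ℂ] F),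
    ∀ (U : Set X) (s : ∀ x, V x), IsOpen U → (H.IsParallelOn s U ↔
      W.IsFlatOn (boundaryInclusion f.toTopInvolution) (fun x => θ x (s x)) U) := hext
  have hθ' : ∀ (s : ∀ x, V x) (x : X), (∀ᶠ y in 𝓝 x, ParallelAt F H.nabla s y) ↔
      ∀ᶠ y in 𝓝 x, W.FlatAt (boundaryInclusion f.toTopInvolution) (fun y => θ y (s y)) y := by
    intro s x
    constructor
    · intro h
      obtain ⟨U, hU, hUo, hx⟩ := eventually_nhds_iff.1 h
      filter_upwards [hUo.mem_nhds hx] with y hy using (hθ U s hUo).1 hU y hy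
    · intro h
      obtain ⟨U, hU, hUo, hx⟩ := eventually_nhds_iff.1 h
      filter_upwards [hUo.mem_nhds hx] with y hy using (hθ U s hUo).2 hU y hy
  obtain ⟨P, hP, hPfix⟩ := W.exists_transport
  let χ : ∀ x, V x →ₗ[ℂ] V (f x) := fun x =>
    ((θ (f x)).symm : F →ₗ[ℂ] V (f x)) ∘ₗ (P x : F →ₗ[ℂ] F) ∘ₗ (θ x : V x →ₗ[ℂ] F)
  let T : ∀ x, V x →ₗ[ℂ] V x := fun x => ((hψ.equiv x).symm : V (f x) →ₗ[ℂ] V x) ∘ₗ χ x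
  have hψT : ∀ x v, ψ x (T x v) = χ x v := fun x v => (hψ.equiv x).apply_symm_apply _
  have hT : ∀ s x, (∀ᶠ y in 𝓝 x, ParallelAt F H.nabla s y) →
      ∀ᶠ y in 𝓝 x, ParallelAt F H.nabla (fun y => T y (s y)) y := by
    intro s x hs
    -- The section s' is χ applied to s and transported along f; it is parallel by flatness of the
    -- transport, and applying ψ to it gives back Ts.
    obtain ⟨s', hs'⟩ := f.toTopInvolution.exists_section (fun x => χ x (s x))
    have hflat : ∀ᶠ y in 𝓝 (f x),
        W.FlatAt (boundaryInclusion f.toTopInvolution) (fun y => θ y (s' y)) y := by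
      have h1 := (hθ' s x).1 hs
      have hfc : ContinuousAt f (f x) := f.continuous_toFun.continuousAt
      have hffx : f (f x) = x := f.involutive x
      have h2 : ∀ᶠ y in 𝓝 (f x), W.FlatAt (boundaryInclusion f.toTopInvolution)
          (fun y => θ y (s y)) (f y) := hfc.eventually (by rw [hffx]; exact h1)
      filter_upwards [h2] with y hy
      have h3 := hP (f y) _ hy
      have h4 := FlatBundle.FlatAt.comp (g := f) h3 f.continuous_toFun.continuousAt
      have h5 : ∀ z, P (f z) (θ (f z) (s (f z))) = θ z (s' z) := by
        intro z
        have h6 : ∀ z, P z (θ z (s z)) = θ (f z) (s' (f z)) := by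
          intro z
          rw [hs']
          exact ((θ (f z)).apply_symm_apply _).symm
        rw [h6]
        have key : ∀ y z : X, y = z → θ y (s' y) = θ z (s' z) := by rintro _ _ rfl; rfl
        exact key _ _ (f.involutive z)
      have h6 : (fun z => P (f z) (θ (f z) (s (f z)))) = fun z => θ z (s' z) := funext h5
      refine (FlatBundle.flatAt_congr_map (fun z => ?_)).1 (h6 ▸ h4)
      exact congrArg (boundaryInclusion f.toTopInvolution) (f.involutive z)
    have h7 := (hθ' s' (f x)).2 hflat
    have h8 : ∀ᶠ y in 𝓝 x, ParallelAt F H.nabla s' (f y) :=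
      (f.continuous_toFun.continuousAt (x := x)).eventually h7
    filter_upwards [h8] with y hy
    have h9 := hpar s' (fun y => T y (s y)) (hψ.apply_section (s := fun y => T y (s y)) (s' := s')
      fun y => by rw [hs', hψT]) (f y) hy
    rwa [f.involutive y] at h9
  obtain ⟨c, hc⟩ := hH.eq_smul T hT
  have hχ : ∀ x, f x = x → ∀ v, (⟨f x, χ x v⟩ : Bundle.TotalSpace F V) = ⟨x, v⟩ := by
    intro x hx v
    have key : ∀ y, y = x → (⟨y, (θ y).symm (θ x v)⟩ : Bundle.TotalSpace F V) = ⟨x, v⟩ := by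
      rintro y rfl
      exact congrArg _ ((θ y).symm_apply_apply v)
    have h1 : χ x v = (θ (f x)).symm (θ x v) := by
      change (θ (f x)).symm (P x (θ x v)) = _
      rw [hPfix x hx]
    rw [h1]
    exact key _ hx
  have hcψ : ∀ x, f x = x → ∀ v, (⟨f x, c • ψ x v⟩ : Bundle.TotalSpace F V) = ⟨x, v⟩ := by
    intro x hx v
    rw [← hχ x hx v, ← hψT, hc, map_smul]
  have hsq : ∀ x, f x = x → ∀ v : V x, (c * c) • v = v := by
    intro x hx v
    have key : ∀ y (w : V y), (⟨y, c • w⟩ : Bundle.TotalSpace F V) = ⟨x, v⟩ →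
        (⟨f y, c • ψ y (c • w)⟩ : Bundle.TotalSpace F V) = ⟨f x, c • ψ x v⟩ := by
      intro y w h
      exact congrArg (fun p : Bundle.TotalSpace F V =>
        (⟨f p.1, c • ψ p.1 p.2⟩ : Bundle.TotalSpace F V)) h
    have h1 := key _ _ (hcψ x hx v)
    rw [hcψ x hx, map_smul, ← mul_smul] at h1
    have h2 := hψ.apply_apply x v
    have h3 := congrArg (fun p : Bundle.TotalSpace F V =>
        (⟨p.1, (c * c) • p.2⟩ : Bundle.TotalSpace F V)) h2
    exact Bundle.TotalSpace.snd_eq (F := F) (h3.symm.trans h1)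
  by_cases h1 : c = 1
  · left
    intro x hx v
    have := hcψ x hx v
    rwa [h1, one_smul] at this
  · right
    intro x hx v
    by_cases h2 : c = -1
    · have := hcψ x hx v
      rw [h2, neg_one_smul] at this
      exact this
    -- If c is neither 1 nor -1, the fibre over a fixed point is zero, and there the condition holds
    -- trivially.
    · have hzero : ∀ w : V x, w = 0 := by
        intro w
        have h3 : (c * c - 1) • w = 0 := by rw [sub_smul, hsq x hx w, one_smul, sub_self]
        refine (smul_eq_zero.1 h3).resolve_left fun h4 => ?_
        have h5 : (c - 1) * (c + 1) = 0 := by linear_combination h4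
        rcases mul_eq_zero.1 h5 with h | h
        · exact h1 (sub_eq_zero.1 h)
        · exact h2 (eq_neg_of_add_eq_zero_left h)
      have key : ∀ y, y = x → ∀ w : V y, (⟨y, w⟩ : Bundle.TotalSpace F V) = ⟨x, v⟩ := by
        rintro y rfl w
        rw [hzero w, hzero v]
      exact key _ hx _

end

/-! ### Continuous frames of equivariant bundles -/

/-- The linear automorphism given by an invertible endomorphism. -/
noncomputable def IsUnit.toLinearEquiv {F : Type*} [NormedAddCommGroup F] [NormedSpace ℂ F]
    {L : F →L[ℂ] F} (h : IsUnit L) : F ≃ₗ[ℂ] F :=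
  (ContinuousLinearEquiv.unitsEquiv ℂ F h.unit).toLinearEquiv

theorem LinearEquiv.isUnit_toContinuousLinearMap {F : Type*} [NormedAddCommGroup F]
    [NormedSpace ℂ F] [FiniteDimensional ℂ F] (e : F ≃ₗ[ℂ] F) :
    IsUnit (LinearMap.toContinuousLinearMap (e : F →ₗ[ℂ] F)) :=
  ⟨(ContinuousLinearEquiv.unitsEquiv ℂ F).symm e.toContinuousLinearEquiv, rfl⟩

theorem ContinuousWithinAt.clm_inverse {Z F : Type*} [TopologicalSpace Z] [NormedAddCommGroup F]
    [NormedSpace ℂ F] [FiniteDimensional ℂ F] {L : Z → F →L[ℂ] F} {B : Set Z} {z : Z}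
    (hL : ContinuousWithinAt L B z) (hb : IsUnit (L z)) :
    ContinuousWithinAt (fun y => ContinuousLinearMap.inverse (L y)) B z := by
  let M : F ≃L[ℂ] F := ContinuousLinearEquiv.unitsEquiv ℂ F hb.unit
  have hM : (M : F →L[ℂ] F) = L z := by ext v; rfl
  have h1 : ContinuousAt (ContinuousLinearMap.inverse : (F →L[ℂ] F) → _) (M : F →L[ℂ] F) :=
    (contDiffAt_map_inverse (𝕜 := ℂ) (n := 0) M).continuousAt
  rw [hM] at h1
  exact h1.comp_continuousWithinAt hL

namespace EqBundle

variable {X : Type*} [TopologicalSpace X] {f : TopInvolution X} (V : EqBundle f)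

/-- The sections of the frame `e` are continuous at `x` within `B`. -/
def FrameWithinAt (e : ∀ x, V.F ≃ₗ[ℂ] V.E x) (B : Set X) (x : X) : Prop :=
  ∀ v, ContinuousWithinAt (fun y => (⟨y, e y v⟩ : Bundle.TotalSpace V.F V.E)) B x

/-- The frame `e` is continuous on `B`. -/
def FrameOn (e : ∀ x, V.F ≃ₗ[ℂ] V.E x) (B : Set X) : Prop :=
  ∀ x ∈ B, V.FrameWithinAt e B x

/-- The frame `e` is compatible with the lift. -/
def Equivariant (e : ∀ x, V.F ≃ₗ[ℂ] V.E x) (B : Set X) : Prop :=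
  ∀ x ∈ B, ∀ v, e (f x) v = V.φ x (e x v)

variable {V}

theorem FrameWithinAt.mono {e : ∀ x, V.F ≃ₗ[ℂ] V.E x} {B B' : Set X} {x : X}
    (h : V.FrameWithinAt e B x) (hB : B' ⊆ B) : V.FrameWithinAt e B' x :=
  fun v => (h v).mono hB

/-- The matrix of the frame `e` in the preferred trivialization at `x`. -/
noncomputable def frameMatrix (e : ∀ x, V.F ≃ₗ[ℂ] V.E x) (x y : X) : V.F →L[ℂ] V.F :=
  LinearMap.toContinuousLinearMap
    ((trivializationAt V.F V.E x).linearMapAt ℂ y ∘ₗ (e y : V.F →ₗ[ℂ] V.E y))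

theorem frameMatrix_apply (e : ∀ x, V.F ≃ₗ[ℂ] V.E x) (x : X) {y : X}
    (hy : y ∈ (trivializationAt V.F V.E x).baseSet) (v : V.F) :
    frameMatrix e x y v = (trivializationAt V.F V.E x ⟨y, e y v⟩).2 := by
  change (trivializationAt V.F V.E x).linearMapAt ℂ y (e y v) = _
  rw [(trivializationAt V.F V.E x).linearMapAt_apply, if_pos hy]

theorem isUnit_frameMatrix (e : ∀ x, V.F ≃ₗ[ℂ] V.E x) (x : X) {y : X}
    (hy : y ∈ (trivializationAt V.F V.E x).baseSet) : IsUnit (frameMatrix e x y) := by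
  have h := ((e y).trans
    ((trivializationAt V.F V.E x).linearEquivAt ℂ y hy)).isUnit_toContinuousLinearMap
  convert h using 1
  ext v
  exact frameMatrix_apply e x hy v

theorem continuousWithinAt_section_iff {s : ∀ x, V.E x} {B : Set X} {x : X} :
    ContinuousWithinAt (fun y => (⟨y, s y⟩ : Bundle.TotalSpace V.F V.E)) B x ↔
      ContinuousWithinAt (fun y => (trivializationAt V.F V.E x ⟨y, s y⟩).2) B x := by
  rw [FiberBundle.continuousWithinAt_totalSpace]
  exact ⟨fun h => h.2, fun h => ⟨continuousWithinAt_id, h⟩⟩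

theorem eventually_baseSet (B : Set X) (x : X) :
    ∀ᶠ y in 𝓝[B] x, y ∈ (trivializationAt V.F V.E x).baseSet :=
  nhdsWithin_le_nhds ((trivializationAt V.F V.E x).open_baseSet.mem_nhds
    (FiberBundle.mem_baseSet_trivializationAt V.F V.E x))

theorem FrameWithinAt.frameMatrix {e : ∀ x, V.F ≃ₗ[ℂ] V.E x} {B : Set X} {x : X}
    (h : V.FrameWithinAt e B x) : ContinuousWithinAt (frameMatrix e x) B x := by
  have hx := FiberBundle.mem_baseSet_trivializationAt V.F V.E x
  rw [continuousWithinAt_clm_apply]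
  intro v
  refine (continuousWithinAt_section_iff.1 (h v)).congr_of_eventuallyEq ?_
    (frameMatrix_apply e x hx v)
  filter_upwards [eventually_baseSet B x] with y hy using frameMatrix_apply e x hy v

/-- Continuity of a section, tested in a frame. -/
theorem FrameWithinAt.section_iff {e : ∀ x, V.F ≃ₗ[ℂ] V.E x} {B : Set X} {x : X}
    (h : V.FrameWithinAt e B x) (a : X → V.F) :
    ContinuousWithinAt (fun y => (⟨y, e y (a y)⟩ : Bundle.TotalSpace V.F V.E)) B x ↔
      ContinuousWithinAt a B x := by
  have hx := FiberBundle.mem_baseSet_trivializationAt V.F V.E x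
  have heq : (fun y => (trivializationAt V.F V.E x ⟨y, e y (a y)⟩).2) =ᶠ[𝓝[B] x]
      fun y => EqBundle.frameMatrix e x y (a y) := by
    filter_upwards [eventually_baseSet B x] with y hy using (frameMatrix_apply e x hy _).symm
  have heqx := (frameMatrix_apply e x hx (a x)).symm
  rw [continuousWithinAt_section_iff, heq.congr_continuousWithinAt heqx]
  refine ⟨fun h1 => ?_, fun h1 => h.frameMatrix.clm_apply h1⟩
  have hinv : ∀ y ∈ (trivializationAt V.F V.E x).baseSet,
      a y = ContinuousLinearMap.inverse (EqBundle.frameMatrix e x y)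
        (EqBundle.frameMatrix e x y (a y)) := by
    intro y hy
    let M : V.F ≃L[ℂ] V.F := ContinuousLinearEquiv.unitsEquiv ℂ V.F (isUnit_frameMatrix e x hy).unit
    have hM : (M : V.F →L[ℂ] V.F) = EqBundle.frameMatrix e x y := by ext v; rfl
    rw [← hM, ContinuousLinearMap.inverse_equiv]
    exact (M.symm_apply_apply _).symm
  refine ((h.frameMatrix.clm_inverse (isUnit_frameMatrix e x hx)).clm_apply h1).congr_of_eventuallyEq
    ?_ (hinv x hx)
  filter_upwards [eventually_baseSet B x] with y hy using hinv y hy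

/-- The transition function between two frames. -/
noncomputable def transition (e e' : ∀ x, V.F ≃ₗ[ℂ] V.E x) (x : X) : V.F →L[ℂ] V.F :=
  LinearMap.toContinuousLinearMap (((e' x).trans (e x).symm : V.F ≃ₗ[ℂ] V.F) : V.F →ₗ[ℂ] V.F)

theorem apply_transition (e e' : ∀ x, V.F ≃ₗ[ℂ] V.E x) (x : X) (v : V.F) :
    e x (transition e e' x v) = e' x v := (e x).apply_symm_apply _

theorem isUnit_transition (e e' : ∀ x, V.F ≃ₗ[ℂ] V.E x) (x : X) : IsUnit (transition e e' x) :=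
  LinearEquiv.isUnit_toContinuousLinearMap _

theorem FrameWithinAt.transition {e e' : ∀ x, V.F ≃ₗ[ℂ] V.E x} {B : Set X} {x : X}
    (h : V.FrameWithinAt e B x) (h' : V.FrameWithinAt e' B x) :
    ContinuousWithinAt (transition e e') B x := by
  rw [continuousWithinAt_clm_apply]
  intro v
  refine (h.section_iff _).1 ?_
  simp only [apply_transition]
  exact h' v

theorem FrameWithinAt.of_apply {e e' : ∀ x, V.F ≃ₗ[ℂ] V.E x} {B : Set X} {x : X}
    (h : V.FrameWithinAt e B x) {g : X → V.F →L[ℂ] V.F} (hg : ContinuousWithinAt g B x)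
    (he : ∀ y ∈ B, ∀ v, e' y v = e y (g y v)) (hx : x ∈ B) : V.FrameWithinAt e' B x := by
  intro v
  have h1 := (h.section_iff (fun y => g y v)).2 (hg.clm_apply continuousWithinAt_const)
  refine h1.congr_of_eventuallyEq ?_ (by rw [he x hx])
  filter_upwards [self_mem_nhdsWithin] with y hy
  rw [he y hy]

theorem FrameWithinAt.congr {e e' : ∀ x, V.F ≃ₗ[ℂ] V.E x} {B : Set X} {x : X}
    (h : V.FrameWithinAt e B x) (he : ∀ y ∈ B, ∀ v, e' y v = e y v) (hx : x ∈ B) :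
    V.FrameWithinAt e' B x := fun v => (h v).congr (fun y hy => by rw [he y hy]) (by rw [he x hx])

variable (V) in
theorem exists_linearEquiv (x : X) : Nonempty (V.F ≃ₗ[ℂ] V.E x) :=
  ⟨((trivializationAt V.F V.E x).linearEquivAt ℂ x
    (FiberBundle.mem_baseSet_trivializationAt V.F V.E x)).symm⟩

variable (V) in
theorem exists_frame (x₀ : X) : ∃ U : Set X, IsOpen U ∧ x₀ ∈ U ∧ ∃ e : ∀ x, V.F ≃ₗ[ℂ] V.E x,
    V.FrameOn e U := by
  classical
  let t := trivializationAt V.F V.E x₀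
  refine ⟨t.baseSet, t.open_baseSet, FiberBundle.mem_baseSet_trivializationAt V.F V.E x₀,
    fun x => if h : x ∈ t.baseSet then (t.linearEquivAt ℂ x h).symm else
      (V.exists_linearEquiv x).some, fun x hx v => ?_⟩
  refine ContinuousAt.continuousWithinAt ?_
  have h1 : ContinuousAt (fun y => t.toOpenPartialHomeomorph.symm (y, v)) x :=
    (t.toOpenPartialHomeomorph.continuousAt_symm (by
      rw [t.target_eq]; exact ⟨hx, Set.mem_univ _⟩)).comp (by fun_prop)
  refine h1.congr ?_
  filter_upwards [t.open_baseSet.mem_nhds hx] with y hy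
  rw [dif_pos hy]
  exact (t.mk_symm hy v).symm

/-- The transported frame is continuous. -/
theorem FrameOn.transport {e e' : ∀ x, V.F ≃ₗ[ℂ] V.E x} {B : Set X} (h : V.FrameOn e B)
    (he : ∀ x v, e' (f x) v = V.φ x (e x v)) : V.FrameOn e' (f ⁻¹' B) := by
  intro x hx v
  have h1 := (h (f x) hx v).comp (f.continuous_toFun.continuousWithinAt (s := f ⁻¹' B) (x := x))
    (fun y hy => hy)
  have h2 := V.continuous_φ.continuousAt.comp_continuousWithinAt h1
  have key : ∀ y z, f z = y → (⟨f z, V.φ z (e z v)⟩ : Bundle.TotalSpace V.F V.E) = ⟨y, e' y v⟩ := by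
    rintro _ z rfl
    rw [he]
  exact h2.congr (fun y _ => (key y (f y) (f.involutive y)).symm)
    (key x (f x) (f.involutive x)).symm

/-- Around every point there is an equivariant frame, if the lift is the identity over the fixed
points. -/
theorem exists_equivariant_frame [T2Space X] (hfix : FixesFibres f V.F V.φ) (x₀ : X) :
    ∃ U : Set X, IsOpen U ∧ x₀ ∈ U ∧ (∀ x ∈ U, f x ∈ U) ∧ ∃ e : ∀ x, V.F ≃ₗ[ℂ] V.E x,
      V.FrameOn e U ∧ V.Equivariant e U := by
  classical
  obtain ⟨U, hU, hxU, e, he⟩ := V.exists_frame x₀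
  obtain ⟨e', he'⟩ := V.isLift.exists_frame e
  have hpar' : V.FrameOn e' (f ⁻¹' U) := he.transport he'
  by_cases hx : f x₀ = x₀
  · have hbase : ∀ v, e' x₀ v = e x₀ v := by
      intro v
      have h1 := hfix x₀ hx (e x₀ v)
      rw [← he'] at h1
      have key : ∀ y, y = x₀ → (⟨y, e' y v⟩ : Bundle.TotalSpace V.F V.E) = ⟨x₀, e' x₀ v⟩ := by
        rintro y rfl; rfl
      rw [key _ hx] at h1
      exact Bundle.TotalSpace.snd_eq h1
    -- symmetrize the frame
    let B : Set X := U ∩ f ⁻¹' U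
    have hB : IsOpen B := hU.inter (hU.preimage f.continuous_toFun)
    have hxB : x₀ ∈ B := ⟨hxU, by rw [Set.mem_preimage, hx]; exact hxU⟩
    -- The frame e followed by g is the average of e and its transport e'. The lift exchanges the
    -- two, so the average is equivariant; it is a frame near x₀ because e = e' at x₀ makes g equal
    -- to 1 there.
    let g : X → V.F →L[ℂ] V.F := fun x => (2⁻¹ : ℂ) • (1 + transition e e' x)
    have hg : ∀ x ∈ B, ContinuousWithinAt g B x := by
      intro x hx
      have h1 : ContinuousWithinAt (fun x => 1 + transition e e' x) B x :=
        continuousWithinAt_const.add (((he x hx.1).mono Set.inter_subset_left).transition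
          ((hpar' x hx.2).mono Set.inter_subset_right))
      exact h1.const_smul (2⁻¹ : ℂ)
    have hg0 : g x₀ = 1 := by
      have : transition e e' x₀ = 1 := by
        ext v
        apply (e x₀).injective
        rw [apply_transition, hbase]
        rfl
      simp only [g, this]
      rw [← two_smul ℂ (1 : V.F →L[ℂ] V.F), smul_smul]
      norm_num
    have hunit : ∀ᶠ x in 𝓝 x₀, IsUnit (g x) := by
      have h1 : ContinuousAt g x₀ := (hg x₀ hxB).continuousAt (hB.mem_nhds hxB)
      refine h1.eventually ?_
      rw [hg0]
      exact Units.isOpen.mem_nhds isUnit_one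
    obtain ⟨N, hN, hNo, hxN⟩ := eventually_nhds_iff.1 hunit
    let e'' : ∀ x, V.F ≃ₗ[ℂ] V.E x := fun x =>
      if h : IsUnit (g x) then h.toLinearEquiv.trans (e x) else e x
    have he'' : ∀ x ∈ N, ∀ v, e'' x v = e x (g x v) := by
      intro x hx v
      simp only [e'', dif_pos (hN x hx)]
      rfl
    have hsum : ∀ x ∈ N, ∀ v, e'' x v = (2⁻¹ : ℂ) • (e x v + e' x v) := by
      intro x hx v
      rw [he'' x hx]
      change e x ((2⁻¹ : ℂ) • (v + transition e e' x v)) = _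
      rw [map_smul, map_add, apply_transition]
    refine ⟨B ∩ (N ∩ f ⁻¹' N), hB.inter (hNo.inter (hNo.preimage f.continuous_toFun)),
      ⟨hxB, hxN, by rw [Set.mem_preimage, hx]; exact hxN⟩, ?_, e'', ?_, ?_⟩
    · rintro x ⟨⟨h1, h2⟩, h3, h4⟩
      refine ⟨⟨h2, ?_⟩, h4, ?_⟩ <;> rw [Set.mem_preimage, f.involutive x] <;> assumption
    · intro x hx
      exact ((he x hx.1.1).mono (Set.inter_subset_left.trans Set.inter_subset_left)).of_apply
        ((hg x hx.1).mono Set.inter_subset_left) (fun y hy v => he'' y hy.2.1 v) hx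
    · rintro x ⟨-, h3, h4⟩ v
      rw [hsum x h3, hsum (f x) h4, map_smul, map_add, he', V.isLift.apply_frame he', add_comm]
  · obtain ⟨W, hWU, hWo, hxW, hW⟩ := f.exists_isOpen_disjoint hx (hU.mem_nhds hxU)
    refine ⟨W ∪ f ⁻¹' W, hWo.union (hWo.preimage f.continuous_toFun), Or.inl hxW, ?_,
      fun x => if x ∈ W then e x else e' x, ?_, ?_⟩
    · rintro x (h | h)
      · right
        rw [Set.mem_preimage, f.involutive x]
        exact h
      · exact Or.inl h
    · rintro x (h | h) v
      · have h1 := (he x (hWU h) v).continuousAt (hU.mem_nhds (hWU h))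
        refine (h1.congr ?_).continuousWithinAt
        filter_upwards [hWo.mem_nhds h] with y hy
        simp [hy]
      · have h1 := (hpar' x (hWU h) v).continuousAt
          ((hU.preimage f.continuous_toFun).mem_nhds (hWU h))
        refine (h1.congr ?_).continuousWithinAt
        filter_upwards [(hWo.preimage f.continuous_toFun).mem_nhds h] with y hy
        have hy' : y ∉ W := fun hy' => hW y hy' hy
        simp [hy']
    · rintro x (h | h) v
      · simp only [h, if_true, hW x h, if_false, he']
      · have hxW' : x ∉ W := fun hx => hW x hx h
        have h' : f x ∈ W := h
        simp only [h', if_true, hxW', if_false]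
        exact V.isLift.apply_frame he' x v

/-- Replacing an equivariant frame `e'` over `A \ S` by another one over the closed set `C`. -/
theorem glue_frames {A C O S Q U : Set X} (hA : IsClosed A) (hC : IsClosed C) (hO : IsOpen O)
    (hOC : O ⊆ C) (hCU : C ⊆ U) (hCf : ∀ x, f x ∈ C ↔ x ∈ C)
    (hQf : ∀ x, f x ∈ Q ↔ x ∈ Q)
    (hSC : ∀ x ∈ S, x ∈ C → x ∈ O)
    {e e' : ∀ x, V.F ≃ₗ[ℂ] V.E x} (he : V.FrameOn e U) (heq : V.Equivariant e U)
    (he' : V.FrameOn e' (A \ S)) (heq' : V.Equivariant e' (A \ S))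
    {G : X → V.F →L[ℂ] V.F} (hG : ContinuousOn G (C \ Q)) (hGu : ∀ x ∈ C \ Q, IsUnit (G x))
    (hGf : ∀ x ∈ C, G (f x) = G x)
    (hGA : ∀ x ∈ A, x ∈ C → x ∉ O → G x = transition e e' x) :
    ∃ e'' : ∀ x, V.F ≃ₗ[ℂ] V.E x, V.FrameOn e'' ((A ∪ C) \ (S \ C ∪ Q)) ∧
      V.Equivariant e'' ((A ∪ C) \ (S \ C ∪ Q)) := by
  classical
  -- On C the frame becomes e G, off C it stays e'. The set Q contains the singularities of G, and O
  -- is an open part of C over which e' is discarded; outside O the matrix G is the transition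
  -- function, so e G = e' there.
  let e'' : ∀ x, V.F ≃ₗ[ℂ] V.E x := fun x =>
    if x ∈ C then (if h : IsUnit (G x) then h.toLinearEquiv.trans (e x) else e x) else e' x
  have hC'' : ∀ x ∈ C \ Q, ∀ v, e'' x v = e x (G x v) := by
    intro x hx v
    simp only [e'', if_pos hx.1, dif_pos (hGu x hx)]
    rfl
  have hnC : ∀ x, x ∉ C → ∀ v, e'' x v = e' x v := fun x hx v => by simp only [e'', if_neg hx]
  have hQ : ∀ x ∈ (A ∪ C) \ (S \ C ∪ Q), x ∈ C → x ∈ C \ Q := fun x hx hxC =>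
    ⟨hxC, fun h => hx.2 (Or.inr h)⟩
  have hAS : ∀ x ∈ (A ∪ C) \ (S \ C ∪ Q), x ∉ C → x ∈ A \ S := fun x hx hxC =>
    ⟨hx.1.resolve_right hxC, fun h => hx.2 (Or.inl ⟨h, hxC⟩)⟩
  have hP2 : ∀ x ∈ (A \ S) \ (O ∪ Q), ∀ v, e'' x v = e' x v := by
    intro x hx v
    by_cases hxC : x ∈ C
    · rw [hC'' x ⟨hxC, fun h => hx.2 (Or.inr h)⟩, hGA x hx.1.1 hxC fun h => hx.2 (Or.inl h),
        apply_transition]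
    · exact hnC x hxC v
  -- A point of the new domain which lies in the closure of one of the two pieces belongs to that
  -- piece, so continuity may be tested on each piece separately.
  have hcover : (A ∪ C) \ (S \ C ∪ Q) ⊆ C \ Q ∪ (A \ S) \ (O ∪ Q) := by
    intro x hx
    by_cases hxC : x ∈ C
    · exact Or.inl (hQ x hx hxC)
    · exact Or.inr ⟨hAS x hx hxC, fun h => h.elim (fun h => hxC (hOC h)) fun h => hx.2 (Or.inr h)⟩
  refine ⟨e'', fun x hx v => ?_, fun x hx v => ?_⟩
  · refine ContinuousWithinAt.mono ?_ hcover
    refine ContinuousWithinAt.union ?_ ?_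
    · by_cases hxC : x ∈ C
      · have h1 := hQ x hx hxC
        exact ((he x (hCU hxC)).mono (Set.sdiff_subset.trans hCU)).of_apply (hG x h1)
          (fun y hy v => hC'' y hy v) h1 v
      · refine continuousWithinAt_of_notMem_closure fun h => hxC ?_
        exact hC.closure_subset_iff.2 Set.sdiff_subset h
    · by_cases hx2 : x ∈ (A \ S) \ (O ∪ Q)
      · exact ((he' x hx2.1).mono Set.sdiff_subset).congr hP2 hx2 v
      · refine continuousWithinAt_of_notMem_closure fun h => hx2 ?_
        have hxA : x ∈ A := hA.closure_subset_iff.2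
          (Set.sdiff_subset.trans Set.sdiff_subset) h
        have hxO : x ∉ O := by
          intro hxO
          obtain ⟨y, hy1, hy2⟩ := mem_closure_iff.1 h O hO hxO
          exact hy2.2 (Or.inl hy1)
        have hxS : x ∉ S := by
          intro hxS
          by_cases hxC : x ∈ C
          · exact hxO (hSC x hxS hxC)
          · exact hx.2 (Or.inl ⟨hxS, hxC⟩)
        exact ⟨⟨hxA, hxS⟩, fun h => h.elim hxO fun h => hx.2 (Or.inr h)⟩
  · by_cases hxC : x ∈ C
    · have h1 := hQ x hx hxC
      have h2 : f x ∈ C \ Q := ⟨(hCf x).2 hxC, fun h => h1.2 ((hQf x).1 h)⟩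
      rw [hC'' x h1, hC'' (f x) h2, hGf x hxC, heq x (hCU hxC)]
    · have h2 : f x ∉ C := fun h => hxC ((hCf x).1 h)
      rw [hnC x hxC, hnC (f x) h2, heq' x (hAS x hx hxC)]

end EqBundle

/-! ### Extension of families of invertible endomorphisms -/

section

variable {F : Type*} [NormedAddCommGroup F] [NormedSpace ℂ F] [FiniteDimensional ℂ F]

theorem ContinuousLinearMap.finite_spectrum (C : F →L[ℂ] F) : (spectrum ℂ C).Finite := by
  have h := Module.End.finite_spectrum ((Module.End.toContinuousLinearMap F (𝕜 := ℂ)).symm C)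
  rwa [AlgEquiv.spectrum_eq] at h

/-- Invertible endomorphisms can be joined by paths. -/
theorem exists_path_isUnit {A B : F →L[ℂ] F} (hA : IsUnit A) (hB : IsUnit B) :
    ∃ p : ℝ → F →L[ℂ] F, Continuous p ∧ p 0 = A ∧ p 1 = B ∧ ∀ t, IsUnit (p t) := by
  obtain ⟨a, rfl⟩ := hA
  obtain ⟨C, hC⟩ : ∃ C : F →L[ℂ] F, C = ↑a⁻¹ * B - 1 := ⟨_, rfl⟩
  have haC : ∀ z : ℂ, (a : F →L[ℂ] F) + z • (B - a) = a * (1 + z • C) := by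
    intro z
    rw [hC, mul_add, mul_one, mul_smul_comm, mul_sub, mul_one, ← mul_assoc, Units.mul_inv, one_mul]
  -- On the complex line through A and B, invertibility fails only at finitely many parameters, of
  -- the form -1/λ with λ an eigenvalue of A⁻¹B - 1. The complement of a finite set in ℂ is path
  -- connected.
  let S : Set ℂ := (fun l : ℂ => -l⁻¹) '' spectrum ℂ C
  have hS : S.Finite := C.finite_spectrum.image _
  have hunit : ∀ z ∉ S, IsUnit ((a : F →L[ℂ] F) + z • (B - a)) := by
    intro z hz
    rw [haC]
    refine a.isUnit.mul ?_
    by_cases hz0 : z = 0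
    · simp [hz0]
    by_contra hcon
    refine hz ⟨-z⁻¹, ?_, by simp⟩
    rw [spectrum.mem_iff]
    intro h1
    apply hcon
    have h2 : (1 : F →L[ℂ] F) + z • C =
        (-z) • (algebraMap ℂ (F →L[ℂ] F) (-z⁻¹) - C) := by
      rw [Algebra.algebraMap_eq_smul_one, smul_sub (-z), smul_smul, neg_mul_neg, mul_inv_cancel₀ hz0,
        one_smul, neg_smul, sub_neg_eq_add]
    rw [h2]
    have h3 : IsUnit (Units.mk0 (-z) (neg_ne_zero.2 hz0) • (algebraMap ℂ (F →L[ℂ] F) (-z⁻¹) - C)) :=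
      h1.smul _
    exact h3
  -- points `0` and `1` may lie in `S` only if the corresponding element is still a unit
  have hpc : IsPathConnected (S \ {0, 1})ᶜ :=
    ((hS.subset Set.sdiff_subset).countable).isPathConnected_compl_of_one_lt_rank
      (by rw [Complex.rank_real_complex]; norm_num)
  have hunit' : ∀ z ∈ (S \ {0, 1})ᶜ, IsUnit ((a : F →L[ℂ] F) + z • (B - a)) := by
    intro z hz
    by_cases h0 : z = 0
    · simp [h0]
    by_cases h1 : z = 1
    · simpa [h1] using hB
    exact hunit z fun h => hz ⟨h, by simp [h0, h1]⟩
  obtain ⟨γ, hγ⟩ := hpc.joinedIn 0 (by simp) 1 (by simp)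
  refine ⟨fun t => a + γ.extend t • (B - a), by fun_prop, by simp, by simp, fun t => hunit' _ ?_⟩
  exact hγ _

/-- A continuous family of invertible endomorphisms over a closed subset of an interval extends
to the interval. -/
theorem exists_isUnit_extension {a b : ℝ} {K : Set ℝ} (hK : IsClosed K) (hKab : K ⊆ Set.Icc a b)
    {g : ℝ → F →L[ℂ] F} (hg : ContinuousOn g K) (hu : ∀ t ∈ K, IsUnit (g t)) :
    ∃ h : ℝ → F →L[ℂ] F, Continuous h ∧ (∀ t ∈ Set.Icc a b, IsUnit (h t)) ∧
      ∀ t ∈ K, h t = g t := by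
  classical
  have : TietzeExtension (F →L[ℂ] F) := TietzeExtension.of_tvs ℂ
  obtain ⟨h₀, hh₀⟩ := ContinuousMap.exists_restrict_eq hK ⟨K.domRestrict g, hg.domRestrict⟩
  have hh₀' : ∀ t ∈ K, h₀ t = g t := fun t ht =>
    congrArg (fun φ : C(K, F →L[ℂ] F) => φ ⟨t, ht⟩) hh₀
  have hUo : IsOpen {t | IsUnit (h₀ t)} := Units.isOpen.preimage h₀.continuous
  have hKc : IsCompact K := isCompact_Icc.of_isClosed_subset hK hKab
  obtain ⟨ε, hε, hεU⟩ := hKc.exists_thickening_subset_open hUo fun t ht => by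
    rw [Set.mem_ofPred_eq, hh₀' t ht]; exact hu t ht
  have hclose : ∀ t ∈ K, ∀ s, |s - t| < ε → IsUnit (h₀ s) := fun t ht s hs =>
    hεU (Metric.mem_thickening_iff.2 ⟨t, ht, hs⟩)
  -- The values at the nodes of a subdivision are fixed beforehand: the Tietze extension where it is
  -- invertible, otherwise 1. Pieces constructed on consecutive intervals then match.
  let w : ℝ → F →L[ℂ] F := fun s => if IsUnit (h₀ s) then h₀ s else 1
  have hw : ∀ s, IsUnit (w s) := by
    intro s
    by_cases h : IsUnit (h₀ s)
    · simp [w, h]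
    · simp [w, h]
  -- An interval of length δ that meets K lies within distance ε of K, where the Tietze extension is
  -- invertible and is used. On an interval not meeting K, any path of invertible maps between the
  -- node values will do.
  set δ := ε / 2 with hδ
  have hδ0 : 0 < δ := by positivity
  have key : ∀ n : ℕ, ∃ h : ℝ → F →L[ℂ] F, Continuous h ∧
      (∀ t ∈ Set.Icc a (a + n * δ), IsUnit (h t)) ∧ (∀ t ∈ K, t ≤ a + n * δ → h t = g t) ∧
      h (a + n * δ) = w (a + n * δ) := by
    intro n
    induction n with
    | zero =>
      refine ⟨fun _ => w a, continuous_const, fun _ _ => hw a, fun t ht hta => ?_, by simp⟩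
      have h1 : t = a := le_antisymm (by simpa using hta) (hKab ht).1
      subst h1
      have h2 : IsUnit (h₀ t) := by rw [hh₀' t ht]; exact hu t ht
      have h3 : w t = h₀ t := if_pos h2
      rw [h3, hh₀' t ht]
    | succ n ih =>
      obtain ⟨h, hc, hhu, hhg, hhw⟩ := ih
      set s := a + n * δ with hs
      have hs' : a + (n + 1 : ℕ) * δ = s + δ := by push_cast; ring
      rw [hs']
      obtain ⟨p, hp, hps, hpw, hpu, hpg⟩ : ∃ p : ℝ → F →L[ℂ] F, Continuous p ∧ p s = w s ∧
          p (s + δ) = w (s + δ) ∧ (∀ t ∈ Set.Icc s (s + δ), IsUnit (p t)) ∧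
          ∀ t ∈ K, t ∈ Set.Icc s (s + δ) → p t = g t := by
        by_cases hmeet : ∃ t ∈ K, t ∈ Set.Icc s (s + δ)
        · obtain ⟨t, htK, ht⟩ := hmeet
          have hnear : ∀ t' ∈ Set.Icc s (s + δ), IsUnit (h₀ t') := fun t' ht' =>
            hclose t htK t' (by
              rw [abs_lt]
              constructor <;> linarith [ht.1, ht.2, ht'.1, ht'.2])
          have h1 := hnear s ⟨le_rfl, by linarith⟩
          have h2 := hnear (s + δ) ⟨by linarith, le_rfl⟩
          exact ⟨h₀, h₀.continuous, by simp [w, h1], by simp [w, h2], hnear,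
            fun t' ht' _ => hh₀' t' ht'⟩
        · obtain ⟨p, hp, hp0, hp1, hpu⟩ := exists_path_isUnit (hw s) (hw (s + δ))
          refine ⟨fun t => p ((t - s) / δ), by fun_prop, by simp [hp0], ?_, fun t _ => hpu _,
            fun t ht ht' => absurd ⟨t, ht, ht'⟩ hmeet⟩
          have : (s + δ - s) / δ = 1 := by rw [add_sub_cancel_left, div_self hδ0.ne']
          simp only [this, hp1]
      refine ⟨fun t => if t ≤ s then h t else p t,
        hc.if_le hp continuous_id continuous_const fun t ht => by
          have h3 : t = s := ht
          rw [h3, hhw, hps], fun t ht => ?_, fun t htK ht => ?_, ?_⟩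
      · by_cases h3 : t ≤ s
        · simpa [h3] using hhu t ⟨ht.1, h3⟩
        · simpa [h3] using hpu t ⟨(not_le.1 h3).le, ht.2⟩
      · by_cases h3 : t ≤ s
        · simpa [h3] using hhg t htK h3
        · simpa [h3] using hpg t htK ⟨(not_le.1 h3).le, ht⟩
      · have h3 : ¬ s + δ ≤ s := by linarith
        simpa [h3] using hpw
  obtain ⟨n, hn⟩ := exists_nat_gt ((b - a) / δ)
  obtain ⟨h, hc, hhu, hhg, -⟩ := key n
  have hnb : b ≤ a + n * δ := by
    rw [div_lt_iff₀ hδ0] at hn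
    linarith
  exact ⟨h, hc, fun t ht => hhu t ⟨ht.1, ht.2.trans hnb⟩,
    fun t ht => hhg t ht ((hKab ht).2.trans hnb)⟩

theorem mem_sphere_zero_iff_sq {r : ℝ} (hr : 0 < r) {z : ℂ} :
    z ∈ Metric.sphere (0 : ℂ) r ↔ z.re ^ 2 + z.im ^ 2 = r ^ 2 := by
  have h2 := Complex.sq_norm_sub_sq_re z
  rw [mem_sphere_zero_iff_norm]
  constructor
  · intro h; rw [← h]; linarith
  · intro h
    have h1 : ‖z‖ ^ 2 = r ^ 2 := by linarith
    exact (sq_eq_sq₀ (norm_nonneg z) hr.le).1 h1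

/-- The extension over an arc of a circle, parametrized by the real part; `s` is the sign of the
imaginary part. -/
theorem exists_isUnit_extension_arc {r : ℝ} (hr : 0 < r) (s : ℝ) (hs : s = 1 ∨ s = -1) {K : Set ℂ}
    (hK : IsClosed K) {g : ℂ → F →L[ℂ] F} (hg : ContinuousOn g (K ∩ Metric.sphere 0 r))
    (hu : ∀ z ∈ K ∩ Metric.sphere 0 r, IsUnit (g z)) :
    ∃ h : ℝ → F →L[ℂ] F, Continuous h ∧ (∀ t ∈ Set.Icc (-r) r, IsUnit (h t)) ∧
      ∀ z ∈ K ∩ Metric.sphere 0 r, 0 ≤ s * z.im → h z.re = g z := by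
  let c : ℝ → ℂ := fun x => ⟨x, s * √(r ^ 2 - x ^ 2)⟩
  have hc : Continuous c := by
    have h1 : Continuous fun x : ℝ => s * √(r ^ 2 - x ^ 2) := by fun_prop
    have h2 : c = fun x : ℝ => Complex.ofReal x +
        Complex.ofReal ((fun x : ℝ => s * √(r ^ 2 - x ^ 2)) x) * Complex.I := by
      funext x
      apply Complex.ext <;> simp [c]
    rw [h2]
    exact Complex.continuous_ofReal.add
      ((Complex.continuous_ofReal.comp h1).mul continuous_const)
  have hs2 : s ^ 2 = 1 := by rcases hs with rfl | rfl <;> norm_num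
  have hcs : ∀ x ∈ Set.Icc (-r) r, c x ∈ Metric.sphere (0 : ℂ) r := by
    intro x hx
    rw [mem_sphere_zero_iff_sq hr]
    have : 0 ≤ r ^ 2 - x ^ 2 := by nlinarith [hx.1, hx.2]
    change x ^ 2 + (s * √(r ^ 2 - x ^ 2)) ^ 2 = r ^ 2
    rw [mul_pow, Real.sq_sqrt this, hs2]
    ring
  have hmap : Set.MapsTo c (Set.Icc (-r) r ∩ c ⁻¹' K) (K ∩ Metric.sphere 0 r) := fun x hx =>
    ⟨hx.2, hcs x hx.1⟩
  obtain ⟨h, hh, hhu, hhg⟩ := exists_isUnit_extension (a := -r) (b := r)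
    (K := Set.Icc (-r) r ∩ c ⁻¹' K) (isClosed_Icc.inter (hK.preimage hc)) Set.inter_subset_left
    (g := fun x => g (c x)) (hg.comp hc.continuousOn hmap) fun t ht => hu _ (hmap ht)
  refine ⟨h, hh, hhu, fun z hz him => ?_⟩
  have hz2 := (mem_sphere_zero_iff_sq hr).1 hz.2
  have hre : z.re ∈ Set.Icc (-r) r := by
    rw [Set.mem_Icc, ← abs_le]
    exact abs_le_of_sq_le_sq (by nlinarith [sq_nonneg z.im]) hr.le
  have hcz : c z.re = z := by
    apply Complex.ext
    · rfl
    · change s * √(r ^ 2 - z.re ^ 2) = z.im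
      have h1 : r ^ 2 - z.re ^ 2 = (s * z.im) ^ 2 := by rw [mul_pow, hs2]; linarith
      rw [h1, Real.sqrt_sq him, ← mul_assoc, ← sq, hs2, one_mul]
  have h1 := hhg z.re ⟨hre, by rw [Set.mem_preimage, hcz]; exact hz.1⟩
  rw [hcz] at h1
  exact h1

/-- Extension of a conjugation invariant family from the boundary circle to the disc. -/
theorem exists_isUnit_extension_conj {r : ℝ} (hr : 0 < r) {K : Set ℂ} (hK : IsClosed K)
    {g : ℂ → F →L[ℂ] F} (hg : ContinuousOn g (K ∩ Metric.sphere 0 r))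
    (hu : ∀ z ∈ K ∩ Metric.sphere 0 r, IsUnit (g z))
    (hconj : ∀ z ∈ K ∩ Metric.sphere 0 r, (starRingEnd ℂ) z ∈ K ∧ g ((starRingEnd ℂ) z) = g z) :
    ∃ h : ℂ → F →L[ℂ] F, Continuous h ∧ (∀ z ∈ Metric.closedBall (0 : ℂ) r, IsUnit (h z)) ∧
      (∀ z, h ((starRingEnd ℂ) z) = h z) ∧ ∀ z ∈ K ∩ Metric.sphere 0 r, h z = g z := by
  obtain ⟨h, hh, hhu, hhg⟩ := exists_isUnit_extension_arc hr 1 (Or.inl rfl) hK hg hu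
  -- A conjugation-invariant family on the circle is determined by the upper arc. Extending it as a
  -- function of the real part keeps it invertible on the whole disc, so there is no winding
  -- obstruction.
  refine ⟨fun z => h z.re, hh.comp Complex.continuous_re, fun z hz => hhu _ ?_,
    fun z => by simp, fun z hz => ?_⟩
  · rw [Set.mem_Icc, ← abs_le]
    exact (Complex.abs_re_le_norm z).trans (by simpa using hz)
  · rcases le_total 0 z.im with him | him
    · exact hhg z hz (by simpa using him)
    · obtain ⟨h1, h2⟩ := hconj z hz
      have h3 := hhg ((starRingEnd ℂ) z) ⟨h1, by simpa using hz.2⟩ (by simpa using him)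
      rw [h2] at h3
      simpa using h3

/-- Extension from the boundary circle to the punctured disc. -/
theorem exists_isUnit_extension_punctured {r : ℝ} (hr : 0 < r) {K : Set ℂ} (hK : IsClosed K)
    {g : ℂ → F →L[ℂ] F} (hg : ContinuousOn g (K ∩ Metric.sphere 0 r))
    (hu : ∀ z ∈ K ∩ Metric.sphere 0 r, IsUnit (g z)) :
    ∃ h : ℂ → F →L[ℂ] F, ContinuousOn h {0}ᶜ ∧ (∀ z ≠ 0, IsUnit (h z)) ∧
      ∀ z ∈ K ∩ Metric.sphere 0 r, h z = g z := by
  classical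
  -- prescribe the values at the two real points of the circle
  let g' : ℂ → F →L[ℂ] F := fun z => if z ∈ K then g z else 1
  let K' : Set ℂ := K ∩ Metric.sphere 0 r ∪ ({(r : ℂ)} ∪ {-(r : ℂ)})
  have hK' : IsClosed K' := (hK.inter Metric.isClosed_sphere).union
    (isClosed_singleton.union isClosed_singleton)
  have hg'K : ∀ z ∈ K, g' z = g z := fun z hz => by simp [g', hz]
  have hg' : ContinuousOn g' K' := by
    refine ContinuousOn.union_of_isClosed ?_ (ContinuousOn.union_of_isClosed
      (continuousOn_singleton _ _) (continuousOn_singleton _ _) isClosed_singleton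
      isClosed_singleton) (hK.inter Metric.isClosed_sphere)
      (isClosed_singleton.union isClosed_singleton)
    exact hg.congr fun z hz => hg'K z hz.1
  have hK's : K' ⊆ Metric.sphere 0 r := by
    rintro z (h | h | h)
    · exact h.2
    · rw [Set.mem_singleton_iff.1 h]; simp [abs_of_pos hr]
    · rw [Set.mem_singleton_iff.1 h]; simp [abs_of_pos hr]
  have hu' : ∀ z ∈ K' ∩ Metric.sphere 0 r, IsUnit (g' z) := by
    rintro z ⟨-, hz⟩
    by_cases h : z ∈ K
    · rw [hg'K z h]; exact hu z ⟨h, hz⟩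
    · simp [g', h]
  have hg'' := hg'.mono (Set.inter_subset_left (t := Metric.sphere (0 : ℂ) r))
  obtain ⟨p, hp, hpu, hpg⟩ := exists_isUnit_extension_arc hr 1 (Or.inl rfl) hK' hg'' hu'
  obtain ⟨q, hq, hqu, hqg⟩ := exists_isUnit_extension_arc hr (-1) (Or.inr rfl) hK' hg'' hu'
  -- The two arcs are extended independently; they match at ±r because the values there were
  -- prescribed.
  let k : ℂ → F →L[ℂ] F := fun z => if 0 ≤ z.im then p z.re else q z.re
  have hpq : ∀ z ∈ Metric.sphere (0 : ℂ) r, z.im = 0 → p z.re = q z.re := by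
    intro z hz him
    have hzK : z ∈ K' := by
      have h1 := (mem_sphere_zero_iff_sq hr).1 hz
      rw [him] at h1
      have h2 : z.re = r ∨ z.re = -r := sq_eq_sq_iff_eq_or_eq_neg.1 (by linarith)
      right
      rcases h2 with h2 | h2
      · left; exact Complex.ext (by simp [h2]) (by simp [him])
      · right; exact Complex.ext (by simp [h2]) (by simp [him])
    rw [hpg z ⟨hzK, hz⟩ (by simp [him]), hqg z ⟨hzK, hz⟩ (by simp [him])]
  have hk : ContinuousOn k (Metric.sphere 0 r) := by
    have h1 : Metric.sphere (0 : ℂ) r = Metric.sphere 0 r ∩ {z | 0 ≤ z.im} ∪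
        Metric.sphere 0 r ∩ {z | z.im ≤ 0} := by
      ext z
      have := le_total 0 z.im
      simp only [Set.mem_union, Set.mem_inter_iff, Set.mem_ofPred_eq]
      tauto
    rw [h1]
    refine ContinuousOn.union_of_isClosed ?_ ?_
      (Metric.isClosed_sphere.inter (isClosed_le continuous_const Complex.continuous_im))
      (Metric.isClosed_sphere.inter (isClosed_le Complex.continuous_im continuous_const))
    · refine (hp.comp Complex.continuous_re).continuousOn.congr fun z hz => ?_
      simp [k, show 0 ≤ z.im from hz.2]
    · refine (hq.comp Complex.continuous_re).continuousOn.congr fun z hz => ?_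
      by_cases h2 : 0 ≤ z.im
      · simp [k, h2, hpq z hz.1 (le_antisymm hz.2 h2)]
      · simp [k, h2]
  have hku : ∀ z ∈ Metric.sphere (0 : ℂ) r, IsUnit (k z) := by
    intro z hz
    have hre : z.re ∈ Set.Icc (-r) r := by
      rw [Set.mem_Icc, ← abs_le]
      exact (Complex.abs_re_le_norm z).trans (by simpa using hz.le)
    by_cases h2 : 0 ≤ z.im
    · simpa [k, h2] using hpu _ hre
    · simpa [k, h2] using hqu _ hre
  have hkg : ∀ z ∈ K ∩ Metric.sphere 0 r, k z = g z := by
    intro z hz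
    have hz' : z ∈ K' ∩ Metric.sphere 0 r := ⟨Or.inl hz, hz.2⟩
    rw [← hg'K z hz.1]
    by_cases h2 : 0 ≤ z.im
    · simpa [k, h2] using hpg z hz' (by simpa using h2)
    · simpa [k, h2] using hqg z hz' (by simpa using (not_le.1 h2).le)
  -- Radial projection onto the circle carries the family inwards; the centre is the only place
  -- where it is not defined.
  let ρ : ℂ → ℂ := fun z => (r / ‖z‖ : ℝ) * z
  have hρ : ∀ z ≠ 0, ρ z ∈ Metric.sphere (0 : ℂ) r := by
    intro z hz
    have : ‖z‖ ≠ 0 := norm_ne_zero_iff.2 hz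
    rw [mem_sphere_zero_iff_norm, norm_mul, Complex.norm_real, Real.norm_of_nonneg (by positivity),
      div_mul_cancel₀ _ this]
  refine ⟨fun z => k (ρ z), hk.comp ?_ fun z hz => hρ z hz, fun z hz => hku _ (hρ z hz),
    fun z hz => ?_⟩
  · intro z hz
    have hz0 : ‖z‖ ≠ 0 := norm_ne_zero_iff.2 hz
    refine ContinuousAt.continuousWithinAt ?_
    have h1 : ContinuousAt (fun z : ℂ => r / ‖z‖) z :=
      continuousAt_const.div continuous_norm.continuousAt hz0
    exact (Complex.continuous_ofReal.continuousAt.comp h1).mul continuousAt_id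
  · have h1 : ‖z‖ = r := by simpa using hz.2
    have h2 : ρ z = z := by simp [ρ, h1, hr.ne']
    simp only [h2]
    exact hkg z hz

end

/-! ### Frames with finitely many singularities -/

namespace EqBundle

variable {X : Type*} [TopologicalSpace X] {f : TopInvolution X} {V : EqBundle f}

variable (V) in
/-- There is an equivariant frame over the complement of the finite set `S` in the closed set
`A`. -/
structure HasFrame (A S : Set X) : Prop where
  isClosed : IsClosed A
  invariant : ∀ x, f x ∈ A ↔ x ∈ A
  finite : S.Finite
  invariant_sing : ∀ x, f x ∈ S ↔ x ∈ S
  exists_frame : ∃ e : ∀ x, V.F ≃ₗ[ℂ] V.E x, V.FrameOn e (A \ S) ∧ V.Equivariant e (A \ S)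

theorem transition_invariant {e e' : ∀ x, V.F ≃ₗ[ℂ] V.E x} {x : X}
    (he : ∀ v, e (f x) v = V.φ x (e x v)) (he' : ∀ v, e' (f x) v = V.φ x (e' x v)) :
    transition e e' (f x) = transition e e' x := by
  ext v
  apply (e (f x)).injective
  rw [apply_transition, he, apply_transition, he']

variable [T2Space X]

/-- The disc is the continuous image of a compact disc in ℂ, hence closed in the Hausdorff space X
and not only in the chart domain. -/
theorem isClosed_chart_ball {κ : OpenPartialHomeomorph X ℂ} {r : ℝ}
    (hr : Metric.closedBall 0 r ⊆ κ.target) :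
    IsClosed (κ.source ∩ κ ⁻¹' Metric.closedBall 0 r) := by
  have : κ.source ∩ κ ⁻¹' Metric.closedBall 0 r = κ.symm '' Metric.closedBall 0 r := by
    ext x
    constructor
    · rintro ⟨h1, h2⟩
      exact ⟨κ x, h2, κ.left_inv h1⟩
    · rintro ⟨z, hz, rfl⟩
      refine ⟨κ.map_target (hr hz), ?_⟩
      rw [Set.mem_preimage, κ.right_inv (hr hz)]
      exact hz
  rw [this]
  exact ((isCompact_closedBall 0 r).image_of_continuousOn
    (κ.continuousOn_symm.mono hr)).isClosed

/-- The transition function in a chart, over the boundary circle of a disc. -/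
theorem continuousOn_transition_sphere {κ : OpenPartialHomeomorph X ℂ} {r : ℝ}
    (hr : Metric.closedBall 0 r ⊆ κ.target) {U A S : Set X} (hU : κ.source ⊆ U)
    {e e' : ∀ x, V.F ≃ₗ[ℂ] V.E x} (he : V.FrameOn e U) (he' : V.FrameOn e' (A \ S))
    (hS : ∀ x ∈ S, x ∈ κ.source → κ x ∉ Metric.sphere 0 r) :
    ContinuousOn (fun z => transition e e' (κ.symm z))
      ((Metric.closedBall 0 r ∩ κ.symm ⁻¹' A) ∩ Metric.sphere 0 r) := by
  have hmap : Set.MapsTo κ.symm ((Metric.closedBall 0 r ∩ κ.symm ⁻¹' A) ∩ Metric.sphere 0 r)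
      (U ∩ (A \ S)) := by
    rintro z ⟨⟨h1, h2⟩, h3⟩
    have h4 := κ.map_target (hr h1)
    refine ⟨hU h4, h2, fun h => hS _ h h4 ?_⟩
    rw [κ.right_inv (hr h1)]
    exact h3
  intro z hz
  have h1 : ContinuousWithinAt (transition e e') (U ∩ (A \ S)) (κ.symm z) :=
    ((he _ (hmap hz).1).mono Set.inter_subset_left).transition
      ((he' _ (hmap hz).2).mono Set.inter_subset_right)
  exact h1.comp ((κ.continuousOn_symm.mono fun w hw => hr hw.1.1) z hz) hmap

/-- An equivariant frame can be changed over a disc and its mirror image, so that the singularities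
in the disc are replaced by one at the centre. -/
theorem HasFrame.move_free {A S : Set X} (h : V.HasFrame A S) {κ : OpenPartialHomeomorph X ℂ}
    {r : ℝ} (hr0 : 0 < r) (hr : Metric.closedBall 0 r ⊆ κ.target) {U : Set X} (hU : κ.source ⊆ U)
    (hUf : ∀ x ∈ U, f x ∈ U) {e : ∀ x, V.F ≃ₗ[ℂ] V.E x} (he : V.FrameOn e U)
    (heq : V.Equivariant e U)
    (hf : ∀ x ∈ κ.source, f x ∉ κ.source)
    (hS : ∀ x ∈ S, x ∈ κ.source → κ x ∉ Metric.sphere 0 r) :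
    V.HasFrame
      (A ∪ ((κ.source ∩ κ ⁻¹' Metric.closedBall 0 r) ∪
        f ⁻¹' (κ.source ∩ κ ⁻¹' Metric.closedBall 0 r)))
      (S \ ((κ.source ∩ κ ⁻¹' Metric.closedBall 0 r) ∪
        f ⁻¹' (κ.source ∩ κ ⁻¹' Metric.closedBall 0 r)) ∪ {κ.symm 0, f (κ.symm 0)}) := by
  classical
  obtain ⟨hAc, hAf, hSfin, hSf, e', he', heq'⟩ := h
  set D := κ.source ∩ κ ⁻¹' Metric.closedBall 0 r with hD
  set O := κ.source ∩ κ ⁻¹' Metric.ball 0 r with hO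
  have hDc : IsClosed D := isClosed_chart_ball hr
  have hOo : IsOpen O := κ.isOpen_inter_preimage Metric.isOpen_ball
  have hOD : O ⊆ D := fun x hx => ⟨hx.1, Metric.ball_subset_closedBall hx.2⟩
  have hfc := f.continuous_toFun
  have hff : ∀ x, f (f x) = x := f.involutive
  have h0 : (0 : ℂ) ∈ κ.target := hr (Metric.mem_closedBall_self hr0.le)
  have hnot : ∀ x, f x ∈ κ.source → x ∉ κ.source := fun x hx hx' => hf x hx' hx
  have hκ0 : ∀ x ∈ κ.source, κ x = 0 → x = κ.symm 0 := fun x hx h => by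
    rw [← h, κ.left_inv hx]
  have hCf : ∀ x, f x ∈ D ∪ f ⁻¹' D ↔ x ∈ D ∪ f ⁻¹' D := by
    intro x
    simp only [Set.mem_union, Set.mem_preimage, hff]
    tauto
  have hQf : ∀ x, f x ∈ ({κ.symm 0, f (κ.symm 0)} : Set X) ↔
      x ∈ ({κ.symm 0, f (κ.symm 0)} : Set X) := by
    intro x
    simp only [Set.mem_insert_iff, Set.mem_singleton_iff, f.involutive.injective.eq_iff]
    constructor
    · rintro (h | h)
      · right; rw [← h, hff]
      · exact Or.inl h
    · rintro (h | h)
      · exact Or.inr h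
      · left; rw [h, hff]
  have hK : IsClosed (Metric.closedBall (0 : ℂ) r ∩ κ.symm ⁻¹' A) :=
    (κ.continuousOn_symm.mono hr).preimage_isClosed_of_isClosed Metric.isClosed_closedBall hAc
  -- The transition function from e to e' is given on the part of the boundary circle lying in A,
  -- where e' has no singularity. Its extension over the punctured disc corrects e so that it fits
  -- e', leaving one singularity at the centre.
  obtain ⟨k, hk, hku, hkg⟩ := exists_isUnit_extension_punctured hr0 hK
    (continuousOn_transition_sphere hr hU he he' hS) fun z _ => isUnit_transition _ _ _
  have hCU : D ∪ f ⁻¹' D ⊆ U := by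
    rintro x (hx | hx)
    · exact hU hx.1
    · have := hUf _ (hU hx.1)
      rwa [hff] at this
  have hSC : ∀ x ∈ S, x ∈ D ∪ f ⁻¹' D → x ∈ O ∪ f ⁻¹' O := by
    have key : ∀ x ∈ S, x ∈ D → x ∈ O := fun x hxS hxD => by
      refine ⟨hxD.1, ?_⟩
      have h1 := hS x hxS hxD.1
      have h2 : κ x ∈ Metric.closedBall 0 r := hxD.2
      rw [Metric.mem_closedBall] at h2
      rw [Metric.mem_sphere] at h1
      exact lt_of_le_of_ne h2 h1
    rintro x hxS (hx | hx)
    · exact Or.inl (key x hxS hx)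
    · exact Or.inr (key _ ((hSf x).2 hxS) hx)
  -- The correction on the mirror disc is copied from the disc through f. The two discs are
  -- disjoint, so this is consistent and G is f-invariant.
  let G : X → V.F →L[ℂ] V.F := fun x => if x ∈ κ.source then k (κ x) else k (κ (f x))
  have hG1 : ∀ x ∈ κ.source, G x = k (κ x) := fun x hx => if_pos hx
  have hG2 : ∀ x, f x ∈ κ.source → G x = k (κ (f x)) := fun x hx => if_neg (hnot x hx)
  have hGd : ∀ x ∈ κ.source, κ x ≠ 0 → ContinuousAt (fun y => k (κ y)) x := fun x hx hx0 =>
    ((hk _ hx0).continuousAt (isOpen_compl_singleton.mem_nhds hx0)).comp (κ.continuousAt hx)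
  have hne : ∀ x ∈ κ.source, x ≠ κ.symm 0 → κ x ≠ 0 := fun x hx h1 h2 => h1 (hκ0 x hx h2)
  have hfne : ∀ x, f x ∈ κ.source → x ≠ f (κ.symm 0) → κ (f x) ≠ 0 := fun x hx h1 h2 =>
    h1 (by rw [← hκ0 _ hx h2, hff])
  have hGc : ContinuousOn G ((D ∪ f ⁻¹' D) \ {κ.symm 0, f (κ.symm 0)}) := by
    rintro x ⟨hx | hx, hxQ⟩
    · have h1 := hGd x hx.1 (hne x hx.1 fun h => hxQ (Or.inl h))
      refine (h1.congr ?_).continuousWithinAt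
      filter_upwards [κ.open_source.mem_nhds hx.1] with y hy using (hG1 y hy).symm
    · have h1 := hGd (f x) hx.1 (hfne x hx.1 fun h => hxQ (Or.inr h))
      have h2 : ContinuousAt (fun y => k (κ (f y))) x := h1.comp hfc.continuousAt
      refine (h2.congr ?_).continuousWithinAt
      filter_upwards [(κ.open_source.preimage hfc).mem_nhds hx.1] with y hy using (hG2 y hy).symm
  have htr : ∀ x ∈ A, x ∈ D → x ∉ O → k (κ x) = transition e e' x := by
    intro x hxA hxD hxO
    have h1 : κ x ∈ Metric.sphere 0 r := by
      rw [Metric.mem_sphere]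
      exact le_antisymm hxD.2 (not_lt.1 fun h => hxO ⟨hxD.1, h⟩)
    have h2 := hkg (κ x) ⟨⟨hxD.2, by rw [Set.mem_preimage, κ.left_inv hxD.1]; exact hxA⟩, h1⟩
    rwa [κ.left_inv hxD.1] at h2
  have hG3 : ∀ x ∈ (D ∪ f ⁻¹' D) \ {κ.symm 0, f (κ.symm 0)}, IsUnit (G x) := by
    rintro x ⟨hx | hx, hxQ⟩
    · rw [hG1 x hx.1]
      exact hku _ (hne x hx.1 fun h => hxQ (Or.inl h))
    · rw [hG2 x hx.1]
      exact hku _ (hfne x hx.1 fun h => hxQ (Or.inr h))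
  have hG4 : ∀ x ∈ D ∪ f ⁻¹' D, G (f x) = G x := by
    rintro x (hx | hx)
    · rw [hG1 x hx.1, hG2 (f x) (by rw [hff]; exact hx.1), hff]
    · rw [hG2 x hx.1, hG1 (f x) hx.1]
  have hG5 : ∀ x ∈ A, x ∈ D ∪ f ⁻¹' D → x ∉ O ∪ f ⁻¹' O → G x = transition e e' x := by
    rintro x hxA (hx | hx) hxO
    · rw [hG1 x hx.1]
      exact htr x hxA hx fun h => hxO (Or.inl h)
    · rw [hG2 x hx.1, htr (f x) ((hAf x).2 hxA) hx fun h => hxO (Or.inr h)]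
      have hxS : x ∉ S := fun h => hxO (hSC x h (Or.inr hx))
      exact transition_invariant (heq x (hCU (Or.inr hx))) (heq' x ⟨hxA, hxS⟩)
  obtain ⟨e'', h1, h2⟩ := glue_frames (V := V) hAc (hDc.union (hDc.preimage hfc))
    (hOo.union (hOo.preimage hfc)) (Set.union_subset_union hOD (Set.preimage_mono hOD)) hCU hCf
    hQf hSC he heq he' heq' hGc hG3 hG4 hG5
  refine ⟨hAc.union (hDc.union (hDc.preimage hfc)), fun x => ?_,
    (hSfin.subset Set.sdiff_subset).union (by simp), fun x => ?_, e'', h1, h2⟩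
  · rw [Set.mem_union, Set.mem_union _ A, hAf, hCf]
  · rw [Set.mem_union, Set.mem_union _ (S \ _), Set.mem_sdiff, Set.mem_sdiff, hSf, hCf, hQf]

/-- An equivariant frame can be changed over an invariant disc around a fixed point, so that there
are no singularities in the disc. -/
theorem HasFrame.move_fixed {A S : Set X} (h : V.HasFrame A S) {κ : OpenPartialHomeomorph X ℂ}
    {r : ℝ} (hr0 : 0 < r) (hr : Metric.closedBall 0 r ⊆ κ.target) {U : Set X} (hU : κ.source ⊆ U)
    {e : ∀ x, V.F ≃ₗ[ℂ] V.E x} (he : V.FrameOn e U) (heq : V.Equivariant e U)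
    (hf : ∀ x ∈ κ.source, f x ∈ κ.source ∧ κ (f x) = (starRingEnd ℂ) (κ x))
    (hS : ∀ x ∈ S, x ∈ κ.source → κ x ∉ Metric.sphere 0 r) :
    V.HasFrame (A ∪ (κ.source ∩ κ ⁻¹' Metric.closedBall 0 r))
      (S \ (κ.source ∩ κ ⁻¹' Metric.closedBall 0 r)) := by
  classical
  obtain ⟨hAc, hAf, hSfin, hSf, e', he', heq'⟩ := h
  set D := κ.source ∩ κ ⁻¹' Metric.closedBall 0 r with hD
  set O := κ.source ∩ κ ⁻¹' Metric.ball 0 r with hO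
  have hDc : IsClosed D := isClosed_chart_ball hr
  have hOo : IsOpen O := κ.isOpen_inter_preimage Metric.isOpen_ball
  have hOD : O ⊆ D := fun x hx => ⟨hx.1, Metric.ball_subset_closedBall hx.2⟩
  have hff : ∀ x, f (f x) = x := f.involutive
  have hDf' : ∀ x ∈ D, f x ∈ D := by
    intro x hx
    refine ⟨(hf x hx.1).1, ?_⟩
    have h1 : κ x ∈ Metric.closedBall 0 r := hx.2
    rw [Set.mem_preimage, (hf x hx.1).2]
    simpa using h1
  have hDf : ∀ x, f x ∈ D ↔ x ∈ D := fun x =>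
    ⟨fun h => by have := hDf' _ h; rwa [hff] at this, hDf' x⟩
  have hK : IsClosed (Metric.closedBall (0 : ℂ) r ∩ κ.symm ⁻¹' A) :=
    (κ.continuousOn_symm.mono hr).preimage_isClosed_of_isClosed Metric.isClosed_closedBall hAc
  have hSC : ∀ x ∈ S, x ∈ D → x ∈ O := by
    intro x hxS hxD
    refine ⟨hxD.1, ?_⟩
    have h1 := hS x hxS hxD.1
    have h2 : κ x ∈ Metric.closedBall 0 r := hxD.2
    rw [Metric.mem_closedBall] at h2
    rw [Metric.mem_sphere] at h1
    exact lt_of_le_of_ne h2 h1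
  -- In this chart f is conjugation, and both frames are equivariant, so the transition function on
  -- the circle is conjugation-invariant and extends without a singularity.
  have hconj : ∀ z ∈ (Metric.closedBall (0 : ℂ) r ∩ κ.symm ⁻¹' A) ∩ Metric.sphere 0 r,
      (starRingEnd ℂ) z ∈ Metric.closedBall (0 : ℂ) r ∩ κ.symm ⁻¹' A ∧
        transition e e' (κ.symm ((starRingEnd ℂ) z)) = transition e e' (κ.symm z) := by
    rintro z ⟨⟨h1, h2⟩, h3⟩
    have hz := hr h1
    have hs := κ.map_target hz
    have h4 : κ.symm ((starRingEnd ℂ) z) = f (κ.symm z) := by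
      have h5 := (hf _ hs).2
      rw [κ.right_inv hz] at h5
      rw [← h5, κ.left_inv (hf _ hs).1]
    have hzS : κ.symm z ∉ S := fun h => hS _ h hs (by rw [κ.right_inv hz]; exact h3)
    refine ⟨⟨by simpa using h1, ?_⟩, ?_⟩
    · rw [Set.mem_preimage, h4, hAf]
      exact h2
    · rw [h4]
      exact transition_invariant (heq _ (hU hs)) (heq' _ ⟨h2, hzS⟩)
  obtain ⟨k, hk, hku, hkc, hkg⟩ := exists_isUnit_extension_conj hr0 hK
    (continuousOn_transition_sphere hr hU he he' hS) (fun z _ => isUnit_transition _ _ _) hconj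
  have hG4 : ∀ x ∈ D, k (κ (f x)) = k (κ x) := fun x hx => by rw [(hf x hx.1).2, hkc]
  have hG5 : ∀ x ∈ A, x ∈ D → x ∉ O → k (κ x) = transition e e' x := by
    intro x hxA hxD hxO
    have h1 : κ x ∈ Metric.sphere 0 r := by
      rw [Metric.mem_sphere]
      exact le_antisymm hxD.2 (not_lt.1 fun h => hxO ⟨hxD.1, h⟩)
    have h2 := hkg (κ x) ⟨⟨hxD.2, by rw [Set.mem_preimage, κ.left_inv hxD.1]; exact hxA⟩, h1⟩
    rwa [κ.left_inv hxD.1] at h2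
  obtain ⟨e'', h1, h2⟩ := glue_frames (V := V) (Q := ∅) (G := fun x => k (κ x)) hAc hDc
    hOo hOD (fun x hx => hU hx.1) hDf (fun x => Iff.rfl) hSC he heq he' heq'
    (hk.comp_continuousOn (κ.continuousOn.mono fun x hx => hx.1.1)) (fun x hx => hku _ hx.1.2)
    hG4 hG5
  rw [Set.union_empty] at h1 h2
  refine ⟨hAc.union hDc, fun x => ?_, hSfin.subset Set.sdiff_subset, fun x => ?_, e'', h1, h2⟩
  · rw [Set.mem_union, Set.mem_union _ A, hAf, hDf]
  · rw [Set.mem_sdiff, Set.mem_sdiff, hSf, hDf]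

end EqBundle

/-! ### Charts adapted to the involution -/

/-- A complex-valued chart can be centred and rescaled, so that its image contains a large disc. -/
theorem OpenPartialHomeomorph.exists_rescale {X : Type*} [TopologicalSpace X]
    (κ : OpenPartialHomeomorph X ℂ) {q : X} (hq : q ∈ κ.source) :
    ∃ c : ℝ, 0 < c ∧ ∃ κ' : OpenPartialHomeomorph X ℂ, κ'.source = κ.source ∧
      (∀ x, κ' x = c * (κ x - κ q)) ∧ Metric.closedBall 0 2 ⊆ κ'.target := by
  obtain ⟨ε, hε, hball⟩ := Metric.isOpen_iff.1 κ.open_target _ (κ.map_source hq)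
  have hc : (0 : ℝ) < 4 / ε := by positivity
  have hc' : ((4 / ε : ℝ) : ℂ) ≠ 0 := by exact_mod_cast hc.ne'
  refine ⟨4 / ε, hc, κ.transHomeomorph
    ((Homeomorph.addRight (-κ q)).trans (Homeomorph.mulLeft₀ _ hc')), rfl, fun x => ?_, ?_⟩
  · simp [sub_eq_add_neg]
  · intro z hz
    rw [OpenPartialHomeomorph.transHomeomorph_target, Set.mem_preimage]
    apply hball
    rw [mem_closedBall_zero_iff] at hz
    rw [Metric.mem_ball, dist_eq_norm]
    have h1 : ((Homeomorph.addRight (-κ q)).trans (Homeomorph.mulLeft₀ _ hc')).symm z - κ q =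
        ((4 / ε : ℝ) : ℂ)⁻¹ * z := by
      change ((4 / ε : ℝ) : ℂ)⁻¹ * z + - -κ q - κ q = _
      ring
    rw [h1, norm_mul, norm_inv, Complex.norm_real, Real.norm_of_nonneg hc.le]
    have h2 : (4 / ε)⁻¹ * ‖z‖ ≤ (4 / ε)⁻¹ * 2 := by gcongr
    have h3 : (4 / ε)⁻¹ * 2 = ε / 2 := by field_simp; norm_num
    linarith

/-- A translation by at most 1/2 leaves a disc of radius 2 - 1/2 = 3/2 in the image. -/
theorem OpenPartialHomeomorph.exists_recenter {X : Type*} [TopologicalSpace X]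
    (κ : OpenPartialHomeomorph X ℂ) {q : X} (hκ : Metric.closedBall 0 2 ⊆ κ.target)
    (hq : ‖κ q‖ ≤ 1 / 2) :
    ∃ κ' : OpenPartialHomeomorph X ℂ, κ'.source = κ.source ∧
      (∀ x, κ' x = κ x - κ q) ∧ Metric.closedBall 0 (3 / 2) ⊆ κ'.target := by
  refine ⟨κ.transHomeomorph (Homeomorph.addRight (-κ q)), rfl, fun x => ?_, ?_⟩
  · simp [sub_eq_add_neg]
  · intro z hz
    rw [OpenPartialHomeomorph.transHomeomorph_target, Set.mem_preimage]
    apply hκ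
    rw [mem_closedBall_zero_iff] at hz ⊢
    have h1 : (Homeomorph.addRight (-κ q)).symm z = z + κ q := by
      change z + - -κ q = _
      rw [neg_neg]
    rw [h1]
    linarith [norm_add_le z (κ q)]

section Charts

variable {X : Type*} [TopologicalSpace X] [ChartedSpace ℂ X]

/-- Around a point which is not fixed, there is a chart disjoint from its mirror image. -/
theorem TopInvolution.exists_chart_of_ne [T2Space X] (f : TopInvolution X) {x₀ : X}
    (hx : f x₀ ≠ x₀) {U : Set X} (hU : U ∈ 𝓝 x₀) :
    ∃ κ : OpenPartialHomeomorph X ℂ, κ.source ⊆ U ∧ x₀ ∈ κ.source ∧ κ x₀ = 0 ∧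
      Metric.closedBall 0 2 ⊆ κ.target ∧ ∀ x ∈ κ.source, f x ∉ κ.source := by
  obtain ⟨W, hWU, hW, hxW, hWf⟩ := f.exists_isOpen_disjoint hx hU
  have hx₀ : x₀ ∈ ((chartAt ℂ x₀).restrOpen W hW).source := by
    rw [OpenPartialHomeomorph.restrOpen_source]
    exact ⟨mem_chart_source ℂ x₀, hxW⟩
  obtain ⟨c, hc, κ, h1, h2, h3⟩ := OpenPartialHomeomorph.exists_rescale _ hx₀
  have h4 : κ.source ⊆ W := by
    rw [h1, OpenPartialHomeomorph.restrOpen_source]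
    exact Set.inter_subset_right
  exact ⟨κ, h4.trans hWU, h1 ▸ hx₀, by simp [h2], h3, fun x hx hx' => hWf x (h4 hx) (h4 hx')⟩

variable [IsManifold 𝓘(ℂ) ω X]

theorem differentiableAt_chart_change {e e' : OpenPartialHomeomorph X ℂ} (he : e ∈ atlas ℂ X)
    (he' : e' ∈ atlas ℂ X) {x : X} (hx : x ∈ e.source) (hx' : x ∈ e'.source) :
    DifferentiableAt ℂ (fun z => e' (e.symm z)) (e x) := by
  have h1 := ((contDiffGroupoid ω 𝓘(ℂ)).compatible he he').1
  have h2 : ContDiffOn ℂ ω (fun z => e' (e.symm z)) (e.symm ≫ₕ e').source := by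
    have h3 : 𝓘(ℂ).symm ⁻¹' (e.symm ≫ₕ e').source ∩ Set.range 𝓘(ℂ) = (e.symm ≫ₕ e').source := by
      simp
    rw [← h3]
    exact h1
  have hm : e x ∈ (e.symm ≫ₕ e').source := by
    simp [hx, hx']
  exact (h2.differentiableOn (by simp)).differentiableAt ((e.symm ≫ₕ e').open_source.mem_nhds hm)

/-- In a chart, the conjugate of an anti-holomorphic involution is holomorphic. -/
theorem RealStructure.differentiableAt_conj (f : RealStructure X) {k : OpenPartialHomeomorph X ℂ}
    (hk : k ∈ atlas ℂ X) {x : X} (hx : x ∈ k.source) (hfx : f x ∈ k.source) :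
    DifferentiableAt ℂ (fun z => (starRingEnd ℂ) (k (f (k.symm z)))) (k x) := by
  set c := chartAt ℂ x with hc
  set d := chartAt ℂ (f x) with hd
  have hxc : x ∈ c.source := mem_chart_source ℂ x
  have hxd : f x ∈ d.source := mem_chart_source ℂ (f x)
  have h1 : DifferentiableAt ℂ (fun z => c (k.symm z)) (k x) :=
    differentiableAt_chart_change hk (chart_mem_atlas ℂ x) hx hxc
  have h2 : DifferentiableAt ℂ (fun z => (starRingEnd ℂ) (d (f (c.symm z)))) (c x) :=
    f.antiholomorphic x
  have h3 : DifferentiableAt ℂ (fun z => k (d.symm z)) (d (f x)) :=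
    differentiableAt_chart_change (chart_mem_atlas ℂ (f x)) hk hxd hfx
  -- Conjugating the chart change on both sides keeps it holomorphic and lets it be composed with
  -- the conjugate of f, which is holomorphic in the preferred charts.
  have h4 := h3.conj_conj
  have h21 : DifferentiableAt ℂ (fun z => (starRingEnd ℂ) (d (f (c.symm (c (k.symm z)))))) (k x) :=
    DifferentiableAt.comp (g := fun z => (starRingEnd ℂ) (d (f (c.symm z))))
      (f := fun z => c (k.symm z)) (k x) (by rw [k.left_inv hx]; exact h2) h1
  have h5 : DifferentiableAt ℂ
      (fun z => (starRingEnd ℂ) (k (d.symm (d (f (c.symm (c (k.symm z)))))))) (k x) := by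
    have := DifferentiableAt.comp (g := (starRingEnd ℂ) ∘ (fun z => k (d.symm z)) ∘ (starRingEnd ℂ))
      (f := fun z => (starRingEnd ℂ) (d (f (c.symm (c (k.symm z)))))) (k x)
      (by rw [k.left_inv hx, c.left_inv hxc]; exact h4) h21
    simpa [Function.comp_def] using this
  refine h5.congr_of_eventuallyEq ?_
  have hs : ContinuousAt k.symm (k x) := k.continuousAt_symm (k.map_source hx)
  have hs1 : ∀ᶠ z in 𝓝 (k x), k.symm z ∈ c.source := hs.eventually_mem
    (c.open_source.mem_nhds (by rw [k.left_inv hx]; exact hxc))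
  have hs2 : ∀ᶠ z in 𝓝 (k x), k.symm z ∈ f ⁻¹' d.source := hs.eventually_mem
    ((d.open_source.preimage f.continuous_toFun).mem_nhds (by rw [k.left_inv hx]; exact hxd))
  filter_upwards [hs1, hs2] with z hz1 hz2
  rw [c.left_inv hz1, d.left_inv hz2]

/-- Around a fixed point of an anti-holomorphic involution, there is a chart in which the involution
is complex conjugation. -/
theorem RealStructure.exists_chart_of_eq (f : RealStructure X) {x₀ : X} (hx : f x₀ = x₀)
    {U : Set X} (hU : U ∈ 𝓝 x₀) :
    ∃ κ : OpenPartialHomeomorph X ℂ, κ.source ⊆ U ∧ x₀ ∈ κ.source ∧ κ x₀ = 0 ∧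
      Metric.closedBall 0 2 ⊆ κ.target ∧
      ∀ x ∈ κ.source, f x ∈ κ.source ∧ κ (f x) = (starRingEnd ℂ) (κ x) := by
  have hff : ∀ x, f (f x) = x := f.involutive
  set k := chartAt ℂ x₀ with hk
  have hxk : x₀ ∈ k.source := mem_chart_source ℂ x₀
  set a : ℂ → ℂ := fun z => (starRingEnd ℂ) (k (f (k.symm z))) with ha
  set z₀ := k x₀ with hz₀
  have ha0 : a z₀ = (starRingEnd ℂ) z₀ := by
    simp only [a, hz₀, k.left_inv hxk, hx]
  have hD : IsOpen (k.target ∩ k.symm ⁻¹' (k.source ∩ f ⁻¹' k.source)) :=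
    k.isOpen_inter_preimage_symm
      (k.open_source.inter (k.open_source.preimage f.continuous_toFun))
  have hdiff : DifferentiableOn ℂ a (k.target ∩ k.symm ⁻¹' (k.source ∩ f ⁻¹' k.source)) := by
    rintro z ⟨h1, h2, h3⟩
    have h4 := f.differentiableAt_conj (chart_mem_atlas ℂ x₀) h2 h3
    rw [k.right_inv h1] at h4
    exact h4.differentiableWithinAt
  have hz₀D : z₀ ∈ k.target ∩ k.symm ⁻¹' (k.source ∩ f ⁻¹' k.source) := by
    refine ⟨k.map_source hxk, ?_⟩
    rw [Set.mem_preimage, hz₀, k.left_inv hxk]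
    exact ⟨hxk, by rw [Set.mem_preimage, hx]; exact hxk⟩
  have han : AnalyticAt ℂ a z₀ := hdiff.analyticAt (hD.mem_nhds hz₀D)
  -- The number l + l̄ a'(z₀) will be the derivative of the new coordinate. With l = 1 it vanishes
  -- only if a'(z₀) = -1, and then l = i gives 2i.
  obtain ⟨l, hl⟩ : ∃ l : ℂ, l + (starRingEnd ℂ) l * deriv a z₀ ≠ 0 := by
    by_cases h : 1 + deriv a z₀ = 0
    · refine ⟨Complex.I, fun h' => ?_⟩
      rw [show deriv a z₀ = -1 by linear_combination h, Complex.conj_I] at h'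
      have : Complex.I = 0 := by linear_combination h' / 2
      exact Complex.I_ne_zero this
    · exact ⟨1, by simpa using h⟩
  -- Here a is the conjugate of f in the chart. The involution exchanges z with the conjugate of
  -- a(z), so it exchanges the two summands up to conjugation: Φ is conjugated by f, and it is a
  -- holomorphic coordinate by the choice of l.
  set Φ : ℂ → ℂ := fun z => l * (z - z₀) + (starRingEnd ℂ) l * (a z - (starRingEnd ℂ) z₀) with hΦ
  have hΦd : HasStrictDerivAt Φ (l + (starRingEnd ℂ) l * deriv a z₀) z₀ := by
    have h1 := HasStrictDerivAt.const_mul l ((hasStrictDerivAt_id z₀).sub_const z₀)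
    have h2 := HasStrictDerivAt.const_mul ((starRingEnd ℂ) l)
      (han.hasStrictDerivAt.sub_const ((starRingEnd ℂ) z₀))
    have h3 := h1.add h2
    rw [mul_one] at h3
    exact h3
  set P := (hΦd.hasStrictFDerivAt_equiv hl).toOpenPartialHomeomorph Φ with hP
  have hPz : z₀ ∈ P.source :=
    (hΦd.hasStrictFDerivAt_equiv hl).mem_toOpenPartialHomeomorph_source
  have hPc : ∀ z, P z = Φ z := fun z => rfl
  obtain ⟨U', hU'U, hU'o, hxU'⟩ := mem_nhds_iff.1 hU
  set T := (k.trans P).source ∩ U' with hT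
  have hTo : IsOpen T := (k.trans P).open_source.inter hU'o
  have hxT : x₀ ∈ T := ⟨by
    rw [OpenPartialHomeomorph.trans_source]
    exact ⟨hxk, hPz⟩, hxU'⟩
  have hTk : T ⊆ k.source := fun x hx => by
    have h := hx.1
    rw [OpenPartialHomeomorph.trans_source] at h
    exact h.1
  set N := T ∩ f ⁻¹' T with hN
  have hNo : IsOpen N := hTo.inter (hTo.preimage f.continuous_toFun)
  have hxN : x₀ ∈ N := ⟨hxT, by rw [Set.mem_preimage, hx]; exact hxT⟩
  have hNf : ∀ x ∈ N, f x ∈ N := fun x h => ⟨h.2, by rw [Set.mem_preimage, hff]; exact h.1⟩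
  have hsrc : ((k.trans P).restrOpen N hNo).source = N := by
    rw [OpenPartialHomeomorph.restrOpen_source]
    exact Set.inter_eq_right.2 fun x hx => hx.1.1
  have hval : ∀ x, (k.trans P).restrOpen N hNo x = Φ (k x) := fun x => rfl
  have hΦ0 : Φ z₀ = 0 := by simp [Φ, ha0]
  obtain ⟨c, hc, κ, h1, h2, h3⟩ := OpenPartialHomeomorph.exists_rescale
    ((k.trans P).restrOpen N hNo) (hsrc.symm ▸ hxN)
  have h2' : ∀ x, κ x = c * Φ (k x) := fun x => by
    rw [h2, hval, hval, ← hz₀, hΦ0, sub_zero]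
  rw [hsrc] at h1
  refine ⟨κ, ?_, h1 ▸ hxN, ?_, h3, fun x hx => ?_⟩
  · rw [h1]
    exact fun x hx => hU'U hx.1.2
  · rw [h2', ← hz₀, hΦ0, mul_zero]
  · rw [h1] at hx ⊢
    refine ⟨hNf x hx, ?_⟩
    have h4 : a (k x) = (starRingEnd ℂ) (k (f x)) := by
      simp only [a, k.left_inv (hTk hx.1)]
    have h5 : a (k (f x)) = (starRingEnd ℂ) (k x) := by
      simp only [a, k.left_inv (hTk hx.2), hff]
    rw [h2', h2', map_mul, Complex.conj_ofReal]
    congr 1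
    simp only [Φ, h4, h5, map_add, map_mul, map_sub, Complex.conj_conj]
    ring

end Charts

/-! ### Global equivariant frames and counting of singularities -/

namespace EqBundle

variable {X : Type*} [TopologicalSpace X] {f : TopInvolution X} {V : EqBundle f}

/-- A frame defines a continuous map from the trivial bundle. -/
theorem FrameOn.continuous_apply {e : ∀ x, V.F ≃ₗ[ℂ] V.E x} (he : V.FrameOn e Set.univ)
    {Z : Type*} [TopologicalSpace Z] {b : Z → X} (hb : Continuous b) {v : Z → V.F}
    (hv : Continuous v) :
    Continuous fun z => (⟨b z, e (b z) (v z)⟩ : Bundle.TotalSpace V.F V.E) := by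
  rw [continuous_iff_continuousAt]
  intro z₀
  rw [FiberBundle.continuousAt_totalSpace]
  refine ⟨hb.continuousAt, ?_⟩
  have h1 : ContinuousAt (frameMatrix e (b z₀)) (b z₀) :=
    (he _ (Set.mem_univ _)).frameMatrix.continuousAt Filter.univ_mem
  have h2 : ContinuousAt (fun z => frameMatrix e (b z₀) (b z)) z₀ :=
    ContinuousAt.comp (g := frameMatrix e (b z₀)) (f := b) h1 hb.continuousAt
  refine (h2.clm_apply hv.continuousAt).congr ?_
  filter_upwards [hb.continuousAt.eventually_mem
    ((trivializationAt V.F V.E (b z₀)).open_baseSet.mem_nhds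
      (FiberBundle.mem_baseSet_trivializationAt V.F V.E (b z₀)))] with z hz
    using frameMatrix_apply e (b z₀) hz (v z)

/-- The coordinates in a frame are continuous functions on the total space. -/
theorem FrameOn.continuous_symm {e : ∀ x, V.F ≃ₗ[ℂ] V.E x} (he : V.FrameOn e Set.univ) :
    Continuous fun p : Bundle.TotalSpace V.F V.E => (e p.1).symm p.2 := by
  rw [continuous_iff_continuousAt]
  intro p₀
  set t := trivializationAt V.F V.E p₀.1 with ht
  have hp₀ : p₀.1 ∈ t.baseSet := FiberBundle.mem_baseSet_trivializationAt V.F V.E p₀.1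
  have hπ := FiberBundle.continuous_proj V.F V.E
  have h1 : ContinuousAt (fun x => ContinuousLinearMap.inverse (frameMatrix e p₀.1 x)) p₀.1 :=
    ((he _ (Set.mem_univ _)).frameMatrix.clm_inverse
      (isUnit_frameMatrix e p₀.1 hp₀)).continuousAt Filter.univ_mem
  have h2 : ContinuousAt (fun p : Bundle.TotalSpace V.F V.E =>
      ContinuousLinearMap.inverse (frameMatrix e p₀.1 p.1)) p₀ :=
    ContinuousAt.comp (g := fun x => ContinuousLinearMap.inverse (frameMatrix e p₀.1 x)) h1
      hπ.continuousAt
  have h3 : ContinuousAt (fun p : Bundle.TotalSpace V.F V.E => (t p).2) p₀ :=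
    continuous_snd.continuousAt.comp (t.continuousAt (t.mem_source.2 hp₀))
  refine (h2.clm_apply h3).congr ?_
  filter_upwards [hπ.continuousAt.eventually_mem (t.open_baseSet.mem_nhds hp₀)] with p hp
  have h4 : (t p).2 = frameMatrix e p₀.1 p.1 ((e p.1).symm p.2) := by
    rw [frameMatrix_apply e p₀.1 hp, LinearEquiv.apply_symm_apply]
  have h5 : ContinuousLinearMap.inverse (frameMatrix e p₀.1 p.1) * frameMatrix e p₀.1 p.1 = 1 := by
    rw [← ContinuousLinearMap.ringInverse_eq_inverse]
    exact Ring.inverse_mul_cancel _ (isUnit_frameMatrix e p₀.1 hp)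
  rw [h4]
  exact congrArg (fun L : V.F →L[ℂ] V.F => L ((e p.1).symm p.2)) h5

/-- An equivariant bundle with an equivariant global frame is trivial. -/
theorem FrameOn.isIso_trivial {e : ∀ x, V.F ≃ₗ[ℂ] V.E x} (he : V.FrameOn e Set.univ)
    (heq : V.Equivariant e Set.univ) : IsIso V (trivial f (Module.finrank ℂ V.F)) := by
  let b : V.F ≃ₗ[ℂ] (Fin (Module.finrank ℂ V.F) → ℂ) := (Module.finBasis ℂ V.F).equivFun
  have hb : Continuous b := b.toLinearMap.continuous_of_finiteDimensional
  have hb' : Continuous b.symm := b.symm.toLinearMap.continuous_of_finiteDimensional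
  refine ⟨fun x => (e x).symm.trans b, ?_, ?_, fun x v => ?_⟩
  · exact (Bundle.Trivial.homeomorphProd X _).symm.continuous.comp
      ((FiberBundle.continuous_proj V.F V.E).prodMk (hb.comp he.continuous_symm))
  · have h := (Bundle.Trivial.homeomorphProd X (Fin (Module.finrank ℂ V.F) → ℂ)).continuous
    exact he.continuous_apply (continuous_fst.comp h) (hb'.comp (continuous_snd.comp h))
  · change b ((e (f x)).symm (V.φ x v)) = b ((e x).symm v)
    congr 1
    rw [LinearEquiv.symm_apply_eq, heq x (Set.mem_univ _), LinearEquiv.apply_symm_apply]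

theorem isIso_trivial_succ (f : TopInvolution X) (n : ℕ) :
    IsIso ((trivial f n).directSum (trivial f 1)) (trivial f (n + 1)) := by
  have h1 : ∀ m (v : Fin m → ℂ),
      Continuous fun x : X => (⟨x, v⟩ : Bundle.TotalSpace (trivial f m).F (trivial f m).E) :=
    fun m v => (Bundle.Trivial.homeomorphProd X (Fin m → ℂ)).symm.continuous.comp
      (continuous_id.prodMk continuous_const)
  have he : ((trivial f n).directSum (trivial f 1)).FrameOn
      (fun _ => LinearEquiv.refl ℂ ((Fin n → ℂ) × (Fin 1 → ℂ))) Set.univ := fun x _ v =>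
    (continuous_prod_total (trivial f n) (trivial f 1) (h1 n v.1)
      (h1 1 v.2)).continuousWithinAt
  have h2 := he.isIso_trivial fun x _ v => rfl
  have h3 : Module.finrank ℂ ((trivial f n).directSum (trivial f 1)).F = n + 1 := by
    change Module.finrank ℂ ((Fin n → ℂ) × (Fin 1 → ℂ)) = n + 1
    simp
  rwa [h3] at h2

theorem kClass_trivial (f : TopInvolution X) (n : ℕ) :
    (trivial f n).kClass = n • (trivial f 1).kClass := by
  induction n with
  | zero =>
    rw [zero_smul]
    exact map_zero (Algebra.GrothendieckAddGroup.of (M := IsoClass f))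
  | succ n ih =>
    have h1 : (trivial f (n + 1)).isoClass = (trivial f n).isoClass + (trivial f 1).isoClass :=
      (Quotient.sound (isIso_trivial_succ f n)).symm
    rw [succ_nsmul, ← ih, kClass, h1]
    exact map_add (Algebra.GrothendieckAddGroup.of (M := IsoClass f)) _ _

theorem FrameOn.reducedClass_eq_zero {e : ∀ x, V.F ≃ₗ[ℂ] V.E x} (he : V.FrameOn e Set.univ)
    (heq : V.Equivariant e Set.univ) : V.reducedClass = 0 := by
  have h1 : V.isoClass = (trivial f (Module.finrank ℂ V.F)).isoClass :=
    Quotient.sound (he.isIso_trivial heq)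
  have h2 : V.kClass = (trivial f (Module.finrank ℂ V.F)).kClass :=
    congrArg Algebra.GrothendieckAddGroup.of h1
  refine (QuotientAddGroup.eq_zero_iff _).2 ?_
  rw [h2, kClass_trivial f (Module.finrank ℂ V.F)]
  exact AddSubgroup.nsmul_mem (AddSubgroup.zmultiples (trivial f 1).kClass)
    (AddSubgroup.mem_zmultiples _) _

/-- The interval is infinite and finitely many radii are excluded. A radius above 1 covers a
neighbourhood independent of the singular set, and one below 3/2 stays in the recentred chart. -/
theorem exists_radius {Y : Type*} {S : Set Y} (hS : S.Finite) (κ : Y → ℂ) :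
    ∃ r : ℝ, 1 < r ∧ r < 3 / 2 ∧ ∀ x ∈ S, κ x ∉ Metric.sphere 0 r := by
  obtain ⟨r, hr, hr'⟩ := ((Set.Ioo_infinite (show (1 : ℝ) < 3 / 2 by norm_num)).sdiff
    (hS.image fun x => ‖κ x‖)).nonempty
  refine ⟨r, hr.1, hr.2, fun x hx h => hr' ⟨x, hx, ?_⟩⟩
  simpa using h

theorem HasFrame.empty : V.HasFrame ∅ ∅ where
  isClosed := isClosed_empty
  invariant _ := Iff.rfl
  finite := Set.finite_empty
  invariant_sing _ := Iff.rfl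
  exists_frame := ⟨fun x => (V.exists_linearEquiv x).some, fun _ h => h.1.elim,
    fun _ h => h.1.elim⟩

/-- Singularities near a point which is not fixed can be gathered at any nearby point. -/
theorem exists_nhds_of_ne [T2Space X] [ChartedSpace ℂ X] (hfix : FixesFibres f V.F V.φ) {x₀ : X}
    (hx : f x₀ ≠ x₀) :
    ∃ O : Set X, IsOpen O ∧ x₀ ∈ O ∧ ∀ q ∈ O, ∀ A S, V.HasFrame A S → ∃ A' S', A ∪ O ⊆ A' ∧
      q ∈ S' ∧ ((S ∩ O).Nonempty → S'.ncard ≤ S.ncard) ∧ V.HasFrame A' S' := by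
  obtain ⟨U, hUo, hxU, hUf, e, he, heq⟩ := exists_equivariant_frame hfix x₀
  obtain ⟨κ, hκU, hxκ, hκ0, hκ, hκf⟩ := f.exists_chart_of_ne hx (hUo.mem_nhds hxU)
  refine ⟨κ.source ∩ κ ⁻¹' Metric.ball 0 (1 / 2),
    κ.isOpen_inter_preimage Metric.isOpen_ball, ⟨hxκ, by simp [hκ0]⟩, ?_⟩
  rintro q ⟨hqκ, hq⟩ A S h
  rw [Set.mem_preimage, mem_ball_zero_iff] at hq
  -- The singularity produced by `move_free` sits at the centre of the chart, so the chart is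
  -- recentred at the prescribed point q.
  obtain ⟨κ', h1, h2, h3⟩ := κ.exists_recenter hκ hq.le
  obtain ⟨r, hr1, hr2, hrS⟩ := exists_radius h.finite κ'
  have h4 := h.move_free (zero_lt_one.trans hr1)
    ((Metric.closedBall_subset_closedBall hr2.le).trans h3) (h1 ▸ hκU) hUf he heq (h1 ▸ hκf)
    fun x hx _ => hrS x hx
  have h5 : κ'.symm 0 = q := by
    rw [← show κ' q = 0 by rw [h2, sub_self], κ'.left_inv (h1 ▸ hqκ)]
  rw [h5] at h4
  set D := κ'.source ∩ κ' ⁻¹' Metric.closedBall 0 r with hD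
  have hOD : κ.source ∩ κ ⁻¹' Metric.ball 0 (1 / 2) ⊆ D := by
    rintro x ⟨hx1, hx2⟩
    rw [Set.mem_preimage, mem_ball_zero_iff] at hx2
    refine ⟨h1 ▸ hx1, ?_⟩
    rw [Set.mem_preimage, mem_closedBall_zero_iff, h2]
    linarith [norm_sub_le (κ x) (κ q)]
  refine ⟨_, _, Set.union_subset_union_right A (hOD.trans Set.subset_union_left),
    Or.inr (Or.inl rfl), ?_, h4⟩
  rintro ⟨y, hyS, hyO⟩
  -- If a singularity y lies in O, then y and f y are two distinct singularities that disappear,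
  -- while at most the two points q and f q are added. So the number does not grow.
  have hne : y ≠ f y := fun hy => hκf y hyO.1 (hy ▸ hyO.1)
  have hsub : ({y, f y} : Set X) ⊆ S ∩ (D ∪ f ⁻¹' D) := by
    rintro z (rfl | rfl)
    · exact ⟨hyS, Or.inl (hOD hyO)⟩
    · refine ⟨(h.invariant_sing _).2 hyS, Or.inr ?_⟩
      rw [Set.mem_preimage, f.involutive y]
      exact hOD hyO
  have hc1 := Set.ncard_le_ncard hsub (h.finite.subset Set.inter_subset_left)
  rw [Set.ncard_pair hne] at hc1
  have hc2 := Set.ncard_inter_add_ncard_sdiff_eq_ncard S (D ∪ f ⁻¹' D) h.finite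
  have hc3 := Set.ncard_union_le (S \ (D ∪ f ⁻¹' D)) {q, f q}
  have hc4 : ({q, f q} : Set X).ncard ≤ 2 := Set.ncard_insert_le q {f q} |>.trans (by simp)
  omega

end EqBundle

/-! ### Removal of all singularities -/

section RealStructure

variable {X : Type*} [TopologicalSpace X] [T2Space X] [ChartedSpace ℂ X] [IsManifold 𝓘(ℂ) ω X]
  {f : RealStructure X} {V : EqBundle f.toTopInvolution}

namespace EqBundle

/-- Singularities near a fixed point can be removed. -/
theorem exists_nhds_of_eq (hfix : FixesFibres f.toTopInvolution V.F V.φ) {x₀ : X}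
    (hx : f x₀ = x₀) :
    ∃ O : Set X, IsOpen O ∧ x₀ ∈ O ∧ ∀ A S, V.HasFrame A S → ∃ A' S', A ∪ O ⊆ A' ∧
      S' ⊆ S \ O ∧ V.HasFrame A' S' := by
  obtain ⟨U, hUo, hxU, hUf, e, he, heq⟩ := exists_equivariant_frame hfix x₀
  obtain ⟨κ, hκU, hxκ, hκ0, hκ, hκf⟩ := f.exists_chart_of_eq hx (hUo.mem_nhds hxU)
  refine ⟨κ.source ∩ κ ⁻¹' Metric.ball 0 1,
    κ.isOpen_inter_preimage Metric.isOpen_ball, ⟨hxκ, by simp [hκ0]⟩, fun A S h => ?_⟩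
  obtain ⟨r, hr1, hr2, hrS⟩ := exists_radius h.finite κ
  have h4 := h.move_fixed (zero_lt_one.trans hr1)
    ((Metric.closedBall_subset_closedBall (by linarith)).trans hκ) hκU he heq hκf
    fun x hx _ => hrS x hx
  have hOD : κ.source ∩ κ ⁻¹' Metric.ball 0 1 ⊆ κ.source ∩ κ ⁻¹' Metric.closedBall 0 r :=
    Set.inter_subset_inter_right _ (Set.preimage_mono
      (Metric.ball_subset_closedBall.trans (Metric.closedBall_subset_closedBall hr1.le)))
  exact ⟨_, _, Set.union_subset_union_right A hOD, Set.sdiff_subset_sdiff_right hOD, h4⟩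

/-- Compactness induction on the sets s with the property that every frame with finitely many
singularities over some A can be changed into one over a set containing A ∪ s. The property passes
to unions because the frame is allowed to change on A. -/
theorem exists_hasFrame_univ [CompactSpace X] (hfix : FixesFibres f.toTopInvolution V.F V.φ) :
    ∃ S, V.HasFrame Set.univ S := by
  have key : ∀ A S, V.HasFrame A S → ∃ A' S', A ∪ Set.univ ⊆ A' ∧ V.HasFrame A' S' := by
    refine isCompact_univ.induction_on
      (p := fun s => ∀ A S, V.HasFrame A S → ∃ A' S', A ∪ s ⊆ A' ∧ V.HasFrame A' S')
      ?_ ?_ ?_ ?_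
    · exact fun A S h => ⟨A, S, by simp, h⟩
    · intro s t hst ht A S h
      obtain ⟨A', S', h1, h2⟩ := ht A S h
      exact ⟨A', S', (Set.union_subset_union_right A hst).trans h1, h2⟩
    · intro s t hs ht A S h
      obtain ⟨A', S', h1, h2⟩ := hs A S h
      obtain ⟨A'', S'', h3, h4⟩ := ht A' S' h2
      refine ⟨A'', S'', ?_, h4⟩
      rw [← Set.union_assoc]
      exact (Set.union_subset_union_left t h1).trans h3
    · intro x _
      by_cases hx : f x = x
      · obtain ⟨O, hO, hxO, h⟩ := exists_nhds_of_eq hfix hx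
        refine ⟨O, mem_nhdsWithin_of_mem_nhds (hO.mem_nhds hxO), fun A S hA => ?_⟩
        obtain ⟨A', S', h1, -, h2⟩ := h A S hA
        exact ⟨A', S', h1, h2⟩
      · obtain ⟨O, hO, hxO, h⟩ := exists_nhds_of_ne hfix hx
        refine ⟨O, mem_nhdsWithin_of_mem_nhds (hO.mem_nhds hxO), fun A S hA => ?_⟩
        obtain ⟨A', S', h1, -, -, h2⟩ := h x hxO A S hA
        exact ⟨A', S', h1, h2⟩
  obtain ⟨A', S', h1, h2⟩ := key ∅ ∅ HasFrame.empty
  have h3 : A' = Set.univ := Set.eq_univ_of_univ_subset (by simpa using h1)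
  exact ⟨S', h3 ▸ h2⟩

/-- On a connected surface with a fixed point all singularities of a frame can be removed: in a
frame with the least number of them, they could be moved to any point. -/
theorem hasFrame_univ_empty [CompactSpace X] [ConnectedSpace X] (hf : ∃ x, f x = x)
    (hfix : FixesFibres f.toTopInvolution V.F V.φ) : V.HasFrame Set.univ ∅ := by
  classical
  have hex : ∃ m, ∃ S, V.HasFrame Set.univ S ∧ S.ncard = m := by
    obtain ⟨S, hS⟩ := exists_hasFrame_univ hfix
    exact ⟨_, S, hS, rfl⟩
  obtain ⟨S, hS, hSm⟩ := Nat.find_spec hex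
  have hmin : ∀ S', V.HasFrame Set.univ S' → Nat.find hex ≤ S'.ncard := fun S' h =>
    Nat.find_min' hex ⟨S', h, rfl⟩
  set m := Nat.find hex with hm
  -- Q consists of the points that are singular for some frame with the least number of
  -- singularities. Near a fixed point Q is empty, since removal would lower the number; elsewhere
  -- it is locally all or nothing, since a singularity can be moved to any nearby point. By
  -- connectedness Q is empty.
  let Q : Set X := {x | ∃ S, V.HasFrame Set.univ S ∧ S.ncard = m ∧ x ∈ S}
  have hloc : ∀ x₀ : X, ∃ O : Set X, IsOpen O ∧ x₀ ∈ O ∧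
      ((O ∩ Q).Nonempty → f x₀ ≠ x₀ ∧ O ⊆ Q) := by
    intro x₀
    by_cases hx : f x₀ = x₀
    · obtain ⟨O, hO, hxO, h⟩ := exists_nhds_of_eq hfix hx
      refine ⟨O, hO, hxO, ?_⟩
      rintro ⟨y, hyO, T, hT, hTm, hyT⟩
      obtain ⟨A', T', h1, h2, h3⟩ := h _ _ hT
      rw [Set.univ_union, Set.univ_subset_iff] at h1
      have h4 : T'.ncard < T.ncard := Set.ncard_lt_ncard
        ⟨h2.trans Set.sdiff_subset, fun h' => (h2 (h' hyT)).2 hyO⟩ hT.finite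
      have h5 := hmin T' (h1 ▸ h3)
      omega
    · obtain ⟨O, hO, hxO, h⟩ := exists_nhds_of_ne hfix hx
      refine ⟨O, hO, hxO, ?_⟩
      rintro ⟨y, hyO, T, hT, hTm, hyT⟩
      refine ⟨hx, fun q hq => ?_⟩
      obtain ⟨A', T', h1, h2, h3, h4⟩ := h q hq _ _ hT
      rw [Set.univ_union, Set.univ_subset_iff] at h1
      subst h1
      exact ⟨T', h4, le_antisymm ((h3 ⟨y, hyT, hyO⟩).trans hTm.le) (hmin T' h4), h2⟩
  have hQ : IsClopen Q := by
    refine ⟨⟨isOpen_iff_forall_mem_open.2 fun x hx => ?_⟩,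
      isOpen_iff_forall_mem_open.2 fun x hx => ?_⟩
    · obtain ⟨O, hO, hxO, h⟩ := hloc x
      exact ⟨O, fun y hyO hyQ => hx ((h ⟨y, hyO, hyQ⟩).2 hxO), hO, hxO⟩
    · obtain ⟨O, hO, hxO, h⟩ := hloc x
      exact ⟨O, (h ⟨x, hxO, hx⟩).2, hO, hxO⟩
  have hQe : Q = ∅ := by
    rcases isClopen_iff.1 hQ with h | h
    · exact h
    · obtain ⟨x, hx⟩ := hf
      obtain ⟨O, hO, hxO, h'⟩ := hloc x
      exact absurd hx (h' ⟨x, hxO, h ▸ Set.mem_univ x⟩).1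
  have hSe : S = ∅ := by
    by_contra hne
    obtain ⟨x, hx⟩ := Set.nonempty_iff_ne_empty.2 hne
    have : x ∈ Q := ⟨S, hS, hSm, hx⟩
    rw [hQe] at this
    exact this
  exact hSe ▸ hS

end EqBundle

/-- Over a connected compact Riemann surface with an anti-holomorphic involution with fixed points,
an equivariant bundle is trivial in reduced K-theory if the lift acts trivially on the fibres over
the fixed points. -/
theorem reducedClass_eq_zero_of_fixesFibres [CompactSpace X] [ConnectedSpace X]
    (hf : ∃ x, f x = x) (hfix : FixesFibres f.toTopInvolution V.F V.φ) : V.reducedClass = 0 := by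
  obtain ⟨e, he, heq⟩ := (EqBundle.hasFrame_univ_empty hf hfix).exists_frame
  rw [Set.sdiff_empty] at he heq
  exact he.reducedClass_eq_zero heq

end RealStructure

/-! ### The main theorem -/

theorem theorem4p2
    {X : Type*} [TopologicalSpace X] [T2Space X] [CompactSpace X] [ConnectedSpace X]
    [ChartedSpace ℂ X] [IsManifold 𝓘(ℂ) ω X]
    (f : RealStructure X)
    {F : Type} [NormedAddCommGroup F] [NormedSpace ℂ F] [FiniteDimensional ℂ F]
    {V : X → Type} [∀ x, NormedAddCommGroup (V x)] [∀ x, InnerProductSpace ℂ (V x)]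
    [∀ x, FiniteDimensional ℂ (V x)] [TopologicalSpace (Bundle.TotalSpace F V)]
    [FiberBundle F V] [VectorBundle ℂ F V] [ContMDiffVectorBundle ∞ F V 𝓘(ℝ, ℂ)]
    (H : HitchinSolution F V) (φ : LiftedInvolution F V f)
    (hφ : H.PreservedBy φ) (hsimple : H.IsSimple) :
    ((∃ x, f x = x) →
      (H.ExtendsOverM f ↔
        φ.toEqBundle.reducedClass = 0 ∨ φ.toEqBundle.neg.reducedClass = 0)) ∧
    (φ.toEqBundle.reducedClass = 0 ∨ φ.toEqBundle.neg.reducedClass = 0 →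
      H.ExtendsOverM f) := by
  have hD := H.isFlatConnection_nabla
  have hpar := LiftedInvolution.preservesParallel hφ
  have hback : φ.toEqBundle.reducedClass = 0 ∨ φ.toEqBundle.neg.reducedClass = 0 →
      H.ExtendsOverM f := by
    rintro (h | h)
    · exact H.extendsOverM_of_lift φ.isLift
        (EqBundle.fixesFibres_of_reducedClass_eq_zero h) hpar
    · exact H.extendsOverM_of_lift φ.isLift.neg
        (EqBundle.fixesFibres_of_reducedClass_eq_zero h) (hpar.neg hD)
  refine ⟨fun hfix => ⟨fun hext => ?_, hback⟩, hback⟩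
  rcases HitchinSolution.fixesFibres_of_extendsOverM hsimple φ.isLift hpar hext with h | h
  · exact Or.inl (reducedClass_eq_zero_of_fixesFibres hfix h)
  · exact Or.inr (reducedClass_eq_zero_of_fixesFibres hfix h)
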